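/- For each $n$ let $Q$ be an $n\times n$ random symmetric matrix whose upper-triangular entries are independent, with $Q_{ii}\sim N(0,1)$ and $Q_{ij}=Q_{ji}\sim N(0,1/2)$ for $i<j$. Let $Z_{(1)}\le\cdots\le Z_{(n)}$ be the ordered diagonal entries, let $\pi$ be the (almost surely unique) permutation of $\{1,\dots,n\}$ with $Q_{\pi(r)\pi(r)}=Z_{(r)}$, and put $X_{ij}=Q_{\pi(i)\pi(j)}$ for $i<j$. For $1\le i<j\le n$ let $$\tau_{ij}=Z_{(1)}-\sqrt{(Z_{(i)}-Z_{(1)})(Z_{(j)}-Z_{(1)})},\qquad p_{ij}=\mathbb P\bigl(X_{ij}<\tau_{ij}\,\big|\,Z_{(1)},\dots,Z_{(n)}\bigr),$$ and let $q_n$ be the (almost surely) common value of $p_{1j}$, $2\le j\le n$. Define $$S_{3,n}=\sum_{3\le i<j\le n}p_{ij},\qquad W_n=(1-q_n)^{n-1}\prod_{j=3}^n(1-p_{2j}),\qquad B_n=\mathbb E\Bigl[W_n\Bigl(1-\prod_{3\le i<j\le n}(1-p_{ij})\Bigr)\Bigr].$$ Then, as $n\to\infty$, $$B_n=\Bigl(9\sqrt{\tfrac{\pi}{2}}+o(1)\Bigr)\frac1{n(\log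 n)^{3/2}},\qquad \mathbb E S_{3,n}=\Bigl(9\sqrt{\tfrac{\pi}{2}}+o(1)\Bigr)\frac1{n(\log n)^{3/2}},$$ and $$\mathbb E\bigl[S_{3,n}^2\bigr]=O\Bigl(\frac1{n^2\log n}\Bigr),\qquad \mathbb E\bigl[(1-W_n)S_{3,n}\bigr]=O\Bigl(\frac1{n^2\log n}\Bigr).$$ -/

import Mathlib

open MeasureTheory ProbabilityTheory Filter Asymptotics
open scoped Topology

namespace RandomStQP

/-- `Q` is a random `n × n` matrix with the (unnormalized) Gaussian Orthogonal Ensemble law: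
symmetric, with independent entries on and above the diagonal, standard normal on the diagonal
and centred normal of variance `1/2` off the diagonal. -/
structure IsGOE {n : ℕ} {Ω : Type*} [MeasurableSpace Ω] (P : Measure Ω)
    (Q : Ω → Matrix (Fin n) (Fin n) ℝ) : Prop where
  measurable : ∀ i j, Measurable fun ω => Q ω i j
  symm : ∀ ω, (Q ω).IsSymm
  diag_law : ∀ i, P.map (fun ω => Q ω i i) = gaussianReal 0 1
  offDiag_law : ∀ i j, i < j → P.map (fun ω => Q ω i j) = gaussianReal 0 (1 / 2)
  indep : iIndepFun (fun (e : {e : Fin n × Fin n // e.1 ≤ e.2}) ω => Q ω e.1.1 e.1.2) P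

/-- A permutation that sorts the diagonal of `A` in nondecreasing order (the only one when the
diagonal entries are distinct). Ranks are counted from `0`: the index `r` stands for
the rank `r + 1`. -/
noncomputable def sortPerm {n : ℕ} (A : Matrix (Fin n) (Fin n) ℝ) : Equiv.Perm (Fin n) :=
  Tuple.sort fun i => A i i

/-- The ordered diagonal entries `Z₍₁₎ ≤ ⋯ ≤ Z₍ₙ₎`. -/
noncomputable def orderedDiag {n : ℕ} (A : Matrix (Fin n) (Fin n) ℝ) (r : Fin n) : ℝ :=
  A (sortPerm A r) (sortPerm A r)

/-- The off-diagonal entries `X i j`, relabelled by the ordering of the diagonal. -/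
noncomputable def orderedEntry {n : ℕ} (A : Matrix (Fin n) (Fin n) ℝ) (i j : Fin n) : ℝ :=
  A (sortPerm A i) (sortPerm A j)

/-- The two-coordinate threshold
`τ i j = Z₍₁₎ - √((Z₍ᵢ₎ - Z₍₁₎) (Z₍ⱼ₎ - Z₍₁₎))`. -/
noncomputable def threshold {n : ℕ} (A : Matrix (Fin n) (Fin n) ℝ) (i j : Fin n) : ℝ :=
  orderedDiag A ⟨0, i.pos⟩ -
    √((orderedDiag A i - orderedDiag A ⟨0, i.pos⟩) *
      (orderedDiag A j - orderedDiag A ⟨0, i.pos⟩))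

section Random

variable {n : ℕ} {Ω : Type*} [MeasurableSpace Ω]

/-- The two-coordinate event `F i j = {X i j < τ i j}`. -/
def pairEvent (Q : Ω → Matrix (Fin n) (Fin n) ℝ) (i j : Fin n) : Set Ω :=
  {ω | orderedEntry (Q ω) i j < threshold (Q ω) i j}

/-- The σ-algebra generated by the ordered diagonal entries `Z₍₁₎, …, Z₍ₙ₎`. -/
noncomputable abbrev diagSigma (Q : Ω → Matrix (Fin n) (Fin n) ℝ) : MeasurableSpace Ω :=
  MeasurableSpace.comap (fun ω => orderedDiag (Q ω)) MeasurableSpace.pi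

/-- The conditional pair probability `p i j = P(F i j | Z₍₁₎, …, Z₍ₙ₎)`. -/
noncomputable def pairProb (P : Measure Ω) (Q : Ω → Matrix (Fin n) (Fin n) ℝ)
    (i j : Fin n) : Ω → ℝ :=
  P⟦pairEvent Q i j | diagSigma Q⟧

/-- `qₙ = P(F 1 j | Z₍₁₎, …, Z₍ₙ₎)`, which does not depend on the rank `j ≥ 2` up to
almost sure equality; it is taken at `j = 2`. It has no meaning for `n < 2`. -/
noncomputable def minPairProb (P : Measure Ω) (Q : Ω → Matrix (Fin n) (Fin n) ℝ) : Ω → ℝ :=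
  if h : 2 ≤ n then pairProb P Q ⟨0, by omega⟩ ⟨1, by omega⟩ else 0

/-- The pairs of ranks `(2, j)` with `3 ≤ j ≤ n` (indices counted from `0`). -/
def secondPairs (n : ℕ) : Finset (Fin n × Fin n) :=
  {e | e.1.val = 1 ∧ 2 ≤ e.2.val}

/-- The pairs of ranks `(i, j)` with `3 ≤ i < j ≤ n` (indices counted from `0`). -/
def remainingPairs (n : ℕ) : Finset (Fin n × Fin n) :=
  {e | 2 ≤ e.1.val ∧ e.1 < e.2}

/-- `S₃ₙ = ∑_{3 ≤ i < j ≤ n} p i j`. -/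
noncomputable def remainingSum (P : Measure Ω) (Q : Ω → Matrix (Fin n) (Fin n) ℝ)
    (ω : Ω) : ℝ :=
  ∑ e ∈ remainingPairs n, pairProb P Q e.1 e.2 ω

/-- `Wₙ = (1 - qₙ)ⁿ⁻¹ ∏_{j = 3}^n (1 - p 2 j)`. -/
noncomputable def prefactor (P : Measure Ω) (Q : Ω → Matrix (Fin n) (Fin n) ℝ)
    (ω : Ω) : ℝ :=
  (1 - minPairProb P Q ω) ^ (n - 1) * ∏ e ∈ secondPairs n, (1 - pairProb P Q e.1 e.2 ω)

/-- `Bₙ = E[(1 - qₙ)ⁿ⁻¹ ∏_{j = 3}^n (1 - p 2 j) (1 - ∏_{3 ≤ i < j ≤ n} (1 - p i j))]`. -/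
noncomputable def termB (P : Measure Ω) (Q : Ω → Matrix (Fin n) (Fin n) ℝ) : ℝ :=
  ∫ ω, prefactor P Q ω * (1 - ∏ e ∈ remainingPairs n, (1 - pairProb P Q e.1 e.2 ω)) ∂P

end Random

end RandomStQP

namespace RandomStQP

/-! Given the diagonal, the entry behind `X i j` is an off-diagonal entry selected by the sorting
permutation. It is independent of the diagonal, so `p i j` is the normal tail `pairFn` evaluated at
the ordered values (`IsGOE.pairProb_ae_eq`), and everything becomes a question about the order
statistics of `n` standard normal variables.

Let `v < x` be the two smallest values. Choosing a remaining pair means choosing four sample points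
`v < x < a < b` with all other points above `x`. Hence the mean of the sum is `n (n-1) (n-2) (n-3)`
times the integral over `x` of `(1 - Phi x) ^ (n - 4) * tripleMass x` (`lintegral_rankSum_eq`). For
`x = -m` with `m` large, put `v = -m - s / m^3`, `a = -m + t / m^3` and leave `b` of order one. The
threshold is then close to `-m - √(s + t) / m`, and the pair probability is close to `tailFactor m *
exp (-2 √(s + t))`: the pairs that count join a value just above the minimum to a typical value. The
integral of `exp (-2 √(s + t))` over the quadrant is `3/4`, and `kernel_le` provides the domination.

With `u = Phi (-m)`, which is asymptotic to `phi m / m`, and `m^2` asymptotic to `2 log (1/u)`, this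
gives `tripleMass (-m)` asymptotic to `√π 2^(-3/2) (3/4) u^4 (log (1/u))^(-3/2)`. The Abelian
theorem `tendsto_integral_one_sub_pow_mul` turns `u^4` into `4! / n^5`, and `4! · (3/4) · √π ·
2^(-3/2) = 9 √(π/2)`.

For the error terms, every pair probability is at most `q = Phi (√2 v)`. In the square of the sum,
pairs sharing an index contribute at most `4 n q` times the sum, while disjoint pairs lead to a
six-point integral (`lintegral_rankSum_sq_le`). Likewise `1 - W ≤ 2 n q` by Bernoulli
(`one_sub_prefFn_le`). The mean of `q` times the sum has order `1 / (n^3 log n)`, and both bounds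
follow. Finally `|W (1 - ∏ (1 - p)) - S| ≤ (1 - W) S + S^2` (`abs_termFn_sub_rankSum_le`) shows that
`B` has the same asymptotics as the mean of `S`. -/

/-- The distribution function of the standard normal law. -/
noncomputable def Phi (x : ℝ) : ℝ := (gaussianReal 0 1).real (Set.Iic x)

/-- The probability that a centred normal variable of variance `1/2` falls below the threshold
`v - √((a - v) (b - v))`. -/
noncomputable def pairFn (v a b : ℝ) : ℝ := Phi (√2 * (v - √((a - v) * (b - v))))

/-- The nondecreasing rearrangement of a tuple. -/
noncomputable def sorted {n : ℕ} (d : Fin n → ℝ) : Fin n → ℝ := d ∘ Tuple.sort d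

/-! ### The normal distribution function, and measurability of sorting. -/

lemma Phi_mono : Monotone Phi := fun _ _ h => measureReal_mono (Set.Iic_subset_Iic.2 h)

lemma Phi_nonneg (x : ℝ) : 0 ≤ Phi x := measureReal_nonneg

lemma Phi_le_one (x : ℝ) : Phi x ≤ 1 := measureReal_le_one

lemma measurable_Phi : Measurable Phi := Phi_mono.measurable

lemma pairFn_nonneg (v a b : ℝ) : 0 ≤ pairFn v a b := Phi_nonneg _

lemma pairFn_le_one (v a b : ℝ) : pairFn v a b ≤ 1 := Phi_le_one _

@[fun_prop]
lemma measurable_pairFn {α : Type*} [MeasurableSpace α] {f g h : α → ℝ} (hf : Measurable f)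
    (hg : Measurable g) (hh : Measurable h) : Measurable fun x => pairFn (f x) (g x) (h x) :=
  measurable_Phi.comp (by fun_prop)

lemma gaussianReal_half_Iio (t : ℝ) : (gaussianReal 0 (1 / 2)).real (Set.Iio t) = Phi (√2 * t) := by
  have h2 : (gaussianReal 0 (1 / 2)).map (√2 * ·) = gaussianReal 0 1 := by
    rw [gaussianReal_map_const_mul]
    congr 1
    · simp
    · ext; simp
  rw [Phi, ← h2, map_measureReal_apply (by fun_prop) measurableSet_Iic]
  have h1 : (√2 * ·) ⁻¹' Set.Iic (√2 * t) = Set.Iic t := by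
    ext x; simp
  rw [h1]
  have h0 : NullSingletonClass (gaussianReal 0 (1 / 2)) :=
    nullSingletonClass_gaussianReal (by simp)
  exact measureReal_congr Iio_ae_eq_Iic

/-- `Tuple.sort` is characterised by finitely many comparisons (values nondecreasing along it, ties
broken by index), so each cell is measurable. -/
lemma measurableSet_sort_eq {n : ℕ} (σ : Equiv.Perm (Fin n)) :
    MeasurableSet {d : Fin n → ℝ | Tuple.sort d = σ} := by
  have : {d : Fin n → ℝ | Tuple.sort d = σ} = {d | ∀ i j, i ≤ j → d (σ i) ≤ d (σ j)} ∩
      {d | ∀ i j, i < j → d (σ i) = d (σ j) → σ i < σ j} := by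
    ext d
    rw [Set.mem_ofPred_eq, eq_comm, Tuple.eq_sort_iff]
    rfl
  rw [this]
  refine MeasurableSet.inter ?_ ?_
  · refine measurableSet_setOfPred.2 (Measurable.forall fun i => .forall fun j =>
      Measurable.imp measurable_const ?_)
    exact measurableSet_setOfPred.1 (measurableSet_le (by fun_prop) (by fun_prop))
  · refine measurableSet_setOfPred.2
      (Measurable.forall fun i => .forall fun j =>
        Measurable.imp measurable_const (Measurable.imp ?_ measurable_const))
    exact measurableSet_setOfPred.1 (measurableSet_eq_fun (by fun_prop) (by fun_prop))

lemma measurable_sorted {n : ℕ} : Measurable (sorted (n := n)) := by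
  refine measurable_pi_lambda _ fun r => ?_
  have : (fun d : Fin n → ℝ => sorted d r) =
      fun d => ∑ σ : Equiv.Perm (Fin n), if Tuple.sort d = σ then d (σ r) else 0 := by
    ext d; simp [sorted]
  rw [this]
  exact Finset.measurable_sum _ fun σ _ =>
    Measurable.ite (measurableSet_sort_eq σ) (by fun_prop) (by fun_prop)

/-- Fubini for the product law of `(X, Y)`: integrating out `X` first leaves its law of a half-line
ending at `T Y`. It identifies a conditional probability given `Y` by testing on `Y ⁻¹' c`. -/
lemma setIntegral_indicator_lt_of_indepFun {Ω E : Type*} [MeasurableSpace Ω] [MeasurableSpace E]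
    {P : Measure Ω} [IsProbabilityMeasure P] {X : Ω → ℝ} {Y : Ω → E} (hX : Measurable X)
    (hY : Measurable Y) (h : IndepFun X Y P) {T : E → ℝ} (hT : Measurable T) {c : Set E}
    (hc : MeasurableSet c) :
    ∫ ω in Y ⁻¹' c, {ω | X ω < T (Y ω)}.indicator (fun _ => (1 : ℝ)) ω ∂P =
      ∫ ω in Y ⁻¹' c, (P.map X).real (Set.Iio (T (Y ω))) ∂P := by
  have hlaw := (indepFun_iff_map_prod_eq_prod_map_map hX.aemeasurable hY.aemeasurable).1 h
  have : IsProbabilityMeasure (P.map X) := Measure.isProbabilityMeasure_map hX.aemeasurable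
  have : IsProbabilityMeasure (P.map Y) := Measure.isProbabilityMeasure_map hY.aemeasurable
  have hA : MeasurableSet {z : ℝ × E | z.1 < T z.2} :=
    measurableSet_lt measurable_fst (hT.comp measurable_snd)
  have hm : Measurable fun y => (P.map X).real (Set.Iio (T y)) := by
    have : Monotone fun t => (P.map X).real (Set.Iio t) := fun a b hab =>
      measureReal_mono (Set.Iio_subset_Iio hab)
    exact this.measurable.comp hT
  rw [← setIntegral_map (f := fun y => (P.map X).real (Set.Iio (T y))) hc
    hm.aestronglyMeasurable hY.aemeasurable]
  have hset : (∫ ω in Y ⁻¹' c, {ω | X ω < T (Y ω)}.indicator (fun _ => (1 : ℝ)) ω ∂P) =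
      ∫ z, ({z : ℝ × E | z.1 < T z.2} ∩ (Prod.snd ⁻¹' c)).indicator (fun _ => (1 : ℝ)) z
        ∂(P.map fun ω => (X ω, Y ω)) := by
    rw [integral_map (hX.prodMk hY).aemeasurable, ← integral_indicator (hY hc)]
    · congr 1; ext ω
      by_cases h1 : X ω < T (Y ω) <;> by_cases h2 : Y ω ∈ c <;> simp [Set.indicator, h1, h2]
    · exact (measurable_const.indicator (hA.inter (measurable_snd hc))).aestronglyMeasurable
  rw [hset, hlaw, integral_prod_symm, ← integral_indicator hc]
  · congr 1; ext y
    by_cases h2 : y ∈ c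
    · have : (fun x => ({z : ℝ × E | z.1 < T z.2} ∩ (Prod.snd ⁻¹' c)).indicator
          (fun _ => (1 : ℝ)) (x, y)) = (Set.Iio (T y)).indicator 1 := by
        ext x; by_cases h1 : x < T y <;> simp [Set.indicator, h1, h2]
      rw [this, integral_indicator_one measurableSet_Iio, Set.indicator_of_mem h2]
    · simp [Set.indicator, h2]
  · exact (integrable_const 1).indicator (hA.inter (measurable_snd hc))

/-! ### Conditional pair probabilities as functions of the ordered diagonal. -/

section GOE

variable {n : ℕ} {Ω : Type*} [MeasurableSpace Ω] {P : Measure Ω}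
  {Q : Ω → Matrix (Fin n) (Fin n) ℝ}

lemma IsGOE.measurable_diag (hQ : IsGOE P Q) : Measurable fun ω i => Q ω i i :=
  measurable_pi_lambda _ fun i => hQ.measurable i i

lemma IsGOE.map_diag [IsProbabilityMeasure P] (hQ : IsGOE P Q) :
    P.map (fun ω i => Q ω i i) = Measure.pi fun _ : Fin n => gaussianReal 0 1 := by
  have h := hQ.indep.precomp (g := fun i : Fin n => ⟨(i, i), le_refl i⟩)
    (fun i j hij => by simpa using hij)
  have h' := (iIndepFun_iff_map_fun_eq_pi_map (fun i => (hQ.measurable i i).aemeasurable)).1 h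
  rw [h']
  congr 1
  ext1 i
  exact hQ.diag_law i

lemma IsGOE.indepFun_diag (hQ : IsGOE P Q) {k l : Fin n} (hkl : k ≠ l) :
    IndepFun (fun ω => Q ω k l) (fun ω i => Q ω i i) P := by
  wlog h : k < l generalizing k l
  · have := this hkl.symm (lt_of_le_of_ne (not_lt.1 h) hkl.symm)
    have hs : (fun ω => Q ω k l) = fun ω => Q ω l k := by
      ext ω; exact (hQ.symm ω).apply l k
    rwa [hs]
  classical
  have h1 := hQ.indep.indepFun_finset
    {(⟨(k, l), h.le⟩ : {e : Fin n × Fin n // e.1 ≤ e.2})}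
    (Finset.univ.image fun i : Fin n => (⟨(i, i), le_refl i⟩ : {e : Fin n × Fin n // e.1 ≤ e.2}))
    (by
      rw [Finset.disjoint_singleton_left]
      simp only [Finset.mem_image, Finset.mem_univ, true_and, Subtype.mk.injEq, Prod.mk.injEq,
        not_exists, not_and]
      rintro i rfl; exact hkl)
    (fun e => hQ.measurable _ _)
  refine h1.comp (φ := fun f => f ⟨⟨(k, l), h.le⟩, Finset.mem_singleton_self _⟩)
    (ψ := fun f (i : Fin n) => f ⟨⟨(i, i), le_refl i⟩,
      Finset.mem_image_of_mem _ (Finset.mem_univ i)⟩)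
    ?_ ?_
  · exact measurable_pi_apply _
  · exact measurable_pi_lambda _ fun i => measurable_pi_apply _

lemma IsGOE.map_offDiag (hQ : IsGOE P Q) {k l : Fin n} (hkl : k ≠ l) :
    P.map (fun ω => Q ω k l) = gaussianReal 0 (1 / 2) := by
  rcases lt_or_gt_of_ne hkl with h | h
  · exact hQ.offDiag_law k l h
  · have hs : (fun ω => Q ω k l) = fun ω => Q ω l k := by
      ext ω; exact (hQ.symm ω).apply l k
    rw [hs]; exact hQ.offDiag_law l k h

/-- The value of `pairProb` as a function of the ordered diagonal. -/
noncomputable def rankFn (i j : Fin n) (z : Fin n → ℝ) : ℝ := pairFn (z ⟨0, i.pos⟩) (z i) (z j)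

lemma measurable_rankFn (i j : Fin n) : Measurable (rankFn i j) := by
  unfold rankFn; fun_prop

lemma rankFn_nonneg (i j : Fin n) (z : Fin n → ℝ) : 0 ≤ rankFn i j z := pairFn_nonneg _ _ _

lemma rankFn_le_one (i j : Fin n) (z : Fin n → ℝ) : rankFn i j z ≤ 1 := pairFn_le_one _ _ _

lemma IsGOE.measurable_orderedDiag (hQ : IsGOE P Q) : Measurable fun ω => orderedDiag (Q ω) :=
  measurable_sorted.comp hQ.measurable_diag

lemma mem_pairEvent_iff {Ω : Type*} {Q : Ω → Matrix (Fin n) (Fin n) ℝ} (i j : Fin n)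
    (σ : Equiv.Perm (Fin n)) {ω : Ω}
    (hω : Tuple.sort (fun i => Q ω i i) = σ) :
    ω ∈ pairEvent Q i j ↔ Q ω (σ i) (σ j) < sorted (fun i => Q ω i i) ⟨0, i.pos⟩ -
      √((sorted (fun i => Q ω i i) i - sorted (fun i => Q ω i i) ⟨0, i.pos⟩) *
      (sorted (fun i => Q ω i i) j - sorted (fun i => Q ω i i) ⟨0, i.pos⟩)) := by
  subst hω
  rfl

lemma IsGOE.measurableSet_pairEvent (hQ : IsGOE P Q) (i j : Fin n) :
    MeasurableSet (pairEvent Q i j) := by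
  have h : pairEvent Q i j = ⋃ σ : Equiv.Perm (Fin n), {ω | Tuple.sort (fun i => Q ω i i) = σ} ∩
      {ω | Q ω (σ i) (σ j) < sorted (fun i => Q ω i i) ⟨0, i.pos⟩ -
      √((sorted (fun i => Q ω i i) i - sorted (fun i => Q ω i i) ⟨0, i.pos⟩) *
      (sorted (fun i => Q ω i i) j - sorted (fun i => Q ω i i) ⟨0, i.pos⟩))} := by
    ext ω
    simp only [Set.mem_iUnion, Set.mem_inter_iff, Set.mem_ofPred_eq, exists_eq_left']
    exact mem_pairEvent_iff i j _ rfl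
  rw [h]
  have hs := fun r => (measurable_pi_apply r).comp (measurable_sorted.comp hQ.measurable_diag)
  refine MeasurableSet.iUnion fun σ => ?_
  refine (hQ.measurable_diag (measurableSet_sort_eq σ)).inter ?_
  exact measurableSet_lt (hQ.measurable _ _)
    ((hs _).sub (((hs _).sub (hs _)).mul ((hs _).sub (hs _))).sqrt)

/-- The relabelled entry is not a fixed matrix entry, so the space is cut into cells on which the
sorting permutation `σ` is constant. On a cell it is `Q (σ i) (σ j)`, which is independent of the
diagonal. A cell need not lie in `diagSigma Q`; lying in the σ-algebra of the unsorted diagonal is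
enough for Fubini, and only the sum over the cells is tested. -/
lemma IsGOE.pairProb_ae_eq [IsProbabilityMeasure P] (hQ : IsGOE P Q) {i j : Fin n} (hij : i ≠ j) :
    pairProb P Q i j =ᵐ[P] fun ω => rankFn i j (orderedDiag (Q ω)) := by
  symm
  have hZ := hQ.measurable_orderedDiag
  have hm := hZ.comap_le
  have hd := hQ.measurable_diag
  have hInt : Integrable (fun ω => rankFn i j (orderedDiag (Q ω))) P :=
    Integrable.of_bound ((measurable_rankFn i j).comp hZ).aestronglyMeasurable 1
      (ae_of_all _ fun ω => by
        rw [Real.norm_of_nonneg (rankFn_nonneg _ _ _)]; exact rankFn_le_one _ _ _)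
  have hInt' : Integrable ((pairEvent Q i j).indicator fun _ => (1 : ℝ)) P :=
    (integrable_const 1).indicator (hQ.measurableSet_pairEvent i j)
  refine ae_eq_condExp_of_forall_setIntegral_eq hm hInt' (fun _ _ _ => hInt.integrableOn) ?_ ?_
  · rintro s ⟨B, hB, rfl⟩ -
    have hcov : (fun ω => orderedDiag (Q ω)) ⁻¹' B = ⋃ σ : Equiv.Perm (Fin n),
        (fun ω i => Q ω i i) ⁻¹' ({d | Tuple.sort d = σ} ∩ sorted ⁻¹' B) := by
      ext ω
      simp only [Set.mem_preimage, Set.mem_iUnion, Set.mem_inter_iff, Set.mem_ofPred_eq,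
        exists_eq_left']
      rfl
    have hmeas : ∀ σ : Equiv.Perm (Fin n), MeasurableSet
        ({d : Fin n → ℝ | Tuple.sort d = σ} ∩ sorted ⁻¹' B) := fun σ =>
      (measurableSet_sort_eq σ).inter (measurable_sorted hB)
    have hdisj : Pairwise (Function.onFun Disjoint fun σ : Equiv.Perm (Fin n) =>
        (fun ω i => Q ω i i) ⁻¹' ({d | Tuple.sort d = σ} ∩ sorted ⁻¹' B)) := by
      intro σ τ hne
      refine Set.disjoint_left.2 fun ω h1 h2 => hne ?_
      exact h1.1.symm.trans h2.1
    rw [hcov, integral_iUnion_fintype (fun σ => hd (hmeas σ)) hdisj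
      (fun _ => hInt.integrableOn), integral_iUnion_fintype (fun σ => hd (hmeas σ)) hdisj
      (fun _ => hInt'.integrableOn)]
    refine Finset.sum_congr rfl fun σ _ => ?_
    have hne : σ i ≠ σ j := fun h => hij (σ.injective h)
    have hT : Measurable fun d : Fin n → ℝ => sorted d ⟨0, i.pos⟩ -
        √((sorted d i - sorted d ⟨0, i.pos⟩) * (sorted d j - sorted d ⟨0, i.pos⟩)) := by
      have hs := fun r => (measurable_pi_apply r).comp (measurable_sorted (n := n))
      exact (hs _).sub (((hs _).sub (hs _)).mul ((hs _).sub (hs _))).sqrt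
    have key := setIntegral_indicator_lt_of_indepFun (hQ.measurable (σ i) (σ j)) hd
      (hQ.indepFun_diag hne) hT (hmeas σ)
    rw [hQ.map_offDiag hne] at key
    simp only [gaussianReal_half_Iio] at key
    refine Eq.trans ?_ (key.symm.trans ?_)
    · rfl
    · refine setIntegral_congr_fun (hd (hmeas σ)) fun ω hω => ?_
      have h := mem_pairEvent_iff i j σ hω.1
      exact Set.indicator_const_eq_indicator_const (c := (1 : ℝ)) h.symm
  · have : Measurable[diagSigma Q] fun ω => orderedDiag (Q ω) := comap_measurable _
    exact ((measurable_rankFn i j).comp this).stronglyMeasurable.aestronglyMeasurable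

end GOE

/-! ### Integrals over selected coordinates of a normal sample. -/

open scoped ENNReal

lemma gaussianReal_Ioi (x : ℝ) : gaussianReal 0 1 (Set.Ioi x) = ENNReal.ofReal (1 - Phi x) := by
  rw [← Set.compl_Iic, prob_compl_eq_one_sub measurableSet_Iic, Phi,
    ENNReal.ofReal_sub _ measureReal_nonneg, ofReal_measureReal, ENNReal.ofReal_one]

section Embedding

variable {k n : ℕ}

lemma card_compl_range (e : Fin k ↪ Fin n) :
    Fintype.card {y // ¬ y ∈ Set.range e} = n - k := by
  classical
  have h : Fintype.card {y // y ∈ Set.range e} = k := by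
    rw [← Fintype.card_congr (Equiv.ofInjective e e.injective), Fintype.card_fin]
  rw [Fintype.card_subtype_compl, h, Fintype.card_fin]

open Classical in
/-- The integral of a function of the coordinates selected by `e`, on the event that all other
coordinates exceed the coordinate `e i₀`. -/
lemma lintegral_embedding (e : Fin k ↪ Fin n) (i₀ : Fin k) {g : (Fin k → ℝ) → ℝ≥0∞}
    (hg : Measurable g) :
    ∫⁻ d : Fin n → ℝ, (if ∀ y, y ∉ Set.range e → d (e i₀) < d y then g (d ∘ e) else 0)
        ∂(Measure.pi fun _ => gaussianReal 0 1) =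
      ∫⁻ t : Fin k → ℝ, g t * ENNReal.ofReal ((1 - Phi (t i₀)) ^ (n - k))
        ∂(Measure.pi fun _ => gaussianReal 0 1) := by
  have h1 := measurePreserving_piEquivPiSubtypeProd (fun _ : Fin n => gaussianReal 0 1)
    (fun y => y ∈ Set.range e)
  let f : (({y // y ∈ Set.range e} → ℝ) × ({y // ¬ y ∈ Set.range e} → ℝ)) → ℝ≥0∞ := fun p =>
    if ∀ y, p.1 ⟨e i₀, Set.mem_range_self i₀⟩ < p.2 y then
      g (fun i => p.1 ⟨e i, Set.mem_range_self i⟩) else 0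
  have hf : Measurable f := by
    refine Measurable.ite ?_ (hg.comp (by fun_prop)) measurable_const
    refine measurableSet_setOfPred.2 (Measurable.forall fun y => ?_)
    exact measurableSet_setOfPred.1 (measurableSet_lt (by fun_prop) (by fun_prop))
  have hstep : ∀ d : Fin n → ℝ, (if ∀ y, y ∉ Set.range e → d (e i₀) < d y then g (d ∘ e) else 0) =
      f (MeasurableEquiv.piEquivPiSubtypeProd (fun _ => ℝ) (fun y => y ∈ Set.range e) d) := by
    intro d
    simp only [f, Subtype.forall]
    rfl
  simp_rw [hstep]
  rw [h1.lintegral_comp hf, lintegral_prod _ hf.aemeasurable]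
  -- With the selected coordinates frozen, the other `n - k` coordinates exceed the level
  -- independently, each with probability `1 - Phi`.
  have hin : ∀ d₁ : {y // y ∈ Set.range e} → ℝ,
      ∫⁻ d₂, f (d₁, d₂) ∂(Measure.pi fun _ : {y // ¬ y ∈ Set.range e} => gaussianReal 0 1) =
        g (fun i => d₁ ⟨e i, Set.mem_range_self i⟩) *
          ENNReal.ofReal ((1 - Phi (d₁ ⟨e i₀, Set.mem_range_self i₀⟩)) ^ (n - k)) := by
    intro d₁
    have hs : MeasurableSet (Set.univ.pi fun _ : {y // ¬ y ∈ Set.range e} =>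
        Set.Ioi (d₁ ⟨e i₀, Set.mem_range_self i₀⟩)) := .univ_pi fun _ => measurableSet_Ioi
    have : (fun d₂ => f (d₁, d₂)) = (Set.univ.pi fun _ : {y // ¬ y ∈ Set.range e} =>
        Set.Ioi (d₁ ⟨e i₀, Set.mem_range_self i₀⟩)).indicator fun _ =>
          g (fun i => d₁ ⟨e i, Set.mem_range_self i⟩) := by
      ext d₂
      simp [f, Set.indicator, Set.mem_pi]
    rw [this, lintegral_indicator_const hs, Measure.pi_pi]
    simp only [gaussianReal_Ioi, Finset.prod_const, Finset.card_univ]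
    rw [card_compl_range,
      ENNReal.ofReal_pow (by linarith [Phi_le_one (d₁ ⟨e i₀, Set.mem_range_self i₀⟩)])]
  simp_rw [hin]
  have h2 := measurePreserving_piCongrLeft
    (fun _ : {y // y ∈ Set.range e} => gaussianReal 0 1) (Equiv.ofInjective e e.injective)
  have hm : Measurable fun d₁ : {y // y ∈ Set.range e} → ℝ =>
      g (fun i => d₁ ⟨e i, Set.mem_range_self i⟩) *
      ENNReal.ofReal ((1 - Phi (d₁ ⟨e i₀, Set.mem_range_self i₀⟩)) ^ (n - k)) := by
    refine (hg.comp (by fun_prop)).mul (ENNReal.measurable_ofReal.comp ?_)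
    exact (measurable_const.sub (measurable_Phi.comp (by fun_prop))).pow_const _
  refine (Eq.trans (by congr!) (h2.lintegral_comp hm).symm).trans (lintegral_congr fun t => ?_)
  have : ∀ i : Fin k, MeasurableEquiv.piCongrLeft (fun _ => ℝ)
      (Equiv.ofInjective e e.injective) t ⟨e i, Set.mem_range_self i⟩ = t i := fun i =>
    Equiv.piCongrLeft_apply_apply (P := fun _ => ℝ) (Equiv.ofInjective e e.injective) t i
  simp only [this]

end Embedding

lemma lintegral_pi_succ {k : ℕ} {f : (Fin (k + 1) → ℝ) → ℝ≥0∞} (hf : Measurable f) :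
    ∫⁻ t, f t ∂(Measure.pi fun _ => gaussianReal 0 1) =
      ∫⁻ x, ∫⁻ t, f (Matrix.vecCons x t) ∂(Measure.pi fun _ => gaussianReal 0 1)
        ∂(gaussianReal 0 1) := by
  have h := (measurePreserving_piFinSuccAbove (fun _ : Fin (k + 1) => gaussianReal 0 1) 0).symm
  rw [← h.lintegral_comp hf, lintegral_prod
    (fun z => f ((MeasurableEquiv.piFinSuccAbove (fun _ => ℝ) 0).symm z))
    (hf.comp h.measurable).aemeasurable]
  simp only [MeasurableEquiv.piFinSuccAbove_symm_apply, Fin.insertNthEquiv, Fin.insertNth_zero',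
    Equiv.coe_fn_mk]
  rfl

lemma lintegral_pi_zero (f : (Fin 0 → ℝ) → ℝ≥0∞) :
    ∫⁻ t, f t ∂(Measure.pi fun _ => gaussianReal 0 1) = f ![] := by
  rw [Measure.pi_of_empty (x := ![]), lintegral_dirac]

@[fun_prop]
lemma measurable_vecCons {α : Type*} [MeasurableSpace α] {k : ℕ} {f : α → ℝ} {g : α → Fin k → ℝ}
    (hf : Measurable f) (hg : Measurable g) : Measurable fun a => Matrix.vecCons (f a) (g a) := by
  refine measurable_pi_lambda _ fun i => ?_
  refine Fin.cases ?_ (fun i => ?_) i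
  · simpa using hf
  · simp only [Matrix.cons_val_succ]
    exact (measurable_pi_apply i).comp hg

lemma lintegral_pi_four {f : (Fin 4 → ℝ) → ℝ≥0∞} (hf : Measurable f) :
    ∫⁻ t, f t ∂(Measure.pi fun _ => gaussianReal 0 1) =
      ∫⁻ v, ∫⁻ x, ∫⁻ a, ∫⁻ b, f ![v, x, a, b] ∂(gaussianReal 0 1) ∂(gaussianReal 0 1)
        ∂(gaussianReal 0 1) ∂(gaussianReal 0 1) := by
  rw [lintegral_pi_succ hf]
  refine lintegral_congr fun v => ?_
  rw [lintegral_pi_succ (by fun_prop)]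
  refine lintegral_congr fun x => ?_
  rw [lintegral_pi_succ (by fun_prop)]
  refine lintegral_congr fun a => ?_
  rw [lintegral_pi_succ (by fun_prop)]
  refine lintegral_congr fun b => ?_
  rw [lintegral_pi_zero]

lemma lintegral_pi_six {f : (Fin 6 → ℝ) → ℝ≥0∞} (hf : Measurable f) :
    ∫⁻ t, f t ∂(Measure.pi fun _ => gaussianReal 0 1) =
      ∫⁻ v, ∫⁻ x, ∫⁻ a, ∫⁻ b, ∫⁻ a', ∫⁻ b', f ![v, x, a, b, a', b'] ∂(gaussianReal 0 1)
        ∂(gaussianReal 0 1) ∂(gaussianReal 0 1) ∂(gaussianReal 0 1)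
        ∂(gaussianReal 0 1) ∂(gaussianReal 0 1) := by
  rw [lintegral_pi_succ hf]
  refine lintegral_congr fun v => ?_
  rw [lintegral_pi_succ (by fun_prop)]
  refine lintegral_congr fun x => ?_
  rw [lintegral_pi_succ (by fun_prop)]
  refine lintegral_congr fun a => ?_
  rw [lintegral_pi_succ (by fun_prop)]
  refine lintegral_congr fun b => ?_
  rw [lintegral_pi_succ (by fun_prop)]
  refine lintegral_congr fun a' => ?_
  rw [lintegral_pi_succ (by fun_prop)]
  refine lintegral_congr fun b' => ?_
  rw [lintegral_pi_zero]

/-! ### Sums over ranks rewritten as sums over embeddings. -/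

/-- The sum of the pair probabilities over the remaining pairs, as a function of the ordered
diagonal. -/
noncomputable def rankSum {n : ℕ} (z : Fin n → ℝ) : ℝ := ∑ e ∈ remainingPairs n, rankFn e.1 e.2 z

lemma rankSum_nonneg {n : ℕ} (z : Fin n → ℝ) : 0 ≤ rankSum z :=
  Finset.sum_nonneg fun _ _ => rankFn_nonneg _ _ _

lemma measurable_rankSum {n : ℕ} : Measurable (rankSum (n := n)) :=
  Finset.measurable_sum _ fun _ _ => measurable_rankFn _ _

/-- The weight of the ordered values `v < x < a < b`. -/
noncomputable def fourWeight (c : ℝ → ℝ≥0∞) (t : Fin 4 → ℝ) : ℝ≥0∞ :=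
  if t 0 < t 1 ∧ t 1 < t 2 ∧ t 2 < t 3 then c (t 0) * ENNReal.ofReal (pairFn (t 0) (t 2) (t 3))
  else 0

/-- The weight of two disjoint pairs `a < b` and `a' < b'` above the values `v < x`. -/
noncomputable def sixWeight (t : Fin 6 → ℝ) : ℝ≥0∞ :=
  if t 0 < t 1 ∧ (t 1 < t 2 ∧ t 2 < t 3) ∧ (t 1 < t 4 ∧ t 4 < t 5) then
    ENNReal.ofReal (pairFn (t 0) (t 2) (t 3)) * ENNReal.ofReal (pairFn (t 0) (t 4) (t 5)) else 0

lemma measurable_fourWeight {c : ℝ → ℝ≥0∞} (hc : Measurable c) : Measurable (fourWeight c) := by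
  refine Measurable.ite ?_ ((hc.comp (by fun_prop)).mul
    (ENNReal.measurable_ofReal.comp (by fun_prop))) measurable_const
  have h := fun i j : Fin 4 => measurableSet_lt (measurable_pi_apply (X := fun _ => ℝ) i)
    (measurable_pi_apply j)
  exact (h 0 1).inter ((h 1 2).inter (h 2 3))

lemma measurable_sixWeight : Measurable sixWeight := by
  refine Measurable.ite ?_ ((ENNReal.measurable_ofReal.comp (by fun_prop)).mul
    (ENNReal.measurable_ofReal.comp (by fun_prop))) measurable_const
  have h := fun i j : Fin 6 => measurableSet_lt (measurable_pi_apply (X := fun _ => ℝ) i)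
    (measurable_pi_apply j)
  exact (h 0 1).inter (((h 1 2).inter (h 2 3)).inter ((h 1 4).inter (h 4 5)))

/-- Nothing but `e 0` can lie below `e 1`, so these two indices must be the two lowest ranks. -/
lemma embedding_lowest_two {k n : ℕ} (hn : 2 ≤ n) (e : Fin (k + 2) ↪ Fin n)
    (h : ∀ y, y ∉ Set.range e → e 1 < y) (h01 : e 0 < e 1) (hle : ∀ i, 2 ≤ i.val → e 1 < e i) :
    e 0 = ⟨0, by omega⟩ ∧ e 1 = ⟨1, by omega⟩ := by
  have hcases : ∀ i : Fin (k + 2), i = 0 ∨ i = 1 ∨ 2 ≤ i.val := by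
    intro i
    rcases i with ⟨i, hi⟩
    rcases i with _ | _ | i
    · left; rfl
    · right; left; rfl
    · right; right; simp
  have hmin : ∀ y : Fin n, y < e 1 → y = e 0 := by
    intro y hy
    by_cases hr : y ∈ Set.range e
    · obtain ⟨i, rfl⟩ := hr
      rcases hcases i with rfl | rfl | hi
      · rfl
      · exact absurd hy (lt_irrefl _)
      · exact absurd hy (not_lt.2 (hle i hi).le)
    · exact absurd hy (not_lt.2 (h y hr).le)
  have h0 : e 0 = ⟨0, by omega⟩ := by
    refine (hmin _ ?_).symm
    refine lt_of_le_of_lt ?_ h01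
    exact Nat.zero_le _
  refine ⟨h0, ?_⟩
  by_contra hne
  have h1 : (⟨1, by omega⟩ : Fin n) < e 1 := by
    rw [Fin.lt_def]
    have := Fin.lt_def.1 h01
    have h2 : (e 1).val ≠ 1 := fun h => hne (Fin.ext h)
    simp only
    omega
  have := hmin _ h1
  rw [h0] at this
  simp at this

-- The two lowest ranks are forced, so the embeddings that contribute correspond exactly to the
-- remaining pairs `(e 2, e 3)`. The embedding form is invariant under permuting the sample, which
-- later allows the sorting to be dropped.
open Classical in
lemma ofReal_rankSum_eq_sum_embedding {n : ℕ} (hn : 2 ≤ n) (c : ℝ → ℝ≥0∞) {z : Fin n → ℝ}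
    (hz : StrictMono z) :
    c (z ⟨0, by omega⟩) * ENNReal.ofReal (rankSum z) = ∑ e : Fin 4 ↪ Fin n,
      if ∀ y, y ∉ Set.range e → z (e 1) < z y then fourWeight c (z ∘ e) else 0 := by
  rw [rankSum, ENNReal.ofReal_sum_of_nonneg (fun _ _ => rankFn_nonneg _ _ _), Finset.mul_sum]
  simp only [fourWeight, Function.comp, hz.lt_iff_lt, ← ite_and]
  rw [← Finset.sum_filter]
  symm
  have key : ∀ e : Fin 4 ↪ Fin n, e ∈ Finset.univ.filter (fun e : Fin 4 ↪ Fin n =>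
      (∀ y, y ∉ Set.range e → e 1 < y) ∧ e 0 < e 1 ∧ e 1 < e 2 ∧ e 2 < e 3) →
      (e 0 = ⟨0, by omega⟩ ∧ e 1 = ⟨1, by omega⟩) ∧ e 1 < e 2 ∧ e 2 < e 3 := by
    intro e he
    obtain ⟨h, h1, h2, h3⟩ := (Finset.mem_filter.1 he).2
    refine ⟨embedding_lowest_two hn e h h1 ?_, h2, h3⟩
    intro i hi
    fin_cases i
    · simp at hi
    · simp at hi
    · exact h2
    · exact h2.trans h3
  refine Finset.sum_bij (fun e _ => (e 2, e 3)) ?_ ?_ ?_ ?_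
  · intro e he
    obtain ⟨⟨h0, h1⟩, h2, h3⟩ := key e he
    simp only [remainingPairs, Finset.mem_filter, Finset.mem_univ, true_and]
    refine ⟨?_, h3⟩
    rw [h1] at h2
    exact h2
  · intro e he e' he' hee
    obtain ⟨⟨h0, h1⟩, -⟩ := key e he
    obtain ⟨⟨h0', h1'⟩, -⟩ := key e' he'
    obtain ⟨h2, h3⟩ := Prod.mk.inj hee
    ext i
    fin_cases i
    · exact congrArg Fin.val (h0.trans h0'.symm)
    · exact congrArg Fin.val (h1.trans h1'.symm)
    · exact congrArg Fin.val h2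
    · exact congrArg Fin.val h3
  · rintro ⟨i, j⟩ hij
    simp only [remainingPairs, Finset.mem_filter, Finset.mem_univ, true_and] at hij
    obtain ⟨hi, hj⟩ := hij
    have hj' := Fin.lt_def.1 hj
    refine ⟨⟨![⟨0, by omega⟩, ⟨1, by omega⟩, i, j], ?_⟩, ?_, rfl⟩
    · intro r s hrs
      rw [Fin.ext_iff] at hrs
      fin_cases r <;> fin_cases s <;>
        first | rfl | (exfalso; simp at hrs; done) | (exfalso; simp at hrs; omega)
    · simp only [Finset.mem_filter, Finset.mem_univ, true_and]
      refine ⟨?_, ?_, ?_, ?_⟩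
      · intro y hy
        have hy0 : y ≠ ⟨0, by omega⟩ := fun h => hy ⟨0, h.symm⟩
        have hy1 : y ≠ ⟨1, by omega⟩ := fun h => hy ⟨1, h.symm⟩
        change (⟨1, _⟩ : Fin n) < y
        rw [Fin.lt_def]
        rw [Ne, Fin.ext_iff] at hy0 hy1
        simp only at hy0 hy1 ⊢
        omega
      · change (⟨0, _⟩ : Fin n) < ⟨1, _⟩
        simp
      · change (⟨1, _⟩ : Fin n) < i
        rw [Fin.lt_def]; simp only; omega
      · exact hj
  · intro e he
    obtain ⟨⟨h0, h1⟩, -⟩ := key e he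
    simp only [h0, rankFn]

open Classical in
lemma sum_disjoint_pairs_eq_sum_embedding {n : ℕ} (hn : 2 ≤ n) {z : Fin n → ℝ}
    (hz : StrictMono z) :
    ∑ r ∈ (remainingPairs n ×ˢ remainingPairs n).filter (fun r => r.2.1 ≠ r.1.1 ∧ r.2.1 ≠ r.1.2 ∧
        r.2.2 ≠ r.1.1 ∧ r.2.2 ≠ r.1.2),
      ENNReal.ofReal (rankFn r.1.1 r.1.2 z) * ENNReal.ofReal (rankFn r.2.1 r.2.2 z) =
    ∑ e : Fin 6 ↪ Fin n,
      if ∀ y, y ∉ Set.range e → z (e 1) < z y then sixWeight (z ∘ e) else 0 := by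
  simp only [sixWeight, Function.comp, hz.lt_iff_lt, ← ite_and]
  rw [← Finset.sum_filter (s := Finset.univ)]
  symm
  have key : ∀ e : Fin 6 ↪ Fin n, e ∈ Finset.univ.filter (fun e : Fin 6 ↪ Fin n =>
      (∀ y, y ∉ Set.range e → e 1 < y) ∧ e 0 < e 1 ∧ (e 1 < e 2 ∧ e 2 < e 3) ∧
        e 1 < e 4 ∧ e 4 < e 5) →
      (e 0 = ⟨0, by omega⟩ ∧ e 1 = ⟨1, by omega⟩) ∧ (e 1 < e 2 ∧ e 2 < e 3) ∧
        e 1 < e 4 ∧ e 4 < e 5 := by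
    intro e he
    obtain ⟨h, h1, ⟨h2, h3⟩, h4, h5⟩ := (Finset.mem_filter.1 he).2
    refine ⟨embedding_lowest_two hn e h h1 ?_, ⟨h2, h3⟩, h4, h5⟩
    intro i hi
    fin_cases i
    · simp at hi
    · simp at hi
    · exact h2
    · exact h2.trans h3
    · exact h4
    · exact h4.trans h5
  refine Finset.sum_bij (fun e _ => ((e 2, e 3), (e 4, e 5))) ?_ ?_ ?_ ?_
  · intro e he
    obtain ⟨⟨h0, h1⟩, ⟨h2, h3⟩, h4, h5⟩ := key e he
    simp only [remainingPairs, Finset.mem_filter, Finset.mem_univ, true_and, Finset.mem_product]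
    rw [h1] at h2 h4
    refine ⟨⟨⟨h2, h3⟩, ⟨h4, h5⟩⟩, ?_⟩
    refine ⟨?_, ?_, ?_, ?_⟩ <;> exact e.injective.ne (by decide)
  · intro e he e' he' hee
    obtain ⟨⟨h0, h1⟩, -⟩ := key e he
    obtain ⟨⟨h0', h1'⟩, -⟩ := key e' he'
    obtain ⟨h23, h45⟩ := Prod.mk.inj hee
    obtain ⟨h2, h3⟩ := Prod.mk.inj h23
    obtain ⟨h4, h5⟩ := Prod.mk.inj h45
    ext i
    fin_cases i
    · exact congrArg Fin.val (h0.trans h0'.symm)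
    · exact congrArg Fin.val (h1.trans h1'.symm)
    · exact congrArg Fin.val h2
    · exact congrArg Fin.val h3
    · exact congrArg Fin.val h4
    · exact congrArg Fin.val h5
  · rintro ⟨⟨i, j⟩, k, l⟩ hij
    simp only [remainingPairs, Finset.mem_filter, Finset.mem_univ, true_and,
      Finset.mem_product] at hij
    obtain ⟨⟨⟨hi, hj⟩, hk, hl⟩, hki, hkj, hli, hlj⟩ := hij
    have hj' := Fin.lt_def.1 hj
    have hl' := Fin.lt_def.1 hl
    rw [Ne, Fin.ext_iff] at hki hkj hli hlj
    refine ⟨⟨![⟨0, by omega⟩, ⟨1, by omega⟩, i, j, k, l], ?_⟩, ?_, rfl⟩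
    · intro r s hrs
      rw [Fin.ext_iff] at hrs
      fin_cases r <;> fin_cases s <;>
        first | rfl | (exfalso; simp at hrs; done) | (exfalso; simp at hrs; omega)
    · simp only [Finset.mem_filter, Finset.mem_univ, true_and]
      refine ⟨?_, ?_, ⟨?_, hj⟩, ?_, hl⟩
      · intro y hy
        have hy0 : y ≠ ⟨0, by omega⟩ := fun h => hy ⟨0, h.symm⟩
        have hy1 : y ≠ ⟨1, by omega⟩ := fun h => hy ⟨1, h.symm⟩
        change (⟨1, _⟩ : Fin n) < y
        rw [Fin.lt_def]
        rw [Ne, Fin.ext_iff] at hy0 hy1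
        simp only at hy0 hy1 ⊢
        omega
      · change (⟨0, _⟩ : Fin n) < ⟨1, _⟩
        simp
      · change (⟨1, _⟩ : Fin n) < i
        rw [Fin.lt_def]; simp only; omega
      · change (⟨1, _⟩ : Fin n) < k
        rw [Fin.lt_def]; simp only; omega
  · intro e he
    obtain ⟨⟨h0, h1⟩, -⟩ := key e he
    simp only [h0, rankFn]

lemma pairFn_le_Phi (v a b : ℝ) : pairFn v a b ≤ Phi (√2 * v) :=
  Phi_mono (mul_le_mul_of_nonneg_left (by linarith [Real.sqrt_nonneg ((a - v) * (b - v))])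
    (Real.sqrt_nonneg 2))

lemma card_touching_le {n : ℕ} (i j : Fin n) (R : Finset (Fin n × Fin n)) :
    (R.filter fun r => ¬ (r.1 ≠ i ∧ r.1 ≠ j ∧ r.2 ≠ i ∧ r.2 ≠ j)).card ≤ 4 * n := by
  classical
  have hsub : (R.filter fun r => ¬ (r.1 ≠ i ∧ r.1 ≠ j ∧ r.2 ≠ i ∧ r.2 ≠ j)) ⊆
      (({i} ×ˢ Finset.univ) ∪ ({j} ×ˢ Finset.univ)) ∪
        ((Finset.univ ×ˢ {i}) ∪ (Finset.univ ×ˢ {j})) := by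
    rintro ⟨r, s⟩ h
    have := (Finset.mem_filter.1 h).2
    simp only [Finset.mem_union, Finset.mem_product, Finset.mem_singleton, Finset.mem_univ]
    tauto
  refine (Finset.card_le_card hsub).trans ?_
  refine (Finset.card_union_le _ _).trans ?_
  refine (add_le_add (Finset.card_union_le _ _) (Finset.card_union_le _ _)).trans ?_
  simp only [Finset.card_product, Finset.card_singleton, Finset.card_univ, Fintype.card_fin]
  omega

-- For a fixed pair, at most `4 n` pairs share an index with it, and each of them has probability at
-- most `Phi (√2 v)`, `v` being the minimum. The pairs disjoint from it make up the sum over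
-- embeddings of six points.
open Classical in
lemma ofReal_rankSum_sq_le {n : ℕ} (hn : 2 ≤ n) {z : Fin n → ℝ} (hz : StrictMono z) :
    ENNReal.ofReal (rankSum z) ^ 2 ≤
      4 * n * (ENNReal.ofReal (Phi (√2 * z ⟨0, by omega⟩)) * ENNReal.ofReal (rankSum z)) +
      ∑ e : Fin 6 ↪ Fin n,
        if ∀ y, y ∉ Set.range e → z (e 1) < z y then sixWeight (z ∘ e) else 0 := by
  rw [← sum_disjoint_pairs_eq_sum_embedding hn hz]
  set R := remainingPairs n
  set p : Fin n × Fin n → ℝ≥0∞ := fun r => ENNReal.ofReal (rankFn r.1 r.2 z)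
  set q := ENNReal.ofReal (Phi (√2 * z ⟨0, by omega⟩))
  have hpq : ∀ r, p r ≤ q := fun r => ENNReal.ofReal_le_ofReal (pairFn_le_Phi _ _ _)
  have hS : ENNReal.ofReal (rankSum z) = ∑ r ∈ R, p r :=
    ENNReal.ofReal_sum_of_nonneg fun _ _ => rankFn_nonneg _ _ _
  rw [hS, sq, Finset.sum_mul_sum, Finset.sum_filter, Finset.sum_product, Finset.mul_sum,
    Finset.mul_sum, ← Finset.sum_add_distrib]
  refine Finset.sum_le_sum fun r _ => ?_
  rw [← Finset.sum_filter, ← Finset.sum_filter_add_sum_filter_not R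
    (fun s => s.1 ≠ r.1 ∧ s.1 ≠ r.2 ∧ s.2 ≠ r.1 ∧ s.2 ≠ r.2), add_comm]
  refine add_le_add ?_ le_rfl
  calc _ ≤ ∑ s ∈ R.filter (fun s => ¬ (s.1 ≠ r.1 ∧ s.1 ≠ r.2 ∧ s.2 ≠ r.1 ∧ s.2 ≠ r.2)), p r * q :=
        Finset.sum_le_sum fun s _ => mul_le_mul_right (hpq s) _
    _ ≤ (4 * n : ℕ) * (p r * q) := by
        rw [Finset.sum_const, nsmul_eq_mul]
        gcongr
        exact card_touching_le r.1 r.2 R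
    _ = _ := by push_cast; ring

/-- By Fubini: once the other coordinates are fixed, coordinate `i` is confined to a single point,
which is null. -/
lemma pi_gaussianReal_eq_zero {n : ℕ} {i j : Fin n} (hij : i ≠ j) :
    (Measure.pi fun _ : Fin n => gaussianReal 0 1) {d | d i = d j} = 0 := by
  obtain _ | m := n
  · exact i.elim0
  obtain ⟨k, rfl⟩ := Fin.exists_succAbove_eq hij.symm
  have h := measurePreserving_piFinSuccAbove (fun _ : Fin (m + 1) => gaussianReal 0 1) i
  have hA : MeasurableSet {p : ℝ × (Fin m → ℝ) | p.1 = p.2 k} :=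
    measurableSet_eq_fun (by fun_prop) (by fun_prop)
  have h0 : NullSingletonClass (gaussianReal 0 1) := nullSingletonClass_gaussianReal one_ne_zero
  have := h.measure_preimage hA.nullMeasurableSet
  refine Eq.trans ?_ (this.trans ?_)
  · rfl
  · rw [Measure.prod_apply_symm hA]
    have : ∀ y : Fin m → ℝ, (fun x => (x, y)) ⁻¹' {p : ℝ × (Fin m → ℝ) | p.1 = p.2 k} = {y k} := by
      intro y; ext x; simp
    simp [this]

lemma ae_injective {n : ℕ} :
    ∀ᵐ d ∂(Measure.pi fun _ : Fin n => gaussianReal 0 1), Function.Injective d := by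
  have : ∀ᵐ d ∂(Measure.pi fun _ : Fin n => gaussianReal 0 1), ∀ i j, i ≠ j → d i ≠ d j := by
    refine ae_all_iff.2 fun i => ae_all_iff.2 fun j => ?_
    by_cases hij : i = j
    · simp [hij]
    · filter_upwards [measure_eq_zero_iff_ae_notMem.1 (pi_gaussianReal_eq_zero hij)] with d hd _
      exact hd
  filter_upwards [this] with d hd i j h
  by_contra hne
  exact hd i j hne h

lemma sorted_strictMono {n : ℕ} {d : Fin n → ℝ} (hd : Function.Injective d) :
    StrictMono (sorted d) :=
  (Tuple.monotone_sort d).strictMono_of_injective (hd.comp (Tuple.sort d).injective)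

-- Composing embeddings with the sorting permutation is a bijection of the index set of the sum.
open Classical in
lemma sum_embedding_sorted {k n : ℕ} (i₀ : Fin k) (w : (Fin k → ℝ) → ℝ≥0∞) (d : Fin n → ℝ) :
    ∑ e : Fin k ↪ Fin n, (if ∀ y, y ∉ Set.range e → sorted d (e i₀) < sorted d y then
      w (sorted d ∘ e) else 0) =
    ∑ e : Fin k ↪ Fin n, if ∀ y, y ∉ Set.range e → d (e i₀) < d y then w (d ∘ e) else 0 := by
  refine Fintype.sum_equiv (Equiv.embeddingCongr (Equiv.refl _) (Tuple.sort d)) _ _ fun e => ?_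
  have hiff : (∀ y, y ∉ Set.range e → sorted d (e i₀) < sorted d y) ↔
      ∀ y, y ∉ Set.range (Equiv.embeddingCongr (Equiv.refl _) (Tuple.sort d) e) →
        d ((Equiv.embeddingCongr (Equiv.refl _) (Tuple.sort d) e) i₀) < d y := by
    refine (Tuple.sort d).forall_congr fun y => ?_
    have : y ∈ Set.range e ↔
        Tuple.sort d y ∈ Set.range (Equiv.embeddingCongr (Equiv.refl _) (Tuple.sort d) e) := by
      simp [Set.mem_range]
    rw [this]
    rfl
  simp only [hiff]
  rfl

open Classical in
lemma lintegral_sum_embedding {k n : ℕ} (i₀ : Fin k) {w : (Fin k → ℝ) → ℝ≥0∞}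
    (hw : Measurable w) :
    ∫⁻ d : Fin n → ℝ, ∑ e : Fin k ↪ Fin n,
      (if ∀ y, y ∉ Set.range e → d (e i₀) < d y then w (d ∘ e) else 0)
        ∂(Measure.pi fun _ => gaussianReal 0 1) =
      n.descFactorial k * ∫⁻ t : Fin k → ℝ, w t * ENNReal.ofReal ((1 - Phi (t i₀)) ^ (n - k))
        ∂(Measure.pi fun _ => gaussianReal 0 1) := by
  rw [lintegral_finsetSum]
  · simp only [lintegral_embedding _ i₀ hw, Finset.sum_const, Finset.card_univ,
      Fintype.card_embedding_eq, Fintype.card_fin, nsmul_eq_mul]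
  · intro e _
    refine Measurable.ite ?_ (hw.comp (by fun_prop)) measurable_const
    refine measurableSet_setOfPred.2 (Measurable.forall fun y => Measurable.imp measurable_const ?_)
    exact measurableSet_setOfPred.1 (measurableSet_lt (by fun_prop) (by fun_prop))

/-! ### Reduction of the moments to integrals over the two smallest values. -/

/-- The mass of the pairs above `x` for the minimum `v`. -/
noncomputable def pairMass (v x : ℝ) : ℝ≥0∞ :=
  ∫⁻ a, ∫⁻ b, (if x < a ∧ a < b then ENNReal.ofReal (pairFn v a b) else 0)
    ∂(gaussianReal 0 1) ∂(gaussianReal 0 1)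

lemma measurable_pairMass_integrand : Measurable fun p : ((ℝ × ℝ) × ℝ) × ℝ =>
    if p.1.1.2 < p.1.2 ∧ p.1.2 < p.2 then ENNReal.ofReal (pairFn p.1.1.1 p.1.2 p.2) else 0 := by
  refine Measurable.ite ?_ (ENNReal.measurable_ofReal.comp (by fun_prop)) measurable_const
  exact (measurableSet_lt (f := fun p : ((ℝ × ℝ) × ℝ) × ℝ => p.1.1.2) (g := fun p => p.1.2)
    (by fun_prop) (by fun_prop)).inter (measurableSet_lt (f := fun p : ((ℝ × ℝ) × ℝ) × ℝ => p.1.2)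
    (g := fun p => p.2) (by fun_prop) (by fun_prop))

lemma measurable_pairMass : Measurable fun p : ℝ × ℝ => pairMass p.1 p.2 := by
  unfold pairMass
  exact (measurable_pairMass_integrand.lintegral_prod_right'
    (ν := gaussianReal 0 1)).lintegral_prod_right' (ν := gaussianReal 0 1)

/-- The weight `c` of the minimum is `1` for the mean of the sum and `Phi (√2 ·)` for the error
terms. The bound `2 ≤ n` suffices, since for `n < 4` both sides vanish. -/
lemma lintegral_rankSum_eq {n : ℕ} (hn : 2 ≤ n) {c : ℝ → ℝ≥0∞} (hc : Measurable c) :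
    ∫⁻ d : Fin n → ℝ, c (sorted d ⟨0, by omega⟩) * ENNReal.ofReal (rankSum (sorted d))
        ∂(Measure.pi fun _ => gaussianReal 0 1) =
      n.descFactorial 4 * ∫⁻ x, ENNReal.ofReal ((1 - Phi x) ^ (n - 4)) *
        ∫⁻ v in Set.Iio x, c v * pairMass v x ∂(gaussianReal 0 1) ∂(gaussianReal 0 1) := by
  classical
  have hw := measurable_fourWeight hc
  have h1 := lintegral_sum_embedding (n := n) 1 hw
  have hm1 : Measurable fun t : Fin 4 → ℝ => ENNReal.ofReal ((1 - Phi (t 1)) ^ (n - 4)) :=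
    ENNReal.measurable_ofReal.comp
      ((measurable_const.sub (measurable_Phi.comp (by fun_prop))).pow_const _)
  rw [lintegral_pi_four
    (f := fun t => fourWeight c t * ENNReal.ofReal ((1 - Phi (t 1)) ^ (n - 4))) (hw.mul hm1)] at h1
  refine Eq.trans (lintegral_congr_ae ?_) (h1.trans ?_)
  · filter_upwards [ae_injective] with d hd
    rw [ofReal_rankSum_eq_sum_embedding hn c (sorted_strictMono hd), sum_embedding_sorted]
  congr 1
  have hin : ∀ v x, ∫⁻ a, ∫⁻ b, fourWeight c ![v, x, a, b] *
      ENNReal.ofReal ((1 - Phi (![v, x, a, b] 1)) ^ (n - 4)) ∂(gaussianReal 0 1)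
        ∂(gaussianReal 0 1) = ENNReal.ofReal ((1 - Phi x) ^ (n - 4)) *
          (Set.Iio x).indicator (fun v => c v * pairMass v x) v := by
    intro v x
    have hm2 : ∀ a, Measurable fun b : ℝ =>
        if x < a ∧ a < b then ENNReal.ofReal (pairFn v a b) else 0 := fun a =>
      measurable_pairMass_integrand.comp (by fun_prop : Measurable fun b : ℝ => (((v, x), a), b))
    have hm3 : Measurable fun a : ℝ => ∫⁻ b,
        (if x < a ∧ a < b then ENNReal.ofReal (pairFn v a b) else 0) ∂(gaussianReal 0 1) :=
      Measurable.lintegral_prod_right' (measurable_pairMass_integrand.comp (by fun_prop :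
            Measurable fun q : ℝ × ℝ => (((v, x), q.1), q.2)))
    by_cases hvx : v < x
    · rw [Set.indicator_of_mem (Set.mem_Iio.2 hvx), pairMass, ← mul_assoc,
        ← lintegral_const_mul _ hm3]
      refine lintegral_congr fun a => ?_
      rw [← lintegral_const_mul _ (hm2 a)]
      refine lintegral_congr fun b => ?_
      simp only [fourWeight, Matrix.cons_val, hvx, true_and]
      split_ifs
      · ring
      · simp
    · simp [fourWeight, hvx, Set.indicator]
  simp only [hin]
  have hmeas : Measurable fun p : ℝ × ℝ => (Set.Iio p.2).indicator
      (fun v => c v * pairMass v p.2) p.1 := by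
    have : (fun p : ℝ × ℝ => (Set.Iio p.2).indicator (fun v => c v * pairMass v p.2) p.1) =
        {p : ℝ × ℝ | p.1 < p.2}.indicator fun p => c p.1 * pairMass p.1 p.2 := by
      ext p; by_cases h : p.1 < p.2 <;> simp [Set.indicator, h]
    rw [this]
    exact ((hc.comp measurable_fst).mul measurable_pairMass).indicator
      (measurableSet_lt measurable_fst measurable_snd)
  have hm2 : Measurable fun x => ENNReal.ofReal ((1 - Phi x) ^ (n - 4)) :=
    ENNReal.measurable_ofReal.comp ((measurable_const.sub measurable_Phi).pow_const _)
  -- The second smallest value becomes the outer variable because the power depends on it alone.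
  rw [lintegral_lintegral_swap ((hm2.comp measurable_snd).mul hmeas).aemeasurable]
  refine lintegral_congr fun x => ?_
  have hmx : Measurable ((Set.Iio x).indicator fun v => c v * pairMass v x) :=
    hmeas.comp (by fun_prop : Measurable fun v : ℝ => (v, x))
  rw [lintegral_const_mul _ hmx,
    lintegral_indicator measurableSet_Iio]

-- Given `v` and `x`, the two disjoint pairs are integrated separately, whence the square of
-- `pairMass`.
open Classical in
lemma lintegral_sixWeight_eq {n : ℕ} :
    ∫⁻ d : Fin n → ℝ, ∑ e : Fin 6 ↪ Fin n,
      (if ∀ y, y ∉ Set.range e → d (e 1) < d y then sixWeight (d ∘ e) else 0)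
        ∂(Measure.pi fun _ => gaussianReal 0 1) =
      n.descFactorial 6 * ∫⁻ x, ENNReal.ofReal ((1 - Phi x) ^ (n - 6)) *
        ∫⁻ v in Set.Iio x, pairMass v x ^ 2 ∂(gaussianReal 0 1) ∂(gaussianReal 0 1) := by
  have h1 := lintegral_sum_embedding (n := n) 1 measurable_sixWeight
  have hm1 : Measurable fun t : Fin 6 → ℝ => ENNReal.ofReal ((1 - Phi (t 1)) ^ (n - 6)) :=
    ENNReal.measurable_ofReal.comp
      ((measurable_const.sub (measurable_Phi.comp (by fun_prop))).pow_const _)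
  rw [lintegral_pi_six
    (f := fun t => sixWeight t * ENNReal.ofReal ((1 - Phi (t 1)) ^ (n - 6)))
    (measurable_sixWeight.mul hm1)] at h1
  refine h1.trans ?_
  congr 1
  have hin : ∀ v x, ∫⁻ a, ∫⁻ b, ∫⁻ a', ∫⁻ b', sixWeight ![v, x, a, b, a', b'] *
      ENNReal.ofReal ((1 - Phi (![v, x, a, b, a', b'] 1)) ^ (n - 6)) ∂(gaussianReal 0 1)
        ∂(gaussianReal 0 1) ∂(gaussianReal 0 1) ∂(gaussianReal 0 1) =
        ENNReal.ofReal ((1 - Phi x) ^ (n - 6)) *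
          (Set.Iio x).indicator (fun v => pairMass v x ^ 2) v := by
    intro v x
    have hm2 : ∀ a, Measurable fun b : ℝ =>
        if x < a ∧ a < b then ENNReal.ofReal (pairFn v a b) else 0 := fun a =>
      measurable_pairMass_integrand.comp (by fun_prop : Measurable fun b : ℝ => (((v, x), a), b))
    have hm3 : Measurable fun a : ℝ => ∫⁻ b,
        (if x < a ∧ a < b then ENNReal.ofReal (pairFn v a b) else 0) ∂(gaussianReal 0 1) :=
      Measurable.lintegral_prod_right' (measurable_pairMass_integrand.comp (by fun_prop :
            Measurable fun q : ℝ × ℝ => (((v, x), q.1), q.2)))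
    by_cases hvx : v < x
    · rw [Set.indicator_of_mem (Set.mem_Iio.2 hvx), sq, mul_left_comm]
      nth_rw 1 [pairMass]
      rw [← lintegral_mul_const _ hm3]
      refine lintegral_congr fun a => ?_
      rw [← lintegral_mul_const _ (hm2 a)]
      refine lintegral_congr fun b => ?_
      rw [pairMass, ← mul_assoc, ← lintegral_const_mul _ hm3]
      refine lintegral_congr fun a' => ?_
      rw [← lintegral_const_mul _ (hm2 a')]
      refine lintegral_congr fun b' => ?_
      simp only [sixWeight, Matrix.cons_val, hvx, true_and]
      by_cases h1 : x < a ∧ a < b <;> by_cases h2 : x < a' ∧ a' < b' <;>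
        simp only [h1, h2, and_self, if_true, if_false, zero_mul, mul_zero, and_false, false_and]
      ring
    · simp [sixWeight, hvx, Set.indicator]
  simp only [hin]
  have hmeas : Measurable fun p : ℝ × ℝ => (Set.Iio p.2).indicator
      (fun v => pairMass v p.2 ^ 2) p.1 := by
    have : (fun p : ℝ × ℝ => (Set.Iio p.2).indicator (fun v => pairMass v p.2 ^ 2) p.1) =
        {p : ℝ × ℝ | p.1 < p.2}.indicator fun p => pairMass p.1 p.2 ^ 2 := by
      ext p; by_cases h : p.1 < p.2 <;> simp [Set.indicator, h]
    rw [this]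
    exact (measurable_pairMass.pow_const 2).indicator
      (measurableSet_lt measurable_fst measurable_snd)
  have hm2 : Measurable fun x => ENNReal.ofReal ((1 - Phi x) ^ (n - 6)) :=
    ENNReal.measurable_ofReal.comp ((measurable_const.sub measurable_Phi).pow_const _)
  rw [lintegral_lintegral_swap ((hm2.comp measurable_snd).mul hmeas).aemeasurable]
  refine lintegral_congr fun x => ?_
  have hmx : Measurable ((Set.Iio x).indicator fun v => pairMass v x ^ 2) :=
    hmeas.comp (by fun_prop : Measurable fun v : ℝ => (v, x))
  rw [lintegral_const_mul _ hmx,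
    lintegral_indicator measurableSet_Iio]

lemma lintegral_rankSum_sq_le {n : ℕ} (hn : 2 ≤ n) :
    ∫⁻ d : Fin n → ℝ, ENNReal.ofReal (rankSum (sorted d)) ^ 2
        ∂(Measure.pi fun _ => gaussianReal 0 1) ≤
      4 * n * ∫⁻ d : Fin n → ℝ, ENNReal.ofReal (Phi (√2 * sorted d ⟨0, by omega⟩)) *
        ENNReal.ofReal (rankSum (sorted d)) ∂(Measure.pi fun _ => gaussianReal 0 1) +
      n.descFactorial 6 * ∫⁻ x, ENNReal.ofReal ((1 - Phi x) ^ (n - 6)) *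
        ∫⁻ v in Set.Iio x, pairMass v x ^ 2 ∂(gaussianReal 0 1) ∂(gaussianReal 0 1) := by
  classical
  have hm : Measurable fun d : Fin n → ℝ => ENNReal.ofReal (Phi (√2 * sorted d ⟨0, by omega⟩)) *
        ENNReal.ofReal (rankSum (sorted d)) := by
    refine (ENNReal.measurable_ofReal.comp ?_).mul
      (ENNReal.measurable_ofReal.comp (measurable_rankSum.comp measurable_sorted))
    exact measurable_Phi.comp (((measurable_pi_apply _).comp measurable_sorted).const_mul _)
  rw [← lintegral_sixWeight_eq, ← lintegral_const_mul _ hm,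
    ← lintegral_add_left (hm.const_mul _)]
  refine lintegral_mono_ae ?_
  filter_upwards [ae_injective] with d hd
  rw [← sum_embedding_sorted]
  exact ofReal_rankSum_sq_le hn (sorted_strictMono hd)

/-! ### Normal density, quantile function and Mills ratio. -/

open Real (exp log)

/-- The standard normal density. -/
noncomputable def phi (x : ℝ) : ℝ := exp (-(x ^ 2 / 2)) / √(2 * Real.pi)

lemma gaussianPDFReal_eq_phi (x : ℝ) : gaussianPDFReal 0 1 x = phi x := by
  simp [gaussianPDFReal, phi]
  ring_nf

lemma sqrt_two_pi_pos : 0 < √(2 * Real.pi) := Real.sqrt_pos.2 (by positivity)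

lemma phi_pos (x : ℝ) : 0 < phi x := div_pos (Real.exp_pos _) sqrt_two_pi_pos

@[fun_prop]
lemma continuous_phi : Continuous phi := by unfold phi; fun_prop

lemma integrable_phi : Integrable phi :=
  (integrable_gaussianPDFReal 0 1).congr (ae_of_all _ gaussianPDFReal_eq_phi)

lemma lintegral_gaussianReal {f : ℝ → ℝ≥0∞} :
    ∫⁻ x, f x ∂(gaussianReal 0 1) = ∫⁻ x, ENNReal.ofReal (phi x) * f x := by
  rw [gaussianReal_of_var_ne_zero _ one_ne_zero,
    lintegral_withDensity_eq_lintegral_mul_non_measurable _ (measurable_gaussianPDF 0 1)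
      (ae_of_all _ fun _ => gaussianPDF_lt_top)]
  simp only [gaussianPDF, gaussianPDFReal_eq_phi, Pi.mul_apply]

lemma setLIntegral_gaussianReal {f : ℝ → ℝ≥0∞} {s : Set ℝ} (hs : MeasurableSet s) :
    ∫⁻ x in s, f x ∂(gaussianReal 0 1) = ∫⁻ x in s, ENNReal.ofReal (phi x) * f x := by
  rw [← lintegral_indicator hs, lintegral_gaussianReal, ← lintegral_indicator hs]
  congr 1; ext x
  by_cases h : x ∈ s <;> simp [h]

lemma Phi_eq_integral (x : ℝ) : Phi x = ∫ t in Set.Iic x, phi t := by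
  rw [Phi, Measure.real, gaussianReal_apply_eq_integral _ one_ne_zero, ENNReal.toReal_ofReal]
  · simp only [gaussianPDFReal_eq_phi]
  · exact integral_nonneg fun _ => gaussianPDFReal_nonneg _ _ _

lemma hasDerivAt_Phi (x : ℝ) : HasDerivAt Phi (phi x) x := by
  have h : ∀ y, Phi y = Phi 0 + ∫ t in (0 : ℝ)..y, phi t := by
    intro y
    rw [Phi_eq_integral, Phi_eq_integral, ← intervalIntegral.integral_Iic_sub_Iic
      integrable_phi.integrableOn integrable_phi.integrableOn]
    ring
  have : Phi = fun y => Phi 0 + ∫ t in (0 : ℝ)..y, phi t := funext h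
  rw [this]
  exact (intervalIntegral.integral_hasDerivAt_right (integrable_phi.intervalIntegrable)
    (continuous_phi.stronglyMeasurableAtFilter _ _) continuous_phi.continuousAt).const_add _

@[fun_prop]
lemma continuous_Phi : Continuous Phi :=
  continuous_iff_continuousAt.2 fun x => (hasDerivAt_Phi x).continuousAt

lemma strictMono_Phi : StrictMono Phi :=
  strictMono_of_deriv_pos fun x => by rw [(hasDerivAt_Phi x).deriv]; exact phi_pos x

lemma tendsto_Phi_atBot : Tendsto Phi atBot (𝓝 0) := by
  have := tendsto_cdf_atBot (gaussianReal 0 1)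
  exact this.congr fun x => cdf_eq_real _ x

lemma tendsto_Phi_atTop : Tendsto Phi atTop (𝓝 1) := by
  have := tendsto_cdf_atTop (gaussianReal 0 1)
  exact this.congr fun x => cdf_eq_real _ x

lemma Phi_pos (x : ℝ) : 0 < Phi x :=
  lt_of_le_of_lt (Phi_nonneg (x - 1)) (strictMono_Phi (by linarith))

lemma Phi_lt_one (x : ℝ) : Phi x < 1 :=
  lt_of_lt_of_le (strictMono_Phi (by linarith : x < x + 1)) (Phi_le_one _)

lemma range_Phi : Set.range Phi = Set.Ioo 0 1 := by
  ext u
  constructor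
  · rintro ⟨x, rfl⟩; exact ⟨Phi_pos x, Phi_lt_one x⟩
  · rintro ⟨h0, h1⟩
    obtain ⟨a, ha⟩ := (tendsto_Phi_atBot.eventually (gt_mem_nhds h0)).exists
    obtain ⟨b, hb⟩ := (tendsto_Phi_atTop.eventually (lt_mem_nhds h1)).exists
    obtain ⟨x, hx⟩ := mem_range_of_exists_le_of_exists_ge continuous_Phi ⟨a, ha.le⟩ ⟨b, hb.le⟩
    exact ⟨x, hx⟩

/-- The quantile function of the standard normal law. -/
noncomputable def quantile : ℝ → ℝ := Function.invFun Phi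

lemma quantile_Phi (x : ℝ) : quantile (Phi x) = x :=
  Function.leftInverse_invFun strictMono_Phi.injective x

lemma Phi_quantile {u : ℝ} (hu : u ∈ Set.Ioo (0 : ℝ) 1) : Phi (quantile u) = u := by
  rw [← range_Phi] at hu
  obtain ⟨x, rfl⟩ := hu
  rw [quantile_Phi]

lemma monotoneOn_quantile : MonotoneOn quantile (Set.Ioo 0 1) := by
  intro u hu v hv h
  rwa [← strictMono_Phi.le_iff_le, Phi_quantile hu, Phi_quantile hv]

lemma tendsto_quantile : Tendsto quantile (𝓝[>] 0) atBot := by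
  rw [tendsto_atBot]
  intro b
  have h1 : Set.Ioo (0 : ℝ) (Phi b) ∈ 𝓝[>] (0 : ℝ) := Ioo_mem_nhdsGT (Phi_pos b)
  filter_upwards [h1] with u hu
  rw [← strictMono_Phi.le_iff_le, Phi_quantile ⟨hu.1, hu.2.trans (Phi_lt_one b)⟩]
  exact hu.2.le

/-- The probability integral transform. -/
lemma lintegral_gaussianReal_eq_quantile (f : ℝ → ℝ≥0∞) :
    ∫⁻ x, f x ∂(gaussianReal 0 1) = ∫⁻ u in Set.Ioo (0 : ℝ) 1, f (quantile u) := by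
  rw [← range_Phi, ← Set.image_univ, lintegral_image_eq_lintegral_abs_deriv_mul
    MeasurableSet.univ (fun x _ => (hasDerivAt_Phi x).hasDerivWithinAt)
    strictMono_Phi.injective.injOn, lintegral_gaussianReal, Measure.restrict_univ]
  simp only [quantile_Phi, abs_of_pos (phi_pos _)]

lemma setLIntegral_Ioi_affine (f : ℝ → ℝ≥0∞) (d : ℝ) {c : ℝ} (hc : 0 < c) :
    ∫⁻ x in Set.Ioi d, f x = ∫⁻ s in Set.Ioi (0 : ℝ), ENNReal.ofReal c * f (d + c * s) := by
  have him : (fun s => d + c * s) '' Set.Ioi (0 : ℝ) = Set.Ioi d := by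
    ext x
    simp only [Set.mem_image, Set.mem_Ioi]
    constructor
    · rintro ⟨s, hs, rfl⟩; have := mul_pos hc hs; linarith
    · intro h; exact ⟨(x - d) / c, div_pos (by linarith) hc, by field_simp; ring⟩
  have hd : ∀ s ∈ Set.Ioi (0 : ℝ), HasDerivWithinAt (fun s => d + c * s) c (Set.Ioi 0) s := by
    intro s _
    simpa using (((hasDerivAt_id s).const_mul c).const_add d).hasDerivWithinAt
  rw [← him, lintegral_image_eq_lintegral_abs_deriv_mul measurableSet_Ioi hd
    (fun s _ t _ h => by simpa [hc.ne'] using h), abs_of_pos hc]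

lemma setLIntegral_Iio_affine (f : ℝ → ℝ≥0∞) (d : ℝ) {c : ℝ} (hc : 0 < c) :
    ∫⁻ x in Set.Iio d, f x = ∫⁻ s in Set.Ioi (0 : ℝ), ENNReal.ofReal c * f (d - c * s) := by
  have him : (fun s => d - c * s) '' Set.Ioi (0 : ℝ) = Set.Iio d := by
    ext x
    simp only [Set.mem_image, Set.mem_Ioi, Set.mem_Iio]
    constructor
    · rintro ⟨s, hs, rfl⟩; have := mul_pos hc hs; linarith
    · intro h; exact ⟨(d - x) / c, div_pos (by linarith) hc, by field_simp; ring⟩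
  have hd : ∀ s ∈ Set.Ioi (0 : ℝ), HasDerivWithinAt (fun s => d - c * s) (-c) (Set.Ioi 0) s := by
    intro s _
    simpa using (((hasDerivAt_id s).const_mul c).const_sub d).hasDerivWithinAt
  rw [← him, lintegral_image_eq_lintegral_abs_deriv_mul measurableSet_Ioi hd
    (fun s _ t _ h => by simpa [hc.ne'] using h), abs_neg, abs_of_pos hc]

/-- The Mills ratio, normalised so that it tends to one. -/
noncomputable def mills (y : ℝ) : ℝ := y * Phi (-y) / phi y

lemma Phi_neg_eq {y : ℝ} (hy : y ≠ 0) : Phi (-y) = phi y / y * mills y := by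
  rw [mills]; field_simp [(phi_pos y).ne']

lemma integrableOn_exp_neg : IntegrableOn (fun s : ℝ => exp (-s)) (Set.Ioi 0) := by
  simpa using integrableOn_exp_neg_Ioi 0

/-- The substitution `x = -y - s / y` turns `phi x` into `phi y * exp (-s - s^2 / (2 y^2))`.
Monotonicity in `y`, the bound by `1` and the limit `1` can all be read off this formula. -/
lemma mills_eq_integral {y : ℝ} (hy : 0 < y) :
    mills y = ∫ s in Set.Ioi (0 : ℝ), exp (-s - s ^ 2 / (2 * y ^ 2)) := by
  have h0 : ENNReal.ofReal (Phi (-y)) = ∫⁻ x in Set.Iio (-y), ENNReal.ofReal (phi x) := by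
    rw [Phi_eq_integral, ofReal_integral_eq_lintegral_ofReal integrable_phi.integrableOn
      (ae_of_all _ fun x => (phi_pos x).le)]
    exact (setLIntegral_congr Iio_ae_eq_Iic).symm
  rw [setLIntegral_Iio_affine _ _ (inv_pos.2 hy)] at h0
  have h1 : ∀ s, ENNReal.ofReal y⁻¹ * ENNReal.ofReal (phi (-y - y⁻¹ * s)) =
      ENNReal.ofReal (phi y / y) * ENNReal.ofReal (exp (-s - s ^ 2 / (2 * y ^ 2))) := by
    intro s
    rw [← ENNReal.ofReal_mul (by positivity),
      ← ENNReal.ofReal_mul (div_nonneg (phi_pos y).le hy.le)]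
    congr 1
    have : -((-y - y⁻¹ * s) ^ 2 / 2) = -(y ^ 2 / 2) + (-s - s ^ 2 / (2 * y ^ 2)) := by
      field_simp; ring
    rw [phi, phi, this, Real.exp_add]
    ring
  have hInt : IntegrableOn (fun s : ℝ => exp (-s - s ^ 2 / (2 * y ^ 2))) (Set.Ioi 0) := by
    refine integrableOn_exp_neg.mono' (by fun_prop) (ae_of_all _ fun s => ?_)
    rw [Real.norm_of_nonneg (Real.exp_pos _).le]
    exact Real.exp_le_exp.2 (by have : 0 ≤ s ^ 2 / (2 * y ^ 2) := by positivity
                                linarith)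
  simp only [h1] at h0
  rw [lintegral_const_mul _ (by fun_prop), ← ofReal_integral_eq_lintegral_ofReal hInt
    (ae_of_all _ fun _ => (Real.exp_pos _).le), ← ENNReal.ofReal_mul
    (div_nonneg (phi_pos y).le hy.le), ENNReal.ofReal_eq_ofReal_iff (Phi_nonneg _)
    (mul_nonneg (div_nonneg (phi_pos y).le hy.le)
      (integral_nonneg fun _ => (Real.exp_pos _).le))] at h0
  rw [mills, h0]
  field_simp [(phi_pos y).ne']

lemma mills_pos {y : ℝ} (hy : 0 < y) : 0 < mills y :=
  div_pos (mul_pos hy (Phi_pos _)) (phi_pos y)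

lemma integrableOn_mills (y : ℝ) :
    IntegrableOn (fun s : ℝ => exp (-s - s ^ 2 / (2 * y ^ 2))) (Set.Ioi 0) := by
  refine integrableOn_exp_neg.mono' (by fun_prop) (ae_of_all _ fun s => ?_)
  rw [Real.norm_of_nonneg (Real.exp_pos _).le]
  exact Real.exp_le_exp.2 (by have : 0 ≤ s ^ 2 / (2 * y ^ 2) := by positivity
                              linarith)

lemma mills_mono {x y : ℝ} (hx : 0 < x) (hxy : x ≤ y) : mills x ≤ mills y := by
  rw [mills_eq_integral hx, mills_eq_integral (hx.trans_le hxy)]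
  refine setIntegral_mono (integrableOn_mills x) (integrableOn_mills y) fun s => ?_
  dsimp only
  gcongr

lemma integral_exp_neg_Ioi_zero' : ∫ s in Set.Ioi (0 : ℝ), exp (-s) = 1 := by
  simpa using integral_exp_neg_Ioi 0

lemma mills_le_one {y : ℝ} (hy : 0 < y) : mills y ≤ 1 := by
  rw [mills_eq_integral hy, ← integral_exp_neg_Ioi_zero']
  refine setIntegral_mono (integrableOn_mills y) integrableOn_exp_neg fun s => ?_
  refine Real.exp_le_exp.2 ?_
  have : 0 ≤ s ^ 2 / (2 * y ^ 2) := by positivity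
  linarith

lemma tendsto_mills : Tendsto mills atTop (𝓝 1) := by
  have h : Tendsto (fun y : ℝ => ∫ s in Set.Ioi (0 : ℝ), exp (-s - s ^ 2 / (2 * y ^ 2))) atTop
      (𝓝 (∫ s in Set.Ioi (0 : ℝ), exp (-s))) := by
    refine tendsto_integral_filter_of_dominated_convergence (fun s => exp (-s)) ?_ ?_
      integrableOn_exp_neg ?_
    · exact Eventually.of_forall fun y => by fun_prop
    · refine Eventually.of_forall fun y => ae_of_all _ fun s => ?_
      rw [Real.norm_of_nonneg (Real.exp_pos _).le]
      exact Real.exp_le_exp.2 (by have : 0 ≤ s ^ 2 / (2 * y ^ 2) := by positivity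
                                  linarith)
    · refine ae_of_all _ fun s => ?_
      have h2 : Tendsto (fun y : ℝ => s ^ 2 / (2 * y ^ 2)) atTop (𝓝 0) :=
        Tendsto.div_atTop tendsto_const_nhds
          ((tendsto_pow_atTop two_ne_zero).const_mul_atTop two_pos)
      have h3 := (tendsto_const_nhds (x := -s)).sub h2
      rw [sub_zero] at h3
      exact (Real.continuous_exp.tendsto _).comp h3
  rw [integral_exp_neg_Ioi_zero'] at h
  refine h.congr' ?_
  filter_upwards [eventually_gt_atTop 0] with y hy
  exact (mills_eq_integral hy).symm

/-- The leading factor of `Phi (-(√2 * m))`. -/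
noncomputable def tailFactor (m : ℝ) : ℝ := exp (-m ^ 2) / (2 * √Real.pi * m)

lemma tailFactor_eq {m : ℝ} (hm : 0 < m) : tailFactor m = √Real.pi * phi m ^ 2 / m := by
  have h1 : exp (-m ^ 2) = exp (-(m ^ 2 / 2)) ^ 2 := by
    rw [← Real.exp_nat_mul]; congr 1; push_cast; ring
  have h2 : √(2 * Real.pi) ^ 2 = 2 * Real.pi := Real.sq_sqrt (by positivity)
  have h3 : √Real.pi ^ 2 = Real.pi := Real.sq_sqrt (by positivity)
  have h4 : 0 < √Real.pi := Real.sqrt_pos.2 Real.pi_pos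
  rw [tailFactor, phi, div_pow, h2, h1]
  field_simp
  rw [h3]

lemma tailFactor_pos {m : ℝ} (hm : 0 < m) : 0 < tailFactor m := by
  have h4 : 0 < √Real.pi := Real.sqrt_pos.2 Real.pi_pos
  exact div_pos (Real.exp_pos _) (by positivity)

lemma Phi_sqrt_two_mul_neg {y : ℝ} (hy : 0 < y) :
    Phi (√2 * (-y)) = tailFactor y * mills (√2 * y) := by
  have h2 : 0 < √2 := Real.sqrt_pos.2 two_pos
  have h4 : 0 < √Real.pi := Real.sqrt_pos.2 Real.pi_pos
  have hy2 : 0 < √2 * y := mul_pos h2 hy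
  rw [show √2 * (-y) = -(√2 * y) by ring, Phi_neg_eq hy2.ne']
  congr 1
  have h5 : √2 ^ 2 = 2 := Real.sq_sqrt (by norm_num)
  rw [phi, tailFactor, mul_pow, h5, Real.sqrt_mul (by norm_num), div_div]
  congr 1
  · congr 1; ring
  · calc √2 * √Real.pi * (√2 * y) = √2 ^ 2 * √Real.pi * y := by ring
      _ = _ := by rw [h5]

/-! ### An Abelian theorem at the scale `u ~ 1 / n`. -/

open scoped Nat

/-- The function `u ^ k / (1 + log (1 / u)) ^ p`, regularly varying at zero. -/
noncomputable def profile (k : ℕ) (p u : ℝ) : ℝ := u ^ k * (1 + log u⁻¹) ^ (-p)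

lemma one_le_one_add_log_inv {u : ℝ} (hu : u ∈ Set.Ioo (0 : ℝ) 1) : 1 ≤ 1 + log u⁻¹ := by
  have := Real.log_nonneg ((one_le_inv₀ hu.1).2 hu.2.le)
  linarith

lemma profile_pos {k : ℕ} {p u : ℝ} (hu : u ∈ Set.Ioo (0 : ℝ) 1) : 0 < profile k p u :=
  mul_pos (pow_pos hu.1 k)
    (Real.rpow_pos_of_pos (zero_lt_one.trans_le (one_le_one_add_log_inv hu)) _)

@[fun_prop]
lemma measurable_profile (k : ℕ) (p : ℝ) : Measurable (profile k p) := by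
  unfold profile; fun_prop

lemma integrableOn_pow_mul_exp_neg (k : ℕ) {b : ℝ} (hb : 0 < b) :
    IntegrableOn (fun t : ℝ => t ^ k * exp (-b * t)) (Set.Ioi 0) := by
  have := integrableOn_rpow_mul_exp_neg_mul_rpow (p := 1) (s := k) (b := b)
    (by have : (0 : ℝ) ≤ k := k.cast_nonneg
        linarith) one_pos hb
  simpa using this

lemma integral_pow_mul_exp_neg (k : ℕ) : ∫ t in Set.Ioi (0 : ℝ), t ^ k * exp (-t) = k ! := by
  rw [← Real.Gamma_nat_eq_factorial, Real.Gamma_eq_integral (by positivity)]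
  refine setIntegral_congr_fun measurableSet_Ioi fun t _ => ?_
  simp [mul_comm]

/-- A bound of Potter type: with `L = log (N / t)`, one has `log N = L + log t ≤ L + t - 1 ≤ (1 + t)
(1 + L)`. It dominates the logarithmic factor uniformly in `N`. -/
lemma log_div_le {N t : ℝ} (ht : 0 < t) (htN : t < N) :
    log N / (1 + log (t / N)⁻¹) ≤ 1 + t := by
  have hN : 0 < N := ht.trans htN
  have h1 : 0 ≤ log (t / N)⁻¹ := by
    refine Real.log_nonneg ?_
    rw [inv_div, one_le_div ht]; exact htN.le
  rw [div_le_iff₀ (by linarith)]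
  have h2 : log N = log (t / N)⁻¹ + log t := by
    rw [inv_div, Real.log_div hN.ne' ht.ne']; ring
  have h3 := Real.log_le_sub_one_of_pos ht
  nlinarith

/-- An Abelian theorem: the mass of `(1 - u) ^ (n - j)` sits at the scale `u ~ 1 / n`. -/
theorem tendsto_integral_one_sub_pow_mul {k j : ℕ} {p A c : ℝ} (hp0 : 0 ≤ p) (hp2 : p ≤ 2)
    {h : ℝ → ℝ} (hm : AEStronglyMeasurable h (volume.restrict (Set.Ioo 0 1)))
    (hb : ∀ u ∈ Set.Ioo (0 : ℝ) 1, |h u| ≤ A * profile k p u)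
    (hl : Tendsto (fun u => h u / profile k p u) (𝓝[>] 0) (𝓝 c)) :
    Tendsto (fun n : ℕ => (n : ℝ) ^ (k + 1) * log n ^ p *
      ∫ u in Set.Ioo (0 : ℝ) 1, (1 - u) ^ (n - j) * h u) atTop (𝓝 (c * k !)) := by
  let F : ℕ → ℝ → ℝ := fun n t => (n : ℝ) ^ k * log n ^ p *
    (Set.Ioo (0 : ℝ) 1).indicator (fun u => (1 - u) ^ (n - j) * h u) ((n : ℝ)⁻¹ * t)
  have hA : 0 ≤ A := by
    have hu : (1 / 2 : ℝ) ∈ Set.Ioo (0 : ℝ) 1 := by norm_num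
    exact nonneg_of_mul_nonneg_left ((abs_nonneg _).trans (hb _ hu)) (profile_pos hu)
  -- Substitute `u = t / n`.
  have hsubst : ∀ n : ℕ, 0 < n → (n : ℝ) ^ (k + 1) * log n ^ p *
      ∫ u in Set.Ioo (0 : ℝ) 1, (1 - u) ^ (n - j) * h u = ∫ t in Set.Ioi (0 : ℝ), F n t := by
    intro n hn
    have hn' : (0 : ℝ) < n := Nat.cast_pos.2 hn
    have h1 : ∫ u in Set.Ioo (0 : ℝ) 1, (1 - u) ^ (n - j) * h u = ∫ u in Set.Ioi (0 : ℝ),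
        (Set.Ioo (0 : ℝ) 1).indicator (fun u => (1 - u) ^ (n - j) * h u) u := by
      rw [integral_indicator measurableSet_Ioo, Measure.restrict_restrict measurableSet_Ioo]
      congr 2
      ext x; simp only [Set.mem_inter_iff, Set.mem_Ioo, Set.mem_Ioi]; tauto
    have h2 := integral_comp_mul_left_Ioi
      ((Set.Ioo (0 : ℝ) 1).indicator (fun u => (1 - u) ^ (n - j) * h u)) 0 (inv_pos.2 hn')
    rw [mul_zero, inv_inv, smul_eq_mul, ← h1] at h2
    simp only [F]
    rw [integral_const_mul, h2]
    ring
  have hlim : Tendsto (fun n : ℕ => ∫ t in Set.Ioi (0 : ℝ), F n t) atTop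
      (𝓝 (∫ t in Set.Ioi (0 : ℝ), c * (t ^ k * exp (-t)))) := by
    refine tendsto_integral_filter_of_dominated_convergence
      (fun t => A * ((1 + t) ^ 2 * (t ^ k * exp (-(1 / 2) * t)))) ?_ ?_ ?_ ?_
    · filter_upwards [eventually_gt_atTop 0] with n hn
      have hn' : (0 : ℝ) < n := Nat.cast_pos.2 hn
      have hg : AEStronglyMeasurable ((Set.Ioo (0 : ℝ) 1).indicator
          (fun u => (1 - u) ^ (n - j) * h u)) volume := by
        rw [aestronglyMeasurable_indicator_iff measurableSet_Ioo]
        exact AEStronglyMeasurable.mul (by fun_prop) hm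
      have hq : Measure.QuasiMeasurePreserving (fun t : ℝ => (n : ℝ)⁻¹ * t) volume volume := by
        refine ⟨by fun_prop, ?_⟩
        rw [Real.map_volume_mul_left (inv_pos.2 hn').ne']
        exact Measure.smul_absolutelyContinuous
      exact (hg.comp_quasiMeasurePreserving hq).restrict.const_mul _
    · filter_upwards [eventually_ge_atTop (2 * j + 1)] with n hn
      rw [ae_restrict_iff' measurableSet_Ioi]
      refine ae_of_all _ fun t (ht : 0 < t) => ?_
      have hn' : (0 : ℝ) < n := Nat.cast_pos.2 (by omega)
      have hlog : 0 ≤ log n := Real.log_natCast_nonneg n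
      by_cases hu : (n : ℝ)⁻¹ * t ∈ Set.Ioo (0 : ℝ) 1
      swap
      · simp only [F, Set.indicator_of_notMem hu, mul_zero, norm_zero]
        positivity
      simp only [F, Set.indicator_of_mem hu]
      set u := (n : ℝ)⁻¹ * t with hudef
      have hut : u = t / n := by rw [hudef]; ring
      have htn : t < n := by
        have := hu.2
        rwa [hut, div_lt_one hn'] at this
      have e1 : (1 - u) ^ (n - j) ≤ exp (-(1 / 2) * t) := by
        have h1 : 1 - u ≤ exp (-u) := by linarith [Real.add_one_le_exp (-u)]
        refine (pow_le_pow_left₀ (by linarith [hu.2]) h1 _).trans ?_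
        rw [← Real.exp_nat_mul]
        refine Real.exp_le_exp.2 ?_
        -- Since `n ≥ 2 j + 1`, losing `j` factors costs at most half of the exponent, hence the
        -- rate `1/2` in the dominating function.
        have h2 : (n : ℝ) / 2 ≤ ((n - j : ℕ) : ℝ) := by
          rw [Nat.cast_sub (by omega)]
          have : (2 * j + 1 : ℝ) ≤ n := by exact_mod_cast hn
          linarith
        have h3 : t = n * u := by rw [hut]; field_simp
        have := mul_le_mul_of_nonneg_right h2 hu.1.le
        rw [h3]; linarith
      have hone := one_le_one_add_log_inv hu
      have e2 : (n : ℝ) ^ k * log n ^ p * profile k p u ≤ t ^ k * (1 + t) ^ 2 := by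
        have h1 : (n : ℝ) ^ k * log n ^ p * profile k p u =
            t ^ k * (log n / (1 + log u⁻¹)) ^ p := by
          rw [profile, Real.div_rpow hlog (by linarith), Real.rpow_neg (by linarith), hut, div_pow]
          field_simp
        rw [h1]
        refine mul_le_mul_of_nonneg_left ?_ (by positivity)
        have h2 : log n / (1 + log u⁻¹) ≤ 1 + t := by rw [hut]; exact log_div_le ht htn
        refine (Real.rpow_le_rpow (div_nonneg hlog (by linarith)) h2 hp0).trans ?_
        -- Here `p ≤ 2` is used: it replaces the power `p` by a square, so that the dominating
        -- function is a polynomial times an exponential.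
        rw [← Real.rpow_natCast]
        exact Real.rpow_le_rpow_of_exponent_le (by linarith) (by exact_mod_cast hp2)
      have hu1 : 0 ≤ 1 - u := by linarith [hu.2]
      rw [Real.norm_eq_abs, abs_mul, abs_mul ((1 - u) ^ (n - j)), abs_of_nonneg (by positivity),
        abs_of_nonneg (pow_nonneg hu1 _)]
      calc (n : ℝ) ^ k * log n ^ p * ((1 - u) ^ (n - j) * |h u|)
          ≤ (n : ℝ) ^ k * log n ^ p * (exp (-(1 / 2) * t) * (A * profile k p u)) := by
            gcongr
            exact hb u hu
        _ = A * exp (-(1 / 2) * t) * ((n : ℝ) ^ k * log n ^ p * profile k p u) := by ring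
        _ ≤ A * exp (-(1 / 2) * t) * (t ^ k * (1 + t) ^ 2) := by gcongr
        _ = _ := by ring
    · have h1 := integrableOn_pow_mul_exp_neg k (b := 1 / 2) (by norm_num)
      have h2 := integrableOn_pow_mul_exp_neg (k + 1) (b := 1 / 2) (by norm_num)
      have h3 := integrableOn_pow_mul_exp_neg (k + 2) (b := 1 / 2) (by norm_num)
      refine (((h1.add (h2.const_mul 2)).add h3).const_mul A).congr (ae_of_all _ fun t => ?_)
      simp only [Pi.add_apply]
      ring
    · rw [ae_restrict_iff' measurableSet_Ioi]
      refine ae_of_all _ fun t (ht : 0 < t) => ?_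
      have hnat : Tendsto (fun n : ℕ => (n : ℝ)) atTop atTop := tendsto_natCast_atTop_atTop
      have hu0 : Tendsto (fun n : ℕ => (n : ℝ)⁻¹ * t) atTop (𝓝 0) := by
        simpa using (tendsto_inv_atTop_zero.comp hnat).mul_const t
      have hu : Tendsto (fun n : ℕ => (n : ℝ)⁻¹ * t) atTop (𝓝[>] 0) := by
        refine tendsto_nhdsWithin_iff.2 ⟨hu0, ?_⟩
        filter_upwards [eventually_gt_atTop 0] with n hn
        exact mul_pos (inv_pos.2 (Nat.cast_pos.2 hn)) ht
      have l1 := hl.comp hu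
      have l2 : Tendsto (fun n : ℕ => (1 - (n : ℝ)⁻¹ * t) ^ (n - j)) atTop (𝓝 (exp (-t))) := by
        have a1 := Real.tendsto_one_add_div_pow_exp (-t)
        have a2 : Tendsto (fun n : ℕ => (1 - (n : ℝ)⁻¹ * t) ^ j) atTop (𝓝 1) := by
          simpa using (tendsto_const_nhds (x := (1 : ℝ)).sub hu0).pow j
        have a3 := a1.div a2 one_ne_zero
        rw [div_one] at a3
        refine a3.congr' ?_
        filter_upwards [eventually_ge_atTop j, hu0.eventually (gt_mem_nhds zero_lt_one)]
          with n hn hlt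
        rw [Pi.div_apply, div_eq_iff (pow_pos (by linarith) j).ne', ← pow_add,
           Nat.sub_add_cancel hn]
        congr 1
        ring
      have l3 : Tendsto (fun n : ℕ => (log n / (1 + log ((n : ℝ)⁻¹ * t)⁻¹)) ^ p) atTop (𝓝 1) := by
        have b1 : Tendsto (fun n : ℕ => log n) atTop atTop := Real.tendsto_log_atTop.comp hnat
        have b2 : Tendsto (fun n : ℕ => 1 + (1 - log t) / log n) atTop (𝓝 1) := by
          simpa using tendsto_const_nhds (x := (1 : ℝ)) |>.add (b1.const_div_atTop (1 - log t))
        have b3 := (b2.inv₀ one_ne_zero).rpow_const (p := p) (Or.inl (by norm_num))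
        simp only [inv_one, Real.one_rpow] at b3
        refine b3.congr' ?_
        filter_upwards [eventually_gt_atTop 0, b1.eventually_gt_atTop 0] with n hn hln
        have hn' : (0 : ℝ) < n := Nat.cast_pos.2 hn
        have : log ((n : ℝ)⁻¹ * t)⁻¹ = log n - log t := by
          rw [mul_inv, inv_inv, ← div_eq_mul_inv, Real.log_div hn'.ne' ht.ne']
        rw [this]
        congr 1
        have e : 1 + (1 - log t) / log n = (1 + (log n - log t)) / log n := by
          field_simp; ring
        rw [e, inv_div]
      have l4 := ((l1.mul l2).mul (l3.const_mul (t ^ k)))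
      have e : c * exp (-t) * (t ^ k * 1) = c * (t ^ k * exp (-t)) := by ring
      rw [e] at l4
      refine l4.congr' ?_
      filter_upwards [eventually_gt_atTop 1, hu0.eventually (gt_mem_nhds zero_lt_one)] with n hn hlt
      have hn' : (0 : ℝ) < n := Nat.cast_pos.2 (by omega)
      have hmem : (n : ℝ)⁻¹ * t ∈ Set.Ioo (0 : ℝ) 1 := ⟨mul_pos (inv_pos.2 hn') ht, hlt⟩
      have hone := one_le_one_add_log_inv hmem
      have hlog : 0 ≤ log n := Real.log_natCast_nonneg n
      simp only [F, Set.indicator_of_mem hmem, Function.comp]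
      rw [profile, Real.div_rpow hlog (by linarith), Real.rpow_neg (by linarith), mul_pow,
        inv_pow]
      have hpos := Real.rpow_pos_of_pos (zero_lt_one.trans_le hone) p
      generalize (1 + log ((n : ℝ)⁻¹ * t)⁻¹) ^ p = L at hpos
      generalize h ((n : ℝ)⁻¹ * t) = y
      generalize (1 - (n : ℝ)⁻¹ * t) ^ (n - j) = w
      field_simp
  rw [integral_const_mul, integral_pow_mul_exp_neg] at hlim
  refine hlim.congr' ?_
  filter_upwards [eventually_gt_atTop 0] with n hn
  exact (hsubst n hn).symm

/-! ### Uniform bounds for the pair density near the minimum. -/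

/-- The joint density of the excess `η` and the value `b` weighted with the pair probability,
for the second smallest value `-m` and the smallest value `-m - ζ`. -/
noncomputable def kernel (m ζ η b : ℝ) : ℝ :=
  if -m + η < b then phi (-m + η) * phi b * pairFn (-m - ζ) (-m + η) b else 0

/-- Minus the threshold in the coordinates of `kernel`. -/
noncomputable def depth (m ζ η b : ℝ) : ℝ := m + ζ + √((η + ζ) * (b + m + ζ))

lemma pairFn_eq_depth (m ζ η b : ℝ) :
    pairFn (-m - ζ) (-m + η) b = Phi (√2 * (-depth m ζ η b)) := by
  rw [pairFn, depth]
  congr 2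
  rw [show (-m + η - (-m - ζ)) * (b - (-m - ζ)) = (η + ζ) * (b + m + ζ) by ring]
  ring

lemma kernel_nonneg (m ζ η b : ℝ) : 0 ≤ kernel m ζ η b := by
  unfold kernel
  split_ifs
  · exact mul_nonneg (mul_nonneg (phi_pos _).le (phi_pos _).le) (pairFn_nonneg _ _ _)
  · exact le_rfl

/-- The dominating function in the excesses, on the scale `m ^ (-3)`. -/
noncomputable def decay (s : ℝ) : ℝ := exp (-(1 / 24) * √s)

lemma decay_pos (s : ℝ) : 0 < decay s := Real.exp_pos _

@[fun_prop]
lemma continuous_decay : Continuous decay := by unfold decay; fun_prop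

lemma integrableOn_decay : IntegrableOn decay (Set.Ioi 0) := by
  have := integrableOn_rpow_mul_exp_neg_mul_rpow (p := 1 / 2) (s := 0) (b := 1 / 24)
    (by norm_num) (by norm_num) (by norm_num)
  refine this.congr (ae_of_all _ fun t => ?_)
  simp [decay, Real.sqrt_eq_rpow]

/-- The growth `m η` of the density of `a` has to be beaten. If `b` is at distance at least `m / 2`
from `-m`, one half of the square-root term absorbs `m η` and the other half gives the decay.
Otherwise `b ≤ -m / 2`, and the decay is paid for by half of the Gaussian exponent of `b`. -/
lemma exponent_le {m ζ η b : ℝ} (hm : 0 < m) (hζ : 0 ≤ ζ) (hη : 0 ≤ η) (hb : -m + η < b) :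
    m * η - b ^ 2 / 2 - 2 * m * ζ - 2 * m * √((η + ζ) * (b + m + ζ)) ≤
      -(b ^ 2 / 4) - 1 / 24 * √(m ^ 3 * ζ) - 1 / 24 * √(m ^ 3 * η) := by
  set E := b + m with hE
  have hEη : η ≤ E := by linarith
  have h1 : η + ζ ≤ √((η + ζ) * (E + ζ)) := by
    refine Real.le_sqrt_of_sq_le ?_
    rw [sq]
    exact mul_le_mul_of_nonneg_left (by linarith) (by linarith)
  rcases le_total (m / 2) E with hcase | hcase
  · have h2 : ∀ x, 0 ≤ x → x ≤ η + ζ → √(m ^ 3 * x) ≤ 2 * (m * √((η + ζ) * (E + ζ))) := by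
      intro x hx hx'
      refine Real.sqrt_le_iff.2 ⟨by positivity, ?_⟩
      rw [mul_pow, mul_pow, Real.sq_sqrt (mul_nonneg (by linarith) (by linarith))]
      have e1 : x * (m / 2) ≤ (η + ζ) * (E + ζ) :=
        mul_le_mul hx' (by linarith) (by linarith) (by linarith)
      have := mul_le_mul_of_nonneg_left e1 (sq_nonneg m)
      nlinarith [mul_nonneg (pow_pos hm 3).le hx]
    have h3 := h2 ζ hζ (by linarith)
    have h4 := h2 η hη (by linarith)
    have h5 := mul_le_mul_of_nonneg_left h1 hm.le
    nlinarith [sq_nonneg b, mul_nonneg hm.le hζ]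
  -- This case fixes the constant `1/24`: the available `b^2 / 4 ≥ m^2 / 16` must cover `m^2 / 24`
  -- from `η` and `m^2 / 48` from `ζ`, which add up to exactly `m^2 / 16`.
  · have hb2 : m ^ 2 / 4 ≤ b ^ 2 := by nlinarith
    have h3 : √(m ^ 3 * η) ≤ m ^ 2 := by
      refine Real.sqrt_le_iff.2 ⟨by positivity, ?_⟩
      have : η ≤ m := by linarith
      calc m ^ 3 * η ≤ m ^ 3 * m := by gcongr
        _ = _ := by ring
    have h4 : √(m ^ 3 * ζ) ≤ (m ^ 2 + m * ζ) / 2 := by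
      refine Real.sqrt_le_iff.2 ⟨by positivity, ?_⟩
      nlinarith [sq_nonneg (m ^ 2 - m * ζ)]
    have h5 := mul_le_mul_of_nonneg_left h1 hm.le
    nlinarith [mul_nonneg hm.le hζ]

lemma le_depth {m ζ : ℝ} (hζ : 0 ≤ ζ) (η b : ℝ) : m ≤ depth m ζ η b := by
  have := Real.sqrt_nonneg ((η + ζ) * (b + m + ζ))
  unfold depth
  linarith

/-- With `R` the square root in `depth`, expanding gives `depth^2 ≥ m^2 + 2 m ζ + 2 m R`; the Mills
ratio is at most `1` and the denominator only grows. -/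
lemma pairFn_le_exp {m ζ η b : ℝ} (hm : 0 < m) (hζ : 0 ≤ ζ) :
    pairFn (-m - ζ) (-m + η) b ≤
      tailFactor m * exp (-(2 * m * ζ) - 2 * m * √((η + ζ) * (b + m + ζ))) := by
  have hy := le_depth (m := m) hζ η b
  have hy0 : 0 < depth m ζ η b := hm.trans_le hy
  have h2 : 0 < √2 := Real.sqrt_pos.2 two_pos
  have hpi : 0 < √Real.pi := Real.sqrt_pos.2 Real.pi_pos
  rw [pairFn_eq_depth, Phi_sqrt_two_mul_neg hy0]
  refine (mul_le_of_le_one_right (tailFactor_pos hy0).le (mills_le_one (mul_pos h2 hy0))).trans ?_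
  rw [tailFactor, tailFactor, div_mul_eq_mul_div, ← Real.exp_add]
  refine div_le_div₀ (Real.exp_pos _).le (Real.exp_le_exp.2 ?_) (by positivity) (by gcongr)
  have hs := Real.sqrt_nonneg ((η + ζ) * (b + m + ζ))
  unfold depth
  nlinarith [mul_nonneg hζ hs]

lemma phi_sub_add (m η : ℝ) : phi (-m + η) = phi m * exp (m * η - η ^ 2 / 2) := by
  rw [phi, phi, div_mul_eq_mul_div, ← Real.exp_add]
  congr 2
  ring

lemma kernel_le {m ζ η : ℝ} (hm : 0 < m) (hζ : 0 ≤ ζ) (hη : 0 ≤ η) (b : ℝ) :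
    kernel m ζ η b ≤ phi m * tailFactor m / √(2 * Real.pi) *
      (decay (m ^ 3 * ζ) * (decay (m ^ 3 * η) * exp (-(b ^ 2 / 4)))) := by
  have ht := tailFactor_pos hm
  have hφ := phi_pos m
  have hpi := sqrt_two_pi_pos
  unfold kernel
  split_ifs with h
  · calc phi (-m + η) * phi b * pairFn (-m - ζ) (-m + η) b
        ≤ (phi m * exp (m * η)) * phi b *
          (tailFactor m * exp (-(2 * m * ζ) - 2 * m * √((η + ζ) * (b + m + ζ)))) := by
          refine mul_le_mul ?_ (pairFn_le_exp hm hζ) (pairFn_nonneg _ _ _)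
            (mul_nonneg (by positivity) (phi_pos b).le)
          refine mul_le_mul_of_nonneg_right ?_ (phi_pos b).le
          rw [phi_sub_add]
          gcongr
          nlinarith [sq_nonneg η]
      _ = phi m * tailFactor m / √(2 * Real.pi) *
          exp (m * η - b ^ 2 / 2 - 2 * m * ζ - 2 * m * √((η + ζ) * (b + m + ζ))) := by
          rw [show m * η - b ^ 2 / 2 - 2 * m * ζ - 2 * m * √((η + ζ) * (b + m + ζ)) =
            m * η + (-(b ^ 2 / 2) + (-(2 * m * ζ) - 2 * m * √((η + ζ) * (b + m + ζ)))) by ring,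
            Real.exp_add, Real.exp_add, phi.eq_def b]
          ring
      _ ≤ phi m * tailFactor m / √(2 * Real.pi) *
          exp (-(b ^ 2 / 4) - 1 / 24 * √(m ^ 3 * ζ) - 1 / 24 * √(m ^ 3 * η)) := by
          gcongr _ * ?_
          exact Real.exp_le_exp.2 (exponent_le hm hζ hη h)
      _ = _ := by
          rw [decay, decay, ← Real.exp_add, ← Real.exp_add]
          congr 2
          ring
  · have := decay_pos (m ^ 3 * ζ)
    have := decay_pos (m ^ 3 * η)
    positivity

lemma measurable_kernel (m : ℝ) :
    Measurable fun p : ℝ × ℝ × ℝ => kernel m p.1 p.2.1 p.2.2 := by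
  unfold kernel
  refine Measurable.ite (measurableSet_lt (by fun_prop) (by fun_prop)) ?_ measurable_const
  exact ((continuous_phi.measurable.comp (by fun_prop)).mul
    (continuous_phi.measurable.comp (by fun_prop))).mul (by fun_prop)

lemma pairMass_eq {m c : ℝ} (hc : 0 < c) (ζ : ℝ) :
    pairMass (-m - ζ) (-m) = ∫⁻ t in Set.Ioi (0 : ℝ), ENNReal.ofReal c *
      ∫⁻ b, ENNReal.ofReal (kernel m ζ (c * t) b) := by
  have h1 : pairMass (-m - ζ) (-m) = ∫⁻ a in Set.Ioi (-m), ENNReal.ofReal (phi a) *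
      ∫⁻ b, ENNReal.ofReal (phi b) *
        (if a < b then ENNReal.ofReal (pairFn (-m - ζ) a b) else 0) := by
    rw [pairMass, lintegral_gaussianReal, ← lintegral_indicator measurableSet_Ioi]
    refine lintegral_congr fun a => ?_
    rw [lintegral_gaussianReal]
    by_cases h : -m < a
    · rw [Set.indicator_of_mem (Set.mem_Ioi.2 h)]
      simp [h]
    · simp [h]
  rw [h1, setLIntegral_Ioi_affine _ _ hc]
  refine lintegral_congr fun t => ?_
  congr 1
  rw [← lintegral_const_mul']
  · refine lintegral_congr fun b => ?_
    unfold kernel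
    split_ifs with h
    · rw [ENNReal.ofReal_mul (mul_nonneg (phi_pos _).le (phi_pos _).le),
        ENNReal.ofReal_mul (phi_pos _).le, mul_assoc]
    · simp
  · exact ENNReal.ofReal_ne_top

lemma lintegral_decay_lt_top : ∫⁻ t in Set.Ioi (0 : ℝ), ENNReal.ofReal (decay t) < ∞ :=
  integrableOn_decay.lintegral_lt_top

lemma lintegral_exp_neg_sq_lt_top : ∫⁻ b : ℝ, ENNReal.ofReal (exp (-(b ^ 2 / 4))) < ∞ := by
  have h := integrable_exp_neg_mul_sq (b := 1 / 4) (by norm_num)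
  have h' : Integrable fun b : ℝ => exp (-(b ^ 2 / 4)) := by
    refine h.congr (ae_of_all _ fun b => ?_)
    dsimp only
    congr 1; ring
  exact h'.lintegral_lt_top

lemma pow_three_mul_inv {m : ℝ} (hm : 0 < m) (s : ℝ) : m ^ 3 * ((m ^ 3)⁻¹ * s) = s := by
  rw [mul_inv_cancel_left₀ (pow_pos hm 3).ne']

/-- The constant in the bound for `pairMass`. -/
noncomputable def massConst : ℝ≥0∞ :=
  (∫⁻ t in Set.Ioi (0 : ℝ), ENNReal.ofReal (decay t)) *
    ∫⁻ b : ℝ, ENNReal.ofReal (exp (-(b ^ 2 / 4)))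

lemma massConst_lt_top : massConst < ∞ :=
  ENNReal.mul_lt_top lintegral_decay_lt_top lintegral_exp_neg_sq_lt_top

/-- With `η = t / m^3` the bound on `kernel` factors into functions of `ζ`, `t` and `b`, so
integrating out `t` and `b` leaves the constant `massConst`. -/
lemma pairMass_le {m : ℝ} (hm : 0 < m) {ζ : ℝ} (hζ : 0 ≤ ζ) :
    pairMass (-m - ζ) (-m) ≤
      ENNReal.ofReal (phi m * tailFactor m / m ^ 3 * decay (m ^ 3 * ζ)) * massConst := by
  have ht := tailFactor_pos hm
  have hφ := phi_pos m
  have hd := decay_pos (m ^ 3 * ζ)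
  have hpi : 1 ≤ √(2 * Real.pi) := by
    rw [Real.one_le_sqrt]; linarith [Real.pi_gt_three]
  rw [pairMass_eq (inv_pos.2 (pow_pos hm 3))]
  calc ∫⁻ t in Set.Ioi (0 : ℝ), ENNReal.ofReal (m ^ 3)⁻¹ *
      ∫⁻ b, ENNReal.ofReal (kernel m ζ ((m ^ 3)⁻¹ * t) b)
      ≤ ∫⁻ t in Set.Ioi (0 : ℝ), ENNReal.ofReal (m ^ 3)⁻¹ *
        ∫⁻ b, ENNReal.ofReal (phi m * tailFactor m * decay (m ^ 3 * ζ)) *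
          (ENNReal.ofReal (decay t) * ENNReal.ofReal (exp (-(b ^ 2 / 4)))) := by
        refine setLIntegral_mono' measurableSet_Ioi fun t (h0 : 0 < t) => ?_
        gcongr with b
        rw [← ENNReal.ofReal_mul (decay_pos t).le, ← ENNReal.ofReal_mul (by positivity)]
        refine ENNReal.ofReal_le_ofReal ((kernel_le hm hζ (by positivity) b).trans ?_)
        rw [pow_three_mul_inv hm, mul_assoc (phi m * tailFactor m)]
        refine mul_le_mul_of_nonneg_right ?_ ?_
        · exact div_le_self (by positivity) hpi
        · have := decay_pos t
          positivity
    _ = _ := by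
        have h1 : ∀ t, ∫⁻ b : ℝ, ENNReal.ofReal (phi m * tailFactor m * decay (m ^ 3 * ζ)) *
            (ENNReal.ofReal (decay t) * ENNReal.ofReal (exp (-(b ^ 2 / 4)))) =
            ENNReal.ofReal (phi m * tailFactor m * decay (m ^ 3 * ζ)) *
            (∫⁻ b : ℝ, ENNReal.ofReal (exp (-(b ^ 2 / 4)))) * ENNReal.ofReal (decay t) := by
          intro t
          rw [lintegral_const_mul' _ _ ENNReal.ofReal_ne_top,
            lintegral_const_mul' _ _ ENNReal.ofReal_ne_top]
          ring
        simp only [h1]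
        rw [lintegral_const_mul' _ _ ENNReal.ofReal_ne_top, lintegral_const_mul' _ _
          (ENNReal.mul_ne_top ENNReal.ofReal_ne_top lintegral_exp_neg_sq_lt_top.ne), massConst,
          show phi m * tailFactor m / m ^ 3 * decay (m ^ 3 * ζ) =
            (m ^ 3)⁻¹ * (phi m * tailFactor m * decay (m ^ 3 * ζ)) by ring,
          ENNReal.ofReal_mul (p := (m ^ 3)⁻¹) (by positivity)]
        ring

lemma phi_sub_le {m : ℝ} (hm : 0 < m) {ζ : ℝ} (hζ : 0 ≤ ζ) : phi (-m - ζ) ≤ phi m := by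
  refine div_le_div_of_nonneg_right (Real.exp_le_exp.2 ?_) sqrt_two_pi_pos.le
  nlinarith [mul_nonneg hm.le hζ]

lemma setLIntegral_Iio_neg_eq {m : ℝ} (hm : 0 < m) (f : ℝ → ℝ≥0∞) :
    ∫⁻ v in Set.Iio (-m), f v ∂(gaussianReal 0 1) = ∫⁻ s in Set.Ioi (0 : ℝ),
      ENNReal.ofReal (m ^ 3)⁻¹ * (ENNReal.ofReal (phi (-m - (m ^ 3)⁻¹ * s)) *
        f (-m - (m ^ 3)⁻¹ * s)) := by
  rw [setLIntegral_gaussianReal measurableSet_Iio,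
    setLIntegral_Iio_affine _ _ (inv_pos.2 (pow_pos hm 3))]

lemma setLIntegral_pairMass_le {m : ℝ} (hm : 0 < m) :
    ∫⁻ v in Set.Iio (-m), pairMass v (-m) ∂(gaussianReal 0 1) ≤
      ENNReal.ofReal (phi m ^ 2 * tailFactor m / m ^ 6) *
        (massConst * ∫⁻ t in Set.Ioi (0 : ℝ), ENNReal.ofReal (decay t)) := by
  have ht := tailFactor_pos hm
  have hφ := phi_pos m
  rw [setLIntegral_Iio_neg_eq hm]
  calc _ ≤ ∫⁻ s in Set.Ioi (0 : ℝ), ENNReal.ofReal (m ^ 3)⁻¹ * (ENNReal.ofReal (phi m) *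
        (ENNReal.ofReal (phi m * tailFactor m / m ^ 3 * decay s) * massConst)) := by
        refine setLIntegral_mono' measurableSet_Ioi fun s (h0 : 0 < s) => ?_
        have hs : 0 ≤ (m ^ 3)⁻¹ * s := by positivity
        have h1 := pairMass_le hm hs
        rw [pow_three_mul_inv hm] at h1
        gcongr
        exact phi_sub_le hm hs
    _ = ∫⁻ s in Set.Ioi (0 : ℝ), (ENNReal.ofReal (phi m ^ 2 * tailFactor m / m ^ 6) * massConst) *
          ENNReal.ofReal (decay s) := by
        refine lintegral_congr fun s => ?_
        have hw : 0 ≤ phi m * tailFactor m / m ^ 3 := by positivity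
        rw [show phi m ^ 2 * tailFactor m / m ^ 6 =
          (m ^ 3)⁻¹ * (phi m * (phi m * tailFactor m / m ^ 3)) by field_simp]
        generalize phi m * tailFactor m / m ^ 3 = w at hw
        rw [ENNReal.ofReal_mul hw, ENNReal.ofReal_mul (by positivity), ENNReal.ofReal_mul hφ.le]
        ring
    _ = _ := by
        rw [lintegral_const_mul' _ _ (ENNReal.mul_ne_top ENNReal.ofReal_ne_top
          massConst_lt_top.ne)]
        ring

lemma setLIntegral_Phi_mul_pairMass_le {m : ℝ} (hm : 0 < m) :
    ∫⁻ v in Set.Iio (-m), ENNReal.ofReal (Phi (√2 * v)) * pairMass v (-m) ∂(gaussianReal 0 1) ≤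
      ENNReal.ofReal (phi m ^ 2 * tailFactor m ^ 2 / m ^ 6) *
        (massConst * ∫⁻ t in Set.Ioi (0 : ℝ), ENNReal.ofReal (decay t)) := by
  have ht := tailFactor_pos hm
  have hφ := phi_pos m
  have h2 : 0 < √2 := Real.sqrt_pos.2 two_pos
  calc _ ≤ ∫⁻ v in Set.Iio (-m), ENNReal.ofReal (tailFactor m) * pairMass v (-m)
        ∂(gaussianReal 0 1) := by
        refine setLIntegral_mono' measurableSet_Iio fun v (hv : v < -m) => ?_
        gcongr
        refine (Phi_mono (by gcongr : √2 * v ≤ √2 * (-m))).trans ?_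
        rw [Phi_sqrt_two_mul_neg hm]
        exact mul_le_of_le_one_right ht.le (mills_le_one (mul_pos h2 hm))
    _ ≤ ENNReal.ofReal (tailFactor m) * (ENNReal.ofReal (phi m ^ 2 * tailFactor m / m ^ 6) *
        (massConst * ∫⁻ t in Set.Ioi (0 : ℝ), ENNReal.ofReal (decay t))) := by
        rw [lintegral_const_mul' _ _ ENNReal.ofReal_ne_top]
        gcongr
        exact setLIntegral_pairMass_le hm
    _ = _ := by
        rw [← mul_assoc, ← ENNReal.ofReal_mul ht.le]
        congr 2
        ring

lemma setLIntegral_pairMass_sq_le {m : ℝ} (hm : 0 < m) :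
    ∫⁻ v in Set.Iio (-m), pairMass v (-m) ^ 2 ∂(gaussianReal 0 1) ≤
      ENNReal.ofReal (phi m ^ 3 * tailFactor m ^ 2 / m ^ 9) *
        (massConst ^ 2 * ∫⁻ t in Set.Ioi (0 : ℝ), ENNReal.ofReal (decay t)) := by
  have ht := tailFactor_pos hm
  have hφ := phi_pos m
  rw [setLIntegral_Iio_neg_eq hm]
  calc _ ≤ ∫⁻ s in Set.Ioi (0 : ℝ), ENNReal.ofReal (m ^ 3)⁻¹ * (ENNReal.ofReal (phi m) *
        ((ENNReal.ofReal (phi m * tailFactor m / m ^ 3 * decay s) * massConst) *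
          (ENNReal.ofReal (phi m * tailFactor m / m ^ 3) * massConst))) := by
        refine setLIntegral_mono' measurableSet_Ioi fun s (h0 : 0 < s) => ?_
        have hs : 0 ≤ (m ^ 3)⁻¹ * s := by positivity
        have h1 := pairMass_le hm hs
        rw [pow_three_mul_inv hm] at h1
        -- Only one of the two factors has to keep its decay for the integral in `s` to converge.
        have h2 : pairMass (-m - (m ^ 3)⁻¹ * s) (-m) ≤
            ENNReal.ofReal (phi m * tailFactor m / m ^ 3) * massConst := by
          refine h1.trans ?_
          gcongr
          refine mul_le_of_le_one_right (by positivity) ?_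
          exact Real.exp_le_one_iff.2 (by have := Real.sqrt_nonneg s
                                          linarith)
        rw [sq]
        gcongr
        exact phi_sub_le hm hs
    _ = ∫⁻ s in Set.Ioi (0 : ℝ), (ENNReal.ofReal (phi m ^ 3 * tailFactor m ^ 2 / m ^ 9) *
          massConst ^ 2) * ENNReal.ofReal (decay s) := by
        refine lintegral_congr fun s => ?_
        have hw : 0 ≤ phi m * tailFactor m / m ^ 3 := by positivity
        rw [show phi m ^ 3 * tailFactor m ^ 2 / m ^ 9 = (m ^ 3)⁻¹ * (phi m *
          ((phi m * tailFactor m / m ^ 3) * (phi m * tailFactor m / m ^ 3))) by field_simp]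
        generalize phi m * tailFactor m / m ^ 3 = w at hw
        rw [ENNReal.ofReal_mul hw, ENNReal.ofReal_mul (by positivity), ENNReal.ofReal_mul hφ.le,
          ENNReal.ofReal_mul hw]
        ring
    _ = _ := by
        rw [lintegral_const_mul' _ _ (ENNReal.mul_ne_top ENNReal.ofReal_ne_top
          (ENNReal.pow_ne_top massConst_lt_top.ne))]
        ring

/-! ### Limit of the rescaled density and its integral. -/

/-- The integrand of the mass of remaining pairs, in rescaled coordinates and normalised. -/
noncomputable def ratio (m : ℝ) (p : ℝ × ℝ × ℝ) : ℝ :=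
  phi (-m - (m ^ 3)⁻¹ * p.1) / phi m *
    (kernel m ((m ^ 3)⁻¹ * p.1) ((m ^ 3)⁻¹ * p.2.1) p.2.2 / (phi m * tailFactor m))

/-- The reference measure for the rescaled coordinates. -/
noncomputable def scaleMeasure : Measure (ℝ × ℝ × ℝ) :=
  (volume.restrict (Set.Ioi 0)).prod ((volume.restrict (Set.Ioi 0)).prod volume)

lemma lintegral_scaleMeasure {f : ℝ × ℝ × ℝ → ℝ≥0∞} (hf : Measurable f) :
    ∫⁻ p, f p ∂scaleMeasure =
      ∫⁻ s in Set.Ioi (0 : ℝ), ∫⁻ t in Set.Ioi (0 : ℝ), ∫⁻ b, f (s, t, b) := by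
  rw [scaleMeasure, lintegral_prod _ hf.aemeasurable]
  refine lintegral_congr fun s => ?_
  exact lintegral_prod _ (hf.comp measurable_prodMk_left).aemeasurable

lemma measurable_ratio (m : ℝ) : Measurable (ratio m) := by
  unfold ratio
  refine ((continuous_phi.measurable.comp (by fun_prop)).div_const _).mul
    (Measurable.div_const ?_ _)
  exact (measurable_kernel m).comp
    (by fun_prop : Measurable fun p : ℝ × ℝ × ℝ => ((m ^ 3)⁻¹ * p.1, (m ^ 3)⁻¹ * p.2.1, p.2.2))

lemma setLIntegral_pairMass_eq {m : ℝ} (hm : 0 < m) :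
    ∫⁻ v in Set.Iio (-m), pairMass v (-m) ∂(gaussianReal 0 1) =
      ENNReal.ofReal (phi m ^ 2 * tailFactor m / m ^ 6) *
        ∫⁻ p, ENNReal.ofReal (ratio m p) ∂scaleMeasure := by
  have ht := tailFactor_pos hm
  have hφ := phi_pos m
  have hmeas : Measurable fun p => ENNReal.ofReal (ratio m p) :=
    ENNReal.measurable_ofReal.comp (measurable_ratio m)
  rw [setLIntegral_Iio_neg_eq hm, lintegral_scaleMeasure hmeas,
    ← lintegral_const_mul' _ _ ENNReal.ofReal_ne_top]
  refine lintegral_congr fun s => ?_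
  rw [pairMass_eq (inv_pos.2 (pow_pos hm 3)), ← lintegral_const_mul' _ _ ENNReal.ofReal_ne_top,
    ← lintegral_const_mul' _ _ ENNReal.ofReal_ne_top,
    ← lintegral_const_mul' _ _ ENNReal.ofReal_ne_top]
  refine lintegral_congr fun t => ?_
  rw [← mul_assoc, ← mul_assoc, ← lintegral_const_mul' _ _ (ENNReal.mul_ne_top (ENNReal.mul_ne_top
    ENNReal.ofReal_ne_top ENNReal.ofReal_ne_top) ENNReal.ofReal_ne_top),
    ← lintegral_const_mul' _ _ ENNReal.ofReal_ne_top]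
  refine lintegral_congr fun b => ?_
  have hp := phi_pos (-m - (m ^ 3)⁻¹ * s)
  have hk := kernel_nonneg m ((m ^ 3)⁻¹ * s) ((m ^ 3)⁻¹ * t) b
  rw [← ENNReal.ofReal_mul (by positivity), ← ENNReal.ofReal_mul (by positivity),
    ← ENNReal.ofReal_mul (by positivity), ← ENNReal.ofReal_mul (by positivity)]
  congr 1
  simp only [ratio]
  field_simp

/-- The limit of `ratio`. -/
noncomputable def ratioLimit (p : ℝ × ℝ × ℝ) : ℝ := phi p.2.2 * exp (-(2 * √(p.1 + p.2.1)))

/-- At scale `m^(-3)` the shift `m ζ = s / m^2` vanishes, while `m` times the square root is `√((s +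
t) (1 + b / m + s / m^4))`. -/
lemma tendsto_depth (s t b : ℝ) :
    Tendsto (fun m : ℝ => m * (depth m ((m ^ 3)⁻¹ * s) ((m ^ 3)⁻¹ * t) b - m)) atTop
      (𝓝 (√(s + t))) := by
  have hinv : Tendsto (fun m : ℝ => m⁻¹) atTop (𝓝 0) := tendsto_inv_atTop_zero
  have h1 : Tendsto (fun m : ℝ => s * m⁻¹ ^ 2) atTop (𝓝 0) := by
    simpa using (hinv.pow 2).const_mul s
  have h2 : Tendsto (fun m : ℝ => √((s + t) * (b * m⁻¹ + 1 + s * m⁻¹ ^ 4))) atTop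
      (𝓝 √((s + t) * (b * 0 + 1 + s * 0 ^ 4))) :=
    ((((hinv.const_mul b).add_const 1).add ((hinv.pow 4).const_mul s)).const_mul (s + t)).sqrt
  have h3 := h1.add h2
  simp only [mul_zero, zero_add, ne_eq, OfNat.ofNat_ne_zero, not_false_eq_true, zero_pow,
    add_zero, mul_one] at h3
  refine h3.congr' ?_
  filter_upwards [eventually_gt_atTop 0] with m hm
  have e : (s + t) * (b * m⁻¹ + 1 + s * m⁻¹ ^ 4) =
      m ^ 2 * (((m ^ 3)⁻¹ * t + (m ^ 3)⁻¹ * s) * (b + m + (m ^ 3)⁻¹ * s)) := by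
    field_simp
    ring
  rw [e, Real.sqrt_mul (by positivity), Real.sqrt_sq hm.le, depth]
  field_simp
  ring

/-- Writing `y` for the depth, `y^2 - m^2 = 2 m (y - m) + (y - m)^2` tends to `2 √(s + t)`. The two
density ratios, the factor `m / y` and the Mills ratio all tend to `1`. -/
lemma tendsto_ratio {s t : ℝ} (hs : 0 < s) (ht : 0 < t) (b : ℝ) :
    Tendsto (fun m => ratio m (s, t, b)) atTop (𝓝 (ratioLimit (s, t, b))) := by
  have hinv : Tendsto (fun m : ℝ => m⁻¹) atTop (𝓝 0) := tendsto_inv_atTop_zero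
  set y : ℝ → ℝ := fun m => depth m ((m ^ 3)⁻¹ * s) ((m ^ 3)⁻¹ * t) b
  have hd : Tendsto (fun m => m * (y m - m)) atTop (𝓝 (√(s + t))) := tendsto_depth s t b
  have hd0 : Tendsto (fun m => y m - m) atTop (𝓝 0) := by
    have := hd.mul hinv
    rw [mul_zero] at this
    refine this.congr' ?_
    filter_upwards [eventually_gt_atTop 0] with m hm
    field_simp
  have hy : ∀ m, 0 < m → m ≤ y m := fun m hm => le_depth (by positivity) _ _
  have hyinf : Tendsto y atTop atTop := by
    refine tendsto_atTop_mono' _ ?_ tendsto_id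
    filter_upwards [eventually_gt_atTop 0] with m hm using hy m hm
  have l1 : Tendsto (fun m : ℝ => exp (m * (-((m ^ 3)⁻¹ * s)) - (-((m ^ 3)⁻¹ * s)) ^ 2 / 2)) atTop
      (𝓝 1) := by
    have : Tendsto (fun m : ℝ => -s * m⁻¹ ^ 2 - s ^ 2 * m⁻¹ ^ 6 / 2) atTop
        (𝓝 (-s * 0 ^ 2 - s ^ 2 * 0 ^ 6 / 2)) :=
      ((hinv.pow 2).const_mul _).sub (((hinv.pow 6).const_mul _).div_const 2)
    have h2 := (Real.continuous_exp.tendsto _).comp this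
    simp only [ne_eq, OfNat.ofNat_ne_zero, not_false_eq_true, zero_pow, mul_zero, zero_div,
      sub_zero, Real.exp_zero] at h2
    refine h2.congr' ?_
    filter_upwards [eventually_gt_atTop 0] with m hm
    simp only [Function.comp]
    congr 1
    field_simp
  have l2 : Tendsto (fun m : ℝ => exp (m * ((m ^ 3)⁻¹ * t) - ((m ^ 3)⁻¹ * t) ^ 2 / 2)) atTop
      (𝓝 1) := by
    have : Tendsto (fun m : ℝ => t * m⁻¹ ^ 2 - t ^ 2 * m⁻¹ ^ 6 / 2) atTop
        (𝓝 (t * 0 ^ 2 - t ^ 2 * 0 ^ 6 / 2)) :=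
      ((hinv.pow 2).const_mul _).sub (((hinv.pow 6).const_mul _).div_const 2)
    have h2 := (Real.continuous_exp.tendsto _).comp this
    simp only [ne_eq, OfNat.ofNat_ne_zero, not_false_eq_true, zero_pow, mul_zero, zero_div,
      sub_zero, Real.exp_zero] at h2
    refine h2.congr' ?_
    filter_upwards [eventually_gt_atTop 0] with m hm
    simp only [Function.comp]
    congr 1
    field_simp
  have l3 : Tendsto (fun m : ℝ => exp (-(2 * (m * (y m - m)) + (y m - m) ^ 2))) atTop
      (𝓝 (exp (-(2 * √(s + t))))) := by
    have := (((hd.const_mul 2).add (hd0.pow 2)).neg)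
    rw [zero_pow two_ne_zero, add_zero] at this
    exact (Real.continuous_exp.tendsto _).comp this
  have l4 : Tendsto (fun m : ℝ => m / y m) atTop (𝓝 1) := by
    have h1 : Tendsto (fun m : ℝ => (1 + (y m - m) * m⁻¹)⁻¹) atTop (𝓝 (1 + 0 * 0)⁻¹) :=
      ((hd0.mul hinv).const_add 1).inv₀ (by norm_num)
    simp only [mul_zero, add_zero, inv_one] at h1
    refine h1.congr' ?_
    filter_upwards [eventually_gt_atTop 0] with m hm
    have := hm.trans_le (hy m hm)
    have e : 1 + (y m - m) * m⁻¹ = y m / m := by field_simp; ring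
    rw [e, inv_div]
  have l5 : Tendsto (fun m : ℝ => mills (√2 * y m)) atTop (𝓝 1) :=
    tendsto_mills.comp (hyinf.const_mul_atTop (Real.sqrt_pos.2 two_pos))
  have l6 := (l1.mul l2).mul ((l3.mul l4).mul (l5.mul_const (phi b)))
  rw [ratioLimit]
  have e : (1 : ℝ) * 1 * (exp (-(2 * √(s + t))) * 1 * (1 * phi b)) =
      phi b * exp (-(2 * √(s + t))) := by ring
  rw [e] at l6
  refine l6.congr' ?_
  have hlt : ∀ᶠ m : ℝ in atTop, -m + (m ^ 3)⁻¹ * t < b := by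
    have h1 : Tendsto (fun m : ℝ => t * m⁻¹ ^ 3) atTop (𝓝 0) := by
      simpa using (hinv.pow 3).const_mul t
    filter_upwards [h1.eventually (gt_mem_nhds zero_lt_one), eventually_gt_atTop (1 - b)]
      with m h1 h2
    rw [inv_pow] at h1
    linarith
  filter_upwards [eventually_gt_atTop 0, hlt] with m hm hb
  have hφ := phi_pos m
  have hym := hm.trans_le (hy m hm)
  have hpi : 0 < √Real.pi := Real.sqrt_pos.2 Real.pi_pos
  simp only [ratio, kernel, if_pos hb, sub_eq_add_neg (-m)]
  rw [phi_sub_add m (-((m ^ 3)⁻¹ * s)), phi_sub_add m ((m ^ 3)⁻¹ * t), ← sub_eq_add_neg (-m),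
    pairFn_eq_depth, Phi_sqrt_two_mul_neg hym]
  have e2 : tailFactor (y m) =
      tailFactor m * (exp (-(2 * (m * (y m - m)) + (y m - m) ^ 2)) * (m / y m)) := by
    rw [tailFactor, tailFactor, show -(y m) ^ 2 =
      -m ^ 2 + -(2 * (m * (y m - m)) + (y m - m) ^ 2) by ring, Real.exp_add]
    field_simp
  change _ = _ * (_ * (tailFactor (y m) * mills (√2 * y m)) / _)
  rw [e2]
  have htf := tailFactor_pos hm
  field_simp

lemma ratio_le {m s t : ℝ} (hm : 0 < m) (hs : 0 < s) (ht : 0 < t) (b : ℝ) :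
    ratio m (s, t, b) ≤ decay s * (decay t * exp (-(b ^ 2 / 4))) := by
  have htf := tailFactor_pos hm
  have hφ := phi_pos m
  have hpi : 1 ≤ √(2 * Real.pi) := by
    rw [Real.one_le_sqrt]; linarith [Real.pi_gt_three]
  have hk := kernel_le hm (ζ := (m ^ 3)⁻¹ * s) (η := (m ^ 3)⁻¹ * t) (by positivity)
    (by positivity) b
  rw [pow_three_mul_inv hm, pow_three_mul_inv hm] at hk
  have hds := decay_pos s
  have hdt := decay_pos t
  have h1 : phi (-m - (m ^ 3)⁻¹ * s) / phi m ≤ 1 :=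
    (div_le_one hφ).2 (phi_sub_le hm (by positivity))
  have h2 : kernel m ((m ^ 3)⁻¹ * s) ((m ^ 3)⁻¹ * t) b / (phi m * tailFactor m) ≤
      decay s * (decay t * exp (-(b ^ 2 / 4))) := by
    rw [div_le_iff₀ (by positivity)]
    refine hk.trans ?_
    rw [mul_comm (decay s * _)]
    gcongr
    exact div_le_self (by positivity) hpi
  have h3 := div_nonneg (kernel_nonneg m ((m ^ 3)⁻¹ * s) ((m ^ 3)⁻¹ * t) b)
    (mul_pos hφ htf).le
  exact (mul_le_of_le_one_left h3 h1).trans h2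

lemma tendsto_lintegral_ratio :
    Tendsto (fun m => ∫⁻ p, ENNReal.ofReal (ratio m p) ∂scaleMeasure) atTop
      (𝓝 (∫⁻ p, ENNReal.ofReal (ratioLimit p) ∂scaleMeasure)) := by
  have hae : ∀ᵐ p ∂scaleMeasure, 0 < p.1 ∧ 0 < p.2.1 := by
    have h0 : ∀ᵐ s ∂((volume : Measure ℝ).restrict (Set.Ioi 0)), 0 < s :=
      ae_restrict_mem measurableSet_Ioi
    have h1 : ∀ᵐ p ∂scaleMeasure, 0 < p.1 :=
      Measure.quasiMeasurePreserving_fst.ae h0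
    have h2 : ∀ᵐ p ∂scaleMeasure, 0 < p.2.1 :=
      Measure.quasiMeasurePreserving_snd.ae (Measure.quasiMeasurePreserving_fst.ae h0)
    exact h1.and h2
  refine tendsto_lintegral_filter_of_dominated_convergence
    (fun p => ENNReal.ofReal (decay p.1 * (decay p.2.1 * exp (-(p.2.2 ^ 2 / 4))))) ?_ ?_ ?_ ?_
  · exact Eventually.of_forall fun m => ENNReal.measurable_ofReal.comp (measurable_ratio m)
  · filter_upwards [eventually_gt_atTop 0] with m hm
    filter_upwards [hae] with p hp
    exact ENNReal.ofReal_le_ofReal (ratio_le hm hp.1 hp.2 _)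
  · rw [lintegral_scaleMeasure (by fun_prop)]
    have h : ∀ s t b : ℝ, ENNReal.ofReal (decay s * (decay t * exp (-(b ^ 2 / 4)))) =
        ENNReal.ofReal (decay s) * (ENNReal.ofReal (decay t) *
          ENNReal.ofReal (exp (-(b ^ 2 / 4)))) := by
      intro s t b
      rw [ENNReal.ofReal_mul (decay_pos s).le, ENNReal.ofReal_mul (decay_pos t).le]
    simp only [h]
    simp_rw [lintegral_const_mul' _ _ ENNReal.ofReal_ne_top]
    rw [lintegral_mul_const' _ _ (lintegral_mul_const' _ _ lintegral_exp_neg_sq_lt_top.ne ▸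
        (ENNReal.mul_ne_top lintegral_decay_lt_top.ne lintegral_exp_neg_sq_lt_top.ne)),
      lintegral_mul_const' _ _ lintegral_exp_neg_sq_lt_top.ne]
    exact ENNReal.mul_ne_top lintegral_decay_lt_top.ne
      (ENNReal.mul_ne_top lintegral_decay_lt_top.ne lintegral_exp_neg_sq_lt_top.ne)
  · filter_upwards [hae] with p hp
    exact (ENNReal.continuous_ofReal.tendsto _).comp (tendsto_ratio hp.1 hp.2 _)

/-- An antiderivative is `-(r + 1/2) exp (-2 r)` with `r = √(s + t)`. -/
lemma lintegral_exp_neg_two_sqrt {t : ℝ} (ht : 0 < t) :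
    ∫⁻ s in Set.Ioi (0 : ℝ), ENNReal.ofReal (exp (-(2 * √(s + t)))) =
      ENNReal.ofReal ((√t + 1 / 2) * exp (-(2 * √t))) := by
  have hderiv : ∀ s ∈ Set.Ici (0 : ℝ), HasDerivAt
      (fun s => -((√(s + t) + 1 / 2) * exp (-(2 * √(s + t))))) (exp (-(2 * √(s + t)))) s := by
    intro s (hs : 0 ≤ s)
    have hpos : 0 < s + t := by linarith
    have h1 : HasDerivAt (fun s => √(s + t)) (1 / (2 * √(s + t))) s :=
      ((hasDerivAt_id s).add_const t).sqrt hpos.ne'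
    have h2 := ((h1.add_const (1 / 2)).mul ((h1.const_mul 2).neg.exp)).neg
    refine h2.congr_deriv ?_
    have := Real.sqrt_pos.2 hpos
    simp only [Pi.neg_apply]
    field_simp
    ring
  have hlim : Tendsto (fun s => -((√(s + t) + 1 / 2) * exp (-(2 * √(s + t))))) atTop (𝓝 0) := by
    have h1 : Tendsto (fun s => √(s + t)) atTop atTop :=
      Real.tendsto_sqrt_atTop.comp (tendsto_atTop_add_const_right _ t tendsto_id)
    have h2 : Tendsto (fun x : ℝ => x ^ 1 * exp (-x)) atTop (𝓝 0) :=
      Real.tendsto_pow_mul_exp_neg_atTop_nhds_zero 1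
    have h3 : Tendsto (fun x : ℝ => x ^ 0 * exp (-x)) atTop (𝓝 0) :=
      Real.tendsto_pow_mul_exp_neg_atTop_nhds_zero 0
    have h4 := (((h2.add h3).comp (h1.const_mul_atTop two_pos)).const_mul (-(1 / 2)))
    simp only [add_zero, mul_zero] at h4
    refine h4.congr fun s => ?_
    simp only [Function.comp]
    ring
  have hnn : ∀ s ∈ Set.Ioi (0 : ℝ), 0 ≤ exp (-(2 * √(s + t))) := fun s _ => (Real.exp_pos _).le
  have hInt := integrableOn_Ioi_deriv_of_nonneg' hderiv hnn hlim
  rw [← ofReal_integral_eq_lintegral_ofReal hInt (ae_of_all _ fun s => (Real.exp_pos _).le),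
    integral_Ioi_of_hasDerivAt_of_nonneg' hderiv hnn hlim]
  congr 1
  simp

/-- The normal density in `b` integrates to `1` and one excess is integrated explicitly; Gamma
integrals then give `1/2 + 1/4`. -/
lemma lintegral_ratioLimit : ∫⁻ p, ENNReal.ofReal (ratioLimit p) ∂scaleMeasure =
    ENNReal.ofReal (3 / 4) := by
  have hm : Measurable fun p => ENNReal.ofReal (ratioLimit p) := by
    unfold ratioLimit
    have := continuous_phi
    fun_prop
  have h1 : ∫⁻ p, ENNReal.ofReal (ratioLimit p) ∂scaleMeasure =
      ∫⁻ s in Set.Ioi (0 : ℝ), ENNReal.ofReal ((√s + 1 / 2) * exp (-(2 * √s))) := by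
    rw [lintegral_scaleMeasure hm]
    refine setLIntegral_congr_fun measurableSet_Ioi fun s (hs : 0 < s) => ?_
    rw [← lintegral_exp_neg_two_sqrt hs]
    refine lintegral_congr fun t => ?_
    simp only [ratioLimit, ENNReal.ofReal_mul (phi_pos _).le]
    rw [lintegral_mul_const' _ _ ENNReal.ofReal_ne_top, ← ofReal_integral_eq_lintegral_ofReal
      integrable_phi (ae_of_all _ fun x => (phi_pos x).le)]
    have : ∫ x, phi x = 1 := by
      rw [← integral_gaussianPDFReal_eq_one 0 one_ne_zero]
      simp only [gaussianPDFReal_eq_phi]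
    rw [this, ENNReal.ofReal_one, one_mul, add_comm]
  have hi0 := integrableOn_rpow_mul_exp_neg_mul_rpow (p := 1 / 2) (s := 0) (b := 2)
    (by norm_num) (by norm_num) two_pos
  have hi1 := integrableOn_rpow_mul_exp_neg_mul_rpow (p := 1 / 2) (s := 1 / 2) (b := 2)
    (by norm_num) (by norm_num) two_pos
  have hv0 := integral_rpow_mul_exp_neg_mul_rpow (p := 1 / 2) (q := 0) (b := 2)
    (by norm_num) (by norm_num) two_pos
  have hv1 := integral_rpow_mul_exp_neg_mul_rpow (p := 1 / 2) (q := 1 / 2) (b := 2)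
    (by norm_num) (by norm_num) two_pos
  have hfun : ∀ s : ℝ, (√s + 1 / 2) * exp (-(2 * √s)) =
      s ^ (1 / 2 : ℝ) * exp (-2 * s ^ (1 / 2 : ℝ)) +
        1 / 2 * (s ^ (0 : ℝ) * exp (-2 * s ^ (1 / 2 : ℝ))) := by
    intro s
    rw [Real.sqrt_eq_rpow, Real.rpow_zero]
    rw [neg_mul]
    ring
  rw [h1]
  simp only [hfun]
  rw [← ofReal_integral_eq_lintegral_ofReal (f := fun s : ℝ =>
    s ^ (1 / 2 : ℝ) * exp (-2 * s ^ (1 / 2 : ℝ)) +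
      1 / 2 * (s ^ (0 : ℝ) * exp (-2 * s ^ (1 / 2 : ℝ)))) (hi1.add (hi0.const_mul (1 / 2)))]
  · congr 1
    rw [integral_add hi1 (hi0.const_mul _), integral_const_mul, hv0, hv1]
    have g2 : Real.Gamma 2 = 1 := by
      have := Real.Gamma_nat_eq_factorial 1
      norm_num at this ⊢
    have g3 : Real.Gamma 3 = 2 := by
      have := Real.Gamma_nat_eq_factorial 2
      norm_num at this ⊢
    have e1 : ((0 : ℝ) + 1) / (1 / 2) = 2 := by norm_num
    have e2 : ((1 / 2 : ℝ) + 1) / (1 / 2) = 3 := by norm_num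
    have e3 : -((1 / 2 : ℝ) + 1) / (1 / 2) = ((-3 : ℤ) : ℝ) := by norm_num
    have e4 : -((0 : ℝ) + 1) / (1 / 2) = ((-2 : ℤ) : ℝ) := by norm_num
    rw [e1, e2, e3, e4, g2, g3, Real.rpow_intCast, Real.rpow_intCast]
    norm_num
  · rw [EventuallyLE, ae_restrict_iff' measurableSet_Ioi]
    refine ae_of_all _ fun s (hs : 0 < s) => ?_
    have := (Real.exp_pos (-2 * s ^ (1 / 2 : ℝ))).le
    simp only [Pi.zero_apply]
    positivity

/-! ### From the level `m` to the uniform variable `u = Phi (-m)`. -/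

lemma log_inv_Phi_neg {m : ℝ} (hm : 0 < m) :
    log (Phi (-m))⁻¹ = m ^ 2 / 2 + log √(2 * Real.pi) + log m - log (mills m) := by
  have hφ := phi_pos m
  rw [Real.log_inv, Phi_neg_eq hm.ne', Real.log_mul (div_pos hφ hm).ne' (mills_pos hm).ne',
    Real.log_div hφ.ne' hm.ne', phi, Real.log_div (Real.exp_pos _).ne' sqrt_two_pi_pos.ne',
    Real.log_exp]
  ring

lemma Phi_mem_Ioo (x : ℝ) : Phi x ∈ Set.Ioo (0 : ℝ) 1 := ⟨Phi_pos x, Phi_lt_one x⟩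

lemma tendsto_log_inv_Phi_div :
    Tendsto (fun m : ℝ => (1 + log (Phi (-m))⁻¹) / m ^ 2) atTop (𝓝 (1 / 2)) := by
  have hinv : Tendsto (fun m : ℝ => (m ^ 2)⁻¹) atTop (𝓝 0) :=
    tendsto_inv_atTop_zero.comp (tendsto_pow_atTop two_ne_zero)
  have h1 : Tendsto (fun m : ℝ => log m / m ^ 2) atTop (𝓝 0) := by
    have := (Real.isLittleO_log_id_atTop.tendsto_div_nhds_zero).mul tendsto_inv_atTop_zero
    rw [mul_zero] at this
    refine this.congr fun m => ?_
    simp only [id]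
    field_simp
  have h2 : Tendsto (fun m : ℝ => log (mills m)) atTop (𝓝 0) := by
    simpa using tendsto_mills.log one_ne_zero
  have h3 := ((hinv.const_mul (1 + log √(2 * Real.pi))).add h1).sub (h2.mul hinv)
  have h4 := h3.const_add (1 / 2)
  simp only [mul_zero, add_zero, sub_zero] at h4
  refine h4.congr' ?_
  filter_upwards [eventually_gt_atTop 0] with m hm
  rw [log_inv_Phi_neg hm]
  field_simp
  ring

lemma exists_log_inv_Phi_le : ∃ B : ℝ, 0 < B ∧ ∀ m : ℝ, 1 ≤ m →
    1 + log (Phi (-m))⁻¹ ≤ B * m ^ 2 := by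
  refine ⟨3 + |log √(2 * Real.pi)| + |log (mills 1)|, by positivity, fun m hm => ?_⟩
  have hm0 : 0 < m := by linarith
  rw [log_inv_Phi_neg hm0]
  have h1 : log (mills 1) ≤ log (mills m) :=
    Real.log_le_log (mills_pos one_pos) (mills_mono one_pos hm)
  have h2 := Real.log_le_sub_one_of_pos hm0
  have h3 := le_abs_self (log √(2 * Real.pi))
  have h4 := neg_abs_le (log (mills 1))
  have h5 : 1 ≤ m ^ 2 := one_le_pow₀ hm
  have h6 := mul_le_mul_of_nonneg_left h5 (abs_nonneg (log √(2 * Real.pi)))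
  have h7 := mul_le_mul_of_nonneg_left h5 (abs_nonneg (log (mills 1)))
  nlinarith

lemma phi_div_eq {m : ℝ} (hm : 0 < m) : phi m / m = Phi (-m) / mills m := by
  rw [Phi_neg_eq hm.ne', mul_div_cancel_right₀ _ (mills_pos hm).ne']

lemma exists_le_profile_of_one_le (k : ℕ) {p : ℝ} (hp : 0 ≤ p) : ∃ A : ℝ, 0 < A ∧ ∀ m : ℝ, 1 ≤ m →
    (phi m / m) ^ k * (m ^ 2) ^ (-p) ≤ A * profile k p (Phi (-m)) := by
  obtain ⟨B, hB, h⟩ := exists_log_inv_Phi_le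
  have hr := mills_pos one_pos
  refine ⟨B ^ p / mills 1 ^ k, by positivity, fun m hm => ?_⟩
  have hm0 : 0 < m := by linarith
  have hu := Phi_mem_Ioo (-m)
  have h1 := one_le_one_add_log_inv hu
  have h2 : (m ^ 2) ^ (-p) ≤ B ^ p * (1 + log (Phi (-m))⁻¹) ^ (-p) := by
    have h3 : (1 + log (Phi (-m))⁻¹) / B ≤ m ^ 2 := by
      rw [div_le_iff₀ hB]; linarith [h m hm]
    have h4 := Real.rpow_le_rpow_of_nonpos (by positivity) h3 (neg_nonpos.2 hp)
    refine h4.trans_eq ?_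
    rw [Real.div_rpow (by linarith) hB.le, Real.rpow_neg hB.le, div_inv_eq_mul, mul_comm]
  have h5 : (phi m / m) ^ k ≤ Phi (-m) ^ k / mills 1 ^ k := by
    rw [phi_div_eq hm0, div_pow]
    exact div_le_div_of_nonneg_left (pow_nonneg hu.1.le k) (pow_pos hr k)
      (pow_le_pow_left₀ hr.le (mills_mono one_pos hm) k)
  calc _ ≤ Phi (-m) ^ k / mills 1 ^ k * (B ^ p * (1 + log (Phi (-m))⁻¹) ^ (-p)) :=
        mul_le_mul h5 h2 (by positivity) (div_nonneg (pow_nonneg hu.1.le k) (pow_pos hr k).le)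
    _ = _ := by rw [profile]; ring

lemma exists_one_le_profile (k : ℕ) {p : ℝ} (hp : 0 ≤ p) : ∃ A : ℝ, 0 < A ∧ ∀ x : ℝ, -1 ≤ x →
    1 ≤ A * profile k p (Phi x) := by
  have h0 := Phi_mem_Ioo (-1)
  have hpos := profile_pos (k := k) (p := p) h0
  refine ⟨(profile k p (Phi (-1)))⁻¹, inv_pos.2 hpos, fun x hx => ?_⟩
  rw [← div_eq_inv_mul, one_le_div hpos]
  have hle := Phi_mono hx
  have hu := Phi_mem_Ioo x
  have h1 := one_le_one_add_log_inv hu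
  refine mul_le_mul (pow_le_pow_left₀ h0.1.le hle k) ?_ ?_ (pow_nonneg hu.1.le k)
  · refine Real.rpow_le_rpow_of_nonpos (by linarith) ?_ (neg_nonpos.2 hp)
    have := Real.log_le_log (inv_pos.2 hu.1) (inv_anti₀ h0.1 hle)
    linarith
  · exact (Real.rpow_pos_of_pos (by linarith [one_le_one_add_log_inv h0]) _).le

/-- Below `-1` the tail hypothesis applies. Above `-1` the trivial bound `1` is enough, because the
profile stays bounded away from zero there. -/
lemma exists_le_profile (k : ℕ) {p : ℝ} (hp : 0 ≤ p) {f : ℝ → ℝ≥0∞} {K : ℝ≥0∞} (hK : K ≠ ∞)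
    (h1 : ∀ x, f x ≤ 1)
    (h : ∀ m, 1 ≤ m → f (-m) ≤ ENNReal.ofReal ((phi m / m) ^ k * (m ^ 2) ^ (-p)) * K) :
    ∃ A : ℝ, 0 ≤ A ∧ ∀ x, f x ≤ ENNReal.ofReal (A * profile k p (Phi x)) := by
  obtain ⟨A, hA, hA'⟩ := exists_le_profile_of_one_le k hp
  obtain ⟨A₂, hA₂, hA₂'⟩ := exists_one_le_profile k hp
  refine ⟨A * K.toReal + A₂, by positivity, fun x => ?_⟩
  have hpos := profile_pos (k := k) (p := p) (Phi_mem_Ioo x)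
  rcases le_total (-1) x with hx | hx
  · refine (h1 x).trans ?_
    rw [← ENNReal.ofReal_one]
    refine ENNReal.ofReal_le_ofReal ((hA₂' x hx).trans ?_)
    gcongr
    linarith [mul_nonneg hA.le K.toReal_nonneg]
  · have h2 := h (-x) (by linarith)
    have h3 := hA' (-x) (by linarith)
    rw [neg_neg] at h2 h3
    calc f x ≤ ENNReal.ofReal (A * profile k p (Phi x)) * K := h2.trans (by gcongr)
      _ = ENNReal.ofReal (A * profile k p (Phi x)) * ENNReal.ofReal K.toReal := by
          rw [ENNReal.ofReal_toReal hK]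
      _ = ENNReal.ofReal (A * K.toReal * profile k p (Phi x)) := by
          rw [← ENNReal.ofReal_mul (by positivity)]; congr 1; ring
      _ ≤ _ := by
          gcongr
          linarith

lemma pairMass_le_one (v x : ℝ) : pairMass v x ≤ 1 := by
  calc pairMass v x ≤ ∫⁻ _, ∫⁻ _, 1 ∂(gaussianReal 0 1) ∂(gaussianReal 0 1) := by
        refine lintegral_mono fun a => lintegral_mono fun b => ?_
        dsimp only
        split_ifs
        · rw [← ENNReal.ofReal_one]; exact ENNReal.ofReal_le_ofReal (pairFn_le_one _ _ _)
        · exact zero_le_one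
    _ = 1 := by simp

/-- The mass of the configurations `v < x < a < b`. -/
noncomputable def tripleMass (x : ℝ) : ℝ≥0∞ :=
  ∫⁻ v in Set.Iio x, pairMass v x ∂(gaussianReal 0 1)

/-- `tripleMass` with the additional weight `Phi (√2 * v)`. -/
noncomputable def weightedMass (x : ℝ) : ℝ≥0∞ :=
  ∫⁻ v in Set.Iio x, ENNReal.ofReal (Phi (√2 * v)) * pairMass v x ∂(gaussianReal 0 1)

/-- The mass of two independent pairs above `x`. -/
noncomputable def doubleMass (x : ℝ) : ℝ≥0∞ :=
  ∫⁻ v in Set.Iio x, pairMass v x ^ 2 ∂(gaussianReal 0 1)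

lemma setLIntegral_le_one {f : ℝ → ℝ≥0∞} (s : Set ℝ) (hf : ∀ v, f v ≤ 1) :
    ∫⁻ v in s, f v ∂(gaussianReal 0 1) ≤ 1 := by
  calc ∫⁻ v in s, f v ∂(gaussianReal 0 1) ≤ ∫⁻ _, 1 ∂(gaussianReal 0 1) :=
        (setLIntegral_le_lintegral _ _).trans (lintegral_mono hf)
    _ = 1 := by simp

lemma tripleMass_le_one (x : ℝ) : tripleMass x ≤ 1 :=
  setLIntegral_le_one _ fun _ => pairMass_le_one _ _

lemma weightedMass_le_one (x : ℝ) : weightedMass x ≤ 1 :=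
  setLIntegral_le_one _ fun v => by
    refine mul_le_one' ?_ (pairMass_le_one _ _)
    rw [← ENNReal.ofReal_one]; exact ENNReal.ofReal_le_ofReal (Phi_le_one _)

lemma doubleMass_le_one (x : ℝ) : doubleMass x ≤ 1 :=
  setLIntegral_le_one _ fun _ => pow_le_one₀ zero_le (pairMass_le_one _ _)

lemma measurable_tripleMass : Measurable tripleMass := by
  have h1 : tripleMass = fun x => ∫⁻ v, {p : ℝ × ℝ | p.2 < p.1}.indicator
      (fun p => pairMass p.2 p.1) (x, v) ∂(gaussianReal 0 1) := by
    ext x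
    rw [tripleMass, ← lintegral_indicator measurableSet_Iio]
    refine lintegral_congr fun v => ?_
    by_cases h : v < x <;> simp [Set.indicator, h]
  rw [h1]
  refine Measurable.lintegral_prod_right' ?_
  exact (measurable_pairMass.comp measurable_swap).indicator
    (measurableSet_lt measurable_snd measurable_fst)

lemma rpow_neg_one_sq {m : ℝ} : (m ^ 2) ^ (-1 : ℝ) = (m ^ 2)⁻¹ := Real.rpow_neg_one _

lemma rpow_sq_neg {m : ℝ} (hm : 0 < m) : (m ^ 2) ^ (-(3 / 2) : ℝ) = (m ^ 3)⁻¹ := by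
  rw [← Real.rpow_natCast, ← Real.rpow_mul hm.le, ← Real.rpow_natCast, ← Real.rpow_neg hm.le]
  norm_num

lemma tripleScale_eq {m : ℝ} (hm : 0 < m) : phi m ^ 2 * tailFactor m / m ^ 6 =
    √Real.pi * ((phi m / m) ^ 4 * (m ^ 2) ^ (-(3 / 2) : ℝ)) := by
  rw [tailFactor_eq hm, rpow_sq_neg hm]
  field_simp

lemma exists_tripleMass_le : ∃ A : ℝ, 0 ≤ A ∧
    ∀ x, tripleMass x ≤ ENNReal.ofReal (A * profile 4 (3 / 2) (Phi x)) := by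
  refine exists_le_profile 4 (by norm_num) (K := ENNReal.ofReal √Real.pi *
    (massConst * ∫⁻ t in Set.Ioi (0 : ℝ), ENNReal.ofReal (decay t)))
    (ENNReal.mul_ne_top ENNReal.ofReal_ne_top
      (ENNReal.mul_ne_top massConst_lt_top.ne lintegral_decay_lt_top.ne))
    tripleMass_le_one fun m hm => ?_
  have hm0 : 0 < m := by linarith
  refine (setLIntegral_pairMass_le hm0).trans_eq ?_
  rw [tripleScale_eq hm0, ENNReal.ofReal_mul (Real.sqrt_nonneg _)]
  ring

lemma exists_weightedMass_le : ∃ A : ℝ, 0 ≤ A ∧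
    ∀ x, weightedMass x ≤ ENNReal.ofReal (A * profile 6 1 (Phi x)) := by
  refine exists_le_profile 6 zero_le_one (K := ENNReal.ofReal Real.pi *
    (massConst * ∫⁻ t in Set.Ioi (0 : ℝ), ENNReal.ofReal (decay t)))
    (ENNReal.mul_ne_top ENNReal.ofReal_ne_top
      (ENNReal.mul_ne_top massConst_lt_top.ne lintegral_decay_lt_top.ne))
    weightedMass_le_one fun m hm => ?_
  have hm0 : 0 < m := by linarith
  refine (setLIntegral_Phi_mul_pairMass_le hm0).trans_eq ?_
  have e : phi m ^ 2 * tailFactor m ^ 2 / m ^ 6 =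
      Real.pi * ((phi m / m) ^ 6 * (m ^ 2) ^ (-1 : ℝ)) := by
    have h3 : √Real.pi ^ 2 = Real.pi := Real.sq_sqrt Real.pi_pos.le
    rw [tailFactor_eq hm0, rpow_neg_one_sq, div_pow, mul_pow, h3]
    field_simp
  rw [e, ENNReal.ofReal_mul Real.pi_pos.le]
  ring

lemma exists_doubleMass_le : ∃ A : ℝ, 0 ≤ A ∧
    ∀ x, doubleMass x ≤ ENNReal.ofReal (A * profile 7 1 (Phi x)) := by
  refine exists_le_profile 7 zero_le_one (K := ENNReal.ofReal Real.pi *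
    (massConst ^ 2 * ∫⁻ t in Set.Ioi (0 : ℝ), ENNReal.ofReal (decay t)))
    (ENNReal.mul_ne_top ENNReal.ofReal_ne_top
      (ENNReal.mul_ne_top (ENNReal.pow_ne_top massConst_lt_top.ne) lintegral_decay_lt_top.ne))
    doubleMass_le_one fun m hm => ?_
  have hm0 : 0 < m := by linarith
  have hφ := phi_pos m
  refine (setLIntegral_pairMass_sq_le hm0).trans ?_
  -- The left side carries an additional factor `m^(-2)`, that is, one more logarithm. It is
  -- discarded, since the pairs sharing an index are bounded with a single logarithm only.
  have e : phi m ^ 3 * tailFactor m ^ 2 / m ^ 9 ≤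
      Real.pi * ((phi m / m) ^ 7 * (m ^ 2) ^ (-1 : ℝ)) := by
    have h3 : √Real.pi ^ 2 = Real.pi := Real.sq_sqrt Real.pi_pos.le
    have h4 : phi m ^ 3 * tailFactor m ^ 2 / m ^ 9 =
        Real.pi * ((phi m / m) ^ 7 * (m ^ 2) ^ (-1 : ℝ)) * (m ^ 2)⁻¹ := by
      rw [tailFactor_eq hm0, rpow_neg_one_sq, div_pow, mul_pow, h3]
      field_simp
    rw [h4]
    refine mul_le_of_le_one_right ?_ (inv_le_one_of_one_le₀ (one_le_pow₀ hm))
    have := Real.pi_pos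
    positivity
  calc _ ≤ ENNReal.ofReal (Real.pi * ((phi m / m) ^ 7 * (m ^ 2) ^ (-1 : ℝ))) *
        (massConst ^ 2 * ∫⁻ t in Set.Ioi (0 : ℝ), ENNReal.ofReal (decay t)) := by gcongr
    _ = _ := by rw [ENNReal.ofReal_mul Real.pi_pos.le]; ring

/-- The three factors of the limit come from the scale (`√π`), from `1 + log (1/u) ~ m^2 / 2` raised
to the power `3/2`, and from the integral of `ratioLimit`. -/
lemma tendsto_tripleMass_div_profile :
    Tendsto (fun m : ℝ => (tripleMass (-m)).toReal / profile 4 (3 / 2) (Phi (-m))) atTop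
      (𝓝 (√Real.pi * (1 / 2) ^ (3 / 2 : ℝ) * (3 / 4))) := by
  have h1 : Tendsto (fun m => (∫⁻ p, ENNReal.ofReal (ratio m p) ∂scaleMeasure).toReal) atTop
      (𝓝 (3 / 4)) := by
    have := tendsto_lintegral_ratio
    rw [lintegral_ratioLimit] at this
    have h := (ENNReal.tendsto_toReal ENNReal.ofReal_ne_top).comp this
    rwa [ENNReal.toReal_ofReal (by norm_num)] at h
  have h2 := tendsto_log_inv_Phi_div.rpow_const (p := (3 / 2 : ℝ)) (Or.inl (by norm_num))
  have h3 : Tendsto (fun m => (mills m ^ 4)⁻¹) atTop (𝓝 1) := by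
    simpa using (tendsto_mills.pow 4).inv₀ (by norm_num)
  have h4 := ((h3.mul h2).const_mul √Real.pi).mul h1
  rw [one_mul] at h4
  refine h4.congr' ?_
  filter_upwards [eventually_gt_atTop 0] with m hm
  have hu := Phi_mem_Ioo (-m)
  have hone := one_le_one_add_log_inv hu
  have hr := mills_pos hm
  have ht := tailFactor_pos hm
  have hφ := phi_pos m
  rw [tripleMass, setLIntegral_pairMass_eq hm, ENNReal.toReal_mul,
    ENNReal.toReal_ofReal (by positivity), tripleScale_eq hm, phi_div_eq hm, profile,
    Real.div_rpow (by linarith) (by positivity), Real.rpow_neg (by positivity),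
    Real.rpow_neg (by linarith)]
  have hp1 := Real.rpow_pos_of_pos (zero_lt_one.trans_le hone) (3 / 2)
  have hp2 : 0 < (m ^ 2) ^ (3 / 2 : ℝ) := by positivity
  have hu0 := hu.1
  generalize (1 + log (Phi (-m))⁻¹) ^ (3 / 2 : ℝ) = a at *
  generalize (m ^ 2) ^ (3 / 2 : ℝ) = b at *
  generalize Phi (-m) = w at *
  field_simp

lemma profile_le_one {k : ℕ} {p u : ℝ} (hp : 0 ≤ p) (hu : u ∈ Set.Ioo (0 : ℝ) 1) :
    profile k p u ≤ 1 := by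
  have h := one_le_one_add_log_inv hu
  exact mul_le_one₀ (pow_le_one₀ hu.1.le hu.2.le) (Real.rpow_nonneg (by linarith) _)
    (Real.rpow_le_one_of_one_le_of_nonpos h (neg_nonpos.2 hp))

lemma integrableOn_one_sub_pow_mul_profile (k i : ℕ) {p : ℝ} (hp : 0 ≤ p) :
    IntegrableOn (fun u : ℝ => (1 - u) ^ i * profile k p u) (Set.Ioo 0 1) := by
  refine Integrable.mono' (integrable_const (1 : ℝ)) (by fun_prop) ?_
  rw [ae_restrict_iff' measurableSet_Ioo]
  refine ae_of_all _ fun u hu => ?_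
  have h1 : 0 ≤ 1 - u := by linarith [hu.2]
  have h2 := (profile_pos (k := k) (p := p) hu).le
  rw [Real.norm_of_nonneg (by positivity)]
  exact mul_le_one₀ (pow_le_one₀ h1 (by linarith [hu.1])) h2 (profile_le_one hp hu)

lemma lintegral_one_sub_Phi_pow_mul_le {i k : ℕ} {p A : ℝ} (hp : 0 ≤ p) (hA : 0 ≤ A)
    {f : ℝ → ℝ≥0∞} (hf : ∀ x, f x ≤ ENNReal.ofReal (A * profile k p (Phi x))) :
    ∫⁻ x, ENNReal.ofReal ((1 - Phi x) ^ i) * f x ∂(gaussianReal 0 1) ≤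
      ENNReal.ofReal (A * ∫ u in Set.Ioo (0 : ℝ) 1, (1 - u) ^ i * profile k p u) := by
  rw [lintegral_gaussianReal_eq_quantile, ← integral_const_mul,
    ofReal_integral_eq_lintegral_ofReal
      ((integrableOn_one_sub_pow_mul_profile k i hp).const_mul A)]
  · refine setLIntegral_mono' measurableSet_Ioo fun u hu => ?_
    have h1 : 0 ≤ 1 - u := by linarith [hu.2]
    have h := hf (quantile u)
    rw [Phi_quantile hu] at h ⊢
    calc _ ≤ ENNReal.ofReal ((1 - u) ^ i) * ENNReal.ofReal (A * profile k p u) := by gcongr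
      _ = _ := by rw [← ENNReal.ofReal_mul (by positivity)]; congr 1; ring
  · rw [EventuallyLE, ae_restrict_iff' measurableSet_Ioo]
    refine ae_of_all _ fun u hu => ?_
    have h1 : 0 ≤ 1 - u := by linarith [hu.2]
    have h2 := (profile_pos (k := k) (p := p) hu).le
    simp only [Pi.zero_apply]
    positivity

lemma eventually_integral_profile_le (k j : ℕ) {p : ℝ} (hp0 : 0 ≤ p) (hp2 : p ≤ 2) :
    ∀ᶠ n : ℕ in atTop, ∫ u in Set.Ioo (0 : ℝ) 1, (1 - u) ^ (n - j) * profile k p u ≤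
      (k ! + 1) / ((n : ℝ) ^ (k + 1) * log n ^ p) := by
  have h := tendsto_integral_one_sub_pow_mul (k := k) (j := j) (p := p) (A := 1) (c := 1) hp0 hp2
    (h := profile k p) (by fun_prop)
    (fun u hu => by rw [abs_of_pos (profile_pos hu), one_mul])
    (by
      refine tendsto_const_nhds.congr' ?_
      filter_upwards [Ioo_mem_nhdsGT (zero_lt_one' ℝ)] with u hu
      rw [div_self (profile_pos hu).ne'])
  have h2 := h.eventually (gt_mem_nhds (by linarith : (1 : ℝ) * k ! < k ! + 1))
  filter_upwards [h2, eventually_gt_atTop 1] with n hn hn1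
  have hn' : (0 : ℝ) < n := Nat.cast_pos.2 (by omega)
  have hlog : 0 < log n := Real.log_pos (by exact_mod_cast hn1)
  rw [le_div_iff₀ (by positivity), mul_comm]
  exact hn.le

lemma eventually_lintegral_le {k j l : ℕ} {p : ℝ} (hp0 : 0 ≤ p) (hp2 : p ≤ 2)
    {f : ℝ → ℝ≥0∞} (hf : ∃ A : ℝ, 0 ≤ A ∧ ∀ x, f x ≤ ENNReal.ofReal (A * profile k p (Phi x))) :
    ∃ c : ℝ, 0 ≤ c ∧ ∀ᶠ n : ℕ in atTop, (n.descFactorial l : ℝ≥0∞) *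
      ∫⁻ x, ENNReal.ofReal ((1 - Phi x) ^ (n - j)) * f x ∂(gaussianReal 0 1) ≤
        ENNReal.ofReal (c * n ^ l / ((n : ℝ) ^ (k + 1) * log n ^ p)) := by
  obtain ⟨A, hA, hfA⟩ := hf
  refine ⟨A * (k ! + 1), by positivity, ?_⟩
  filter_upwards [eventually_integral_profile_le k j hp0 hp2] with n hn
  have h1 : (n.descFactorial l : ℝ≥0∞) ≤ ENNReal.ofReal ((n : ℝ) ^ l) := by
    rw [← ENNReal.ofReal_natCast]
    exact ENNReal.ofReal_le_ofReal (by exact_mod_cast n.descFactorial_le_pow l)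
  calc _ ≤ ENNReal.ofReal ((n : ℝ) ^ l) *
        ENNReal.ofReal (A * ((k ! + 1) / ((n : ℝ) ^ (k + 1) * log n ^ p))) := by
        refine mul_le_mul' h1 ((lintegral_one_sub_Phi_pow_mul_le hp0 hA hfA).trans ?_)
        gcongr
    _ = _ := by
        rw [← ENNReal.ofReal_mul (by positivity)]
        congr 1
        ring

/-! ### Asymptotics of the moments for a normal sample. -/

/-- The expectation of `Phi (√2 * Z₁) * rankSum` has order at most `1 / (n ^ 3 * log n)`. -/
lemma eventually_weighted_le : ∃ c : ℝ, 0 ≤ c ∧ ∀ᶠ n : ℕ in atTop, ∀ hn : 2 ≤ n,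
    ∫⁻ d : Fin n → ℝ, ENNReal.ofReal (Phi (√2 * sorted d ⟨0, by omega⟩)) *
      ENNReal.ofReal (rankSum (sorted d)) ∂(Measure.pi fun _ => gaussianReal 0 1) ≤
      ENNReal.ofReal (c / ((n : ℝ) ^ 3 * log n)) := by
  obtain ⟨c, hc, h⟩ := eventually_lintegral_le (j := 4) (l := 4) zero_le_one one_le_two
    exists_weightedMass_le
  refine ⟨c, hc, ?_⟩
  filter_upwards [h, eventually_gt_atTop 0] with n hn hn0 hn2
  rw [lintegral_rankSum_eq hn2 (c := fun x => ENNReal.ofReal (Phi (√2 * x)))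
    (ENNReal.measurable_ofReal.comp (measurable_Phi.comp (by fun_prop)))]
  refine hn.trans_eq ?_
  have hn' : (0 : ℝ) < n := Nat.cast_pos.2 hn0
  rw [Real.rpow_one]
  congr 1
  field_simp

lemma eventually_rankSum_sq_le : ∃ c : ℝ, 0 ≤ c ∧ ∀ᶠ n : ℕ in atTop,
    ∫⁻ d : Fin n → ℝ, ENNReal.ofReal (rankSum (sorted d)) ^ 2
      ∂(Measure.pi fun _ => gaussianReal 0 1) ≤ ENNReal.ofReal (c / ((n : ℝ) ^ 2 * log n)) := by
  obtain ⟨c₁, hc₁, h₁⟩ := eventually_weighted_le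
  obtain ⟨c₂, hc₂, h₂⟩ := eventually_lintegral_le (j := 6) (l := 6) zero_le_one one_le_two
    exists_doubleMass_le
  refine ⟨4 * c₁ + c₂, by positivity, ?_⟩
  filter_upwards [h₁, h₂, eventually_ge_atTop 2] with n hn₁ hn₂ hn
  have hn' : (0 : ℝ) < n := Nat.cast_pos.2 (by omega)
  have hlog : 0 ≤ log n := Real.log_natCast_nonneg n
  refine (lintegral_rankSum_sq_le hn).trans
    ((add_le_add (mul_le_mul' le_rfl (hn₁ hn)) hn₂).trans ?_)
  have e : (4 * n : ℝ≥0∞) = ENNReal.ofReal (4 * n) := by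
    rw [ENNReal.ofReal_mul (by norm_num), ENNReal.ofReal_natCast]
    norm_num
  rw [e, ← ENNReal.ofReal_mul (by positivity), ← ENNReal.ofReal_add (by positivity) (by positivity),
    Real.rpow_one]
  refine ENNReal.ofReal_le_ofReal (le_of_eq ?_)
  field_simp
  ring

/-- The sharp asymptotics of the expected sum over the remaining pairs. -/
lemma tendsto_lintegral_rankSum :
    Tendsto (fun n : ℕ => (∫⁻ d : Fin n → ℝ, ENNReal.ofReal (rankSum (sorted d))
      ∂(Measure.pi fun _ => gaussianReal 0 1)).toReal * ((n : ℝ) * log n ^ (3 / 2 : ℝ))) atTop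
      (𝓝 (9 * √(Real.pi / 2))) := by
  obtain ⟨A, hA, hfA⟩ := exists_tripleMass_le
  let h : ℝ → ℝ := fun u => (tripleMass (quantile u)).toReal
  have hm : AEStronglyMeasurable h (volume.restrict (Set.Ioo 0 1)) := by
    have hq : AEMeasurable quantile (volume.restrict (Set.Ioo 0 1)) :=
      aemeasurable_restrict_of_monotoneOn measurableSet_Ioo monotoneOn_quantile
    exact (measurable_tripleMass.ennreal_toReal.comp_aemeasurable hq).aestronglyMeasurable
  have hb : ∀ u ∈ Set.Ioo (0 : ℝ) 1, |h u| ≤ A * profile 4 (3 / 2) u := by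
    intro u hu
    have h1 := hfA (quantile u)
    rw [Phi_quantile hu] at h1
    rw [abs_of_nonneg ENNReal.toReal_nonneg]
    exact ENNReal.toReal_le_of_le_ofReal (mul_nonneg hA (profile_pos hu).le) h1
  -- As `u` decreases to zero, `m = -quantile u` tends to infinity, so the limit in `m` becomes a
  -- limit in `u`.
  have hl : Tendsto (fun u => h u / profile 4 (3 / 2) u) (𝓝[>] 0)
      (𝓝 (√Real.pi * (1 / 2) ^ (3 / 2 : ℝ) * (3 / 4))) := by
    have h1 := tendsto_tripleMass_div_profile.comp
      (tendsto_neg_atBot_atTop.comp tendsto_quantile)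
    refine h1.congr' ?_
    filter_upwards [Ioo_mem_nhdsGT (zero_lt_one' ℝ)] with u hu
    simp only [Function.comp, neg_neg, Phi_quantile hu, h]
  have hlim := tendsto_integral_one_sub_pow_mul (j := 4) (by norm_num) (by norm_num) hm hb hl
  have hdesc : Tendsto (fun n : ℕ => (n.descFactorial 4 : ℝ) / (n : ℝ) ^ 4) atTop (𝓝 1) := by
    have h1 := (isEquivalent_iff_tendsto_one ?_).1 (isEquivalent_descFactorial 4)
    · exact h1
    · filter_upwards [eventually_gt_atTop 0] with n hn
      have hn' : (0 : ℝ) < n := Nat.cast_pos.2 hn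
      positivity
  have hprod := hdesc.mul hlim
  -- The constant: `24 · (3/4) = 18`, and `(1/2)^(3/2) = (1/2) √(1/2)` leaves `9 √(π/2)`.
  have hval : 1 * (√Real.pi * (1 / 2) ^ (3 / 2 : ℝ) * (3 / 4) * (4 ! : ℕ)) =
      9 * √(Real.pi / 2) := by
    have e1 : ((1 : ℝ) / 2) ^ (3 / 2 : ℝ) = 1 / 2 * √(1 / 2) := by
      rw [show (3 / 2 : ℝ) = 1 + 1 / 2 by norm_num, Real.rpow_add (by norm_num), Real.rpow_one,
        Real.sqrt_eq_rpow]
    rw [e1, div_eq_mul_one_div Real.pi, Real.sqrt_mul Real.pi_pos.le]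
    norm_num [Nat.factorial]
    ring
  rw [hval] at hprod
  refine hprod.congr' ?_
  filter_upwards [eventually_ge_atTop 2] with n hn
  have hn' : (0 : ℝ) < n := Nat.cast_pos.2 (by omega)
  have h1 := lintegral_rankSum_eq hn (c := fun _ => 1) measurable_const
  simp only [one_mul] at h1
  have h2 : ∫⁻ x, ENNReal.ofReal ((1 - Phi x) ^ (n - 4)) *
      ∫⁻ v in Set.Iio x, pairMass v x ∂(gaussianReal 0 1) ∂(gaussianReal 0 1) =
      ∫⁻ u in Set.Ioo (0 : ℝ) 1, ENNReal.ofReal ((1 - u) ^ (n - 4) * h u) := by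
    rw [lintegral_gaussianReal_eq_quantile]
    refine setLIntegral_congr_fun measurableSet_Ioo fun u hu => ?_
    have hu1 : 0 ≤ 1 - u := by linarith [hu.2]
    simp only [h, Phi_quantile hu]
    rw [ENNReal.ofReal_mul (by positivity), ENNReal.ofReal_toReal
      (ne_top_of_le_ne_top ENNReal.one_ne_top (tripleMass_le_one _))]
    rfl
  have h3 : (∫⁻ u in Set.Ioo (0 : ℝ) 1, ENNReal.ofReal ((1 - u) ^ (n - 4) * h u)).toReal =
      ∫ u in Set.Ioo (0 : ℝ) 1, (1 - u) ^ (n - 4) * h u := by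
    rw [integral_eq_lintegral_of_nonneg_ae]
    · rw [EventuallyLE, ae_restrict_iff' measurableSet_Ioo]
      refine ae_of_all _ fun u hu => ?_
      have hu1 : 0 ≤ 1 - u := by linarith [hu.2]
      exact mul_nonneg (pow_nonneg hu1 _) ENNReal.toReal_nonneg
    · exact AEStronglyMeasurable.mul (by fun_prop) hm
  rw [h1, h2, ENNReal.toReal_mul, h3, ENNReal.toReal_natCast]
  field_simp

/-! ### Two-sided bounds for products of complements. -/

section Products

variable {ι : Type*} {s : Finset ι} {p : ι → ℝ}

lemma prod_one_sub_mem_Icc (h : ∀ i ∈ s, p i ∈ Set.Icc (0 : ℝ) 1) :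
    ∏ i ∈ s, (1 - p i) ∈ Set.Icc (0 : ℝ) 1 :=
  ⟨Finset.prod_nonneg fun i hi => sub_nonneg.2 (h i hi).2,
    Finset.prod_le_one (fun i hi => sub_nonneg.2 (h i hi).2)
      fun i hi => sub_le_self _ (h i hi).1⟩

lemma one_sub_sum_le_prod (h : ∀ i ∈ s, p i ∈ Set.Icc (0 : ℝ) 1) :
    1 - ∑ i ∈ s, p i ≤ ∏ i ∈ s, (1 - p i) := by
  classical
  induction s using Finset.induction_on with
  | empty => simp
  | insert a s ha ih =>
    have h' : ∀ i ∈ s, p i ∈ Set.Icc (0 : ℝ) 1 := fun i hi => h i (Finset.mem_insert_of_mem hi)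
    have h1 := ih h'
    have h2 := (prod_one_sub_mem_Icc h').2
    have h3 := (h a (Finset.mem_insert_self _ _)).1
    rw [Finset.sum_insert ha, Finset.prod_insert ha]
    nlinarith

/-- With `S` the sum, the product is at most `exp (-S) ≤ 1 / (1 + S)`, and `(1 + S) (1 - S + S^2) =
1 + S^3 ≥ 1`. -/
lemma prod_one_sub_le (h : ∀ i ∈ s, p i ∈ Set.Icc (0 : ℝ) 1) :
    ∏ i ∈ s, (1 - p i) ≤ 1 - ∑ i ∈ s, p i + (∑ i ∈ s, p i) ^ 2 := by
  have hS : 0 ≤ ∑ i ∈ s, p i := Finset.sum_nonneg fun i hi => (h i hi).1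
  have h1 : ∏ i ∈ s, (1 - p i) ≤ exp (-∑ i ∈ s, p i) := by
    rw [← Finset.sum_neg_distrib, Real.exp_sum]
    exact Finset.prod_le_prod (fun i hi => sub_nonneg.2 (h i hi).2)
      fun i _ => Real.one_sub_le_exp_neg _
  refine h1.trans ?_
  have h2 := Real.add_one_le_exp (∑ i ∈ s, p i)
  rw [Real.exp_neg, inv_le_comm₀ (Real.exp_pos _) (by nlinarith [sq_nonneg (∑ i ∈ s, p i - 1)])]
  refine le_trans ?_ h2
  rw [inv_le_iff_one_le_mul₀ (by nlinarith [sq_nonneg (∑ i ∈ s, p i - 1)])]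
  nlinarith [pow_nonneg hS 3]

end Products

/-! ### The prefactor and the comparison of `termFn` with `rankSum`. -/

section Prefactor

variable {n : ℕ}

/-- The value of `minPairProb` as a function of the ordered diagonal. -/
noncomputable def minFn (z : Fin n → ℝ) : ℝ :=
  if h : 2 ≤ n then Phi (√2 * z ⟨0, by omega⟩) else 0

/-- The value of `prefactor` as a function of the ordered diagonal. -/
noncomputable def prefFn (z : Fin n → ℝ) : ℝ :=
  (1 - minFn z) ^ (n - 1) * ∏ e ∈ secondPairs n, (1 - rankFn e.1 e.2 z)

lemma minFn_mem_Icc (z : Fin n → ℝ) : minFn z ∈ Set.Icc (0 : ℝ) 1 := by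
  unfold minFn
  split_ifs
  · exact ⟨Phi_nonneg _, Phi_le_one _⟩
  · simp

lemma rankFn_mem_Icc (i j : Fin n) (z : Fin n → ℝ) : rankFn i j z ∈ Set.Icc (0 : ℝ) 1 :=
  ⟨rankFn_nonneg _ _ _, rankFn_le_one _ _ _⟩

lemma measurable_minFn : Measurable (minFn (n := n)) := by
  unfold minFn
  split_ifs
  · exact measurable_Phi.comp (by fun_prop)
  · exact measurable_const

lemma measurable_prod_rankFn (s : Finset (Fin n × Fin n)) :
    Measurable fun z : Fin n → ℝ => ∏ e ∈ s, (1 - rankFn e.1 e.2 z) :=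
  Finset.measurable_prod _ fun _ _ => measurable_const.sub (measurable_rankFn _ _)

lemma measurable_prefFn : Measurable (prefFn (n := n)) :=
  ((measurable_const.sub measurable_minFn).pow_const _).mul (measurable_prod_rankFn _)

lemma prefFn_mem_Icc (z : Fin n → ℝ) : prefFn z ∈ Set.Icc (0 : ℝ) 1 := by
  have h := minFn_mem_Icc z
  have h2 := prod_one_sub_mem_Icc (s := secondPairs n) fun e _ => rankFn_mem_Icc e.1 e.2 z
  have h1 : 0 ≤ (1 - minFn z) ^ (n - 1) := pow_nonneg (sub_nonneg.2 h.2) _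
  exact ⟨mul_nonneg h1 h2.1, mul_le_one₀
    (pow_le_one₀ (sub_nonneg.2 h.2) (sub_le_self _ h.1)) h2.1 h2.2⟩

lemma card_secondPairs_le (n : ℕ) : (secondPairs n).card ≤ n := by
  have h : Set.InjOn Prod.snd (secondPairs n : Set (Fin n × Fin n)) := by
    intro a ha b hb hab
    simp only [secondPairs, Finset.coe_filter, Finset.mem_univ, true_and, Set.mem_ofPred_eq]
      at ha hb
    exact Prod.ext (Fin.ext (ha.1.trans hb.1.symm)) hab
  have := Finset.card_le_card_of_injOn (t := Finset.univ) Prod.snd (fun _ _ => Finset.mem_univ _) h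
  simpa using this

/-- Each of the at most `2 n` factors of the prefactor is at least `1 - q`, where `q = Phi (√2 z 0)`
bounds every pair probability. Bernoulli's inequality for `(1 - q) ^ (2 n)` concludes. -/
lemma one_sub_prefFn_le (hn : 2 ≤ n) (z : Fin n → ℝ) :
    1 - prefFn z ≤ 2 * n * Phi (√2 * z ⟨0, by omega⟩) := by
  have hq : minFn z = Phi (√2 * z ⟨0, by omega⟩) := dif_pos hn
  rw [← hq]
  have h := minFn_mem_Icc z
  have hp : (1 - minFn z) ^ (secondPairs n).card ≤ ∏ e ∈ secondPairs n, (1 - rankFn e.1 e.2 z) := by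
    rw [← Finset.prod_const]
    refine Finset.prod_le_prod (fun _ _ => sub_nonneg.2 h.2) fun e _ => sub_le_sub_left ?_ _
    rw [hq]
    exact pairFn_le_Phi _ _ _
  have hb : 1 - 2 * n * minFn z ≤ (1 - minFn z) ^ (2 * n) := by
    have := one_add_mul_le_pow (a := -minFn z) (by linarith [h.2]) (2 * n)
    push_cast at this
    rw [← sub_eq_add_neg] at this
    linarith
  have hc : (1 - minFn z) ^ (2 * n) ≤ (1 - minFn z) ^ (n - 1 + (secondPairs n).card) :=
    pow_le_pow_of_le_one (sub_nonneg.2 h.2) (sub_le_self _ h.1)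
      (by have := card_secondPairs_le n; omega)
  have hd : (1 - minFn z) ^ (n - 1 + (secondPairs n).card) ≤ prefFn z := by
    rw [pow_add]
    exact mul_le_mul_of_nonneg_left hp (pow_nonneg (sub_nonneg.2 h.2) _)
  linarith

/-- The integrand of `termB` as a function of the ordered diagonal. -/
noncomputable def termFn (z : Fin n → ℝ) : ℝ :=
  prefFn z * (1 - ∏ e ∈ remainingPairs n, (1 - rankFn e.1 e.2 z))

lemma measurable_termFn : Measurable (termFn (n := n)) :=
  measurable_prefFn.mul (measurable_const.sub (measurable_prod_rankFn _))

/-- One minus the product lies between `S - S^2` and `S`; multiplying by `W ∈ [0, 1]` and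
subtracting `S` costs at most `(1 - W) S + S^2`. -/
lemma abs_termFn_sub_rankSum_le (z : Fin n → ℝ) :
    |termFn z - rankSum z| ≤ (1 - prefFn z) * rankSum z + rankSum z ^ 2 := by
  have h : ∀ e ∈ remainingPairs n, rankFn e.1 e.2 z ∈ Set.Icc (0 : ℝ) 1 :=
    fun e _ => rankFn_mem_Icc _ _ _
  have h1 : 1 - rankSum z ≤ _ := one_sub_sum_le_prod h
  have h2 : _ ≤ 1 - rankSum z + rankSum z ^ 2 := prod_one_sub_le h
  have hW := prefFn_mem_Icc z
  have hS := rankSum_nonneg z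
  unfold termFn
  set W := prefFn z
  set S := rankSum z
  set X := ∏ e ∈ remainingPairs n, (1 - rankFn e.1 e.2 z)
  rw [abs_le]
  constructor
  · nlinarith [mul_nonneg hW.1 (sub_nonneg.2 h2), mul_nonneg (sub_nonneg.2 hW.2) (sq_nonneg S)]
  · nlinarith [mul_nonneg hW.1 (sub_nonneg.2 h1), mul_nonneg (sub_nonneg.2 hW.2) hS]

lemma rankSum_le_card (z : Fin n → ℝ) : rankSum z ≤ (remainingPairs n).card := by
  simpa [rankSum] using Finset.sum_le_card_nsmul (remainingPairs n) (fun e => rankFn e.1 e.2 z) 1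
    fun _ _ => rankFn_le_one _ _ _

end Prefactor

/-! ### Transfer from the normal sample to the random matrix. -/

section Transfer

variable {n : ℕ} {Ω : Type*} [MeasurableSpace Ω] {P : Measure Ω} [IsProbabilityMeasure P]
  {Q : Ω → Matrix (Fin n) (Fin n) ℝ}

lemma IsGOE.lintegral_orderedDiag (hQ : IsGOE P Q) {f : (Fin n → ℝ) → ℝ≥0∞} (hf : Measurable f) :
    ∫⁻ ω, f (orderedDiag (Q ω)) ∂P =
      ∫⁻ d, f (sorted d) ∂(Measure.pi fun _ : Fin n => gaussianReal 0 1) := by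
  rw [← hQ.map_diag]
  exact (lintegral_map (hf.comp measurable_sorted) hQ.measurable_diag).symm

lemma IsGOE.pairProb_ae_eq_of_mem (hQ : IsGOE P Q) {s : Finset (Fin n × Fin n)}
    (hs : ∀ e ∈ s, e.1 ≠ e.2) :
    ∀ᵐ ω ∂P, ∀ e ∈ s, pairProb P Q e.1 e.2 ω = rankFn e.1 e.2 (orderedDiag (Q ω)) :=
  (Finset.eventually_all s).2 fun e he => hQ.pairProb_ae_eq (hs e he)

lemma ne_of_mem_remainingPairs {e : Fin n × Fin n} (he : e ∈ remainingPairs n) : e.1 ≠ e.2 := by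
  simp only [remainingPairs, Finset.mem_filter] at he
  exact he.2.2.ne

lemma ne_of_mem_secondPairs {e : Fin n × Fin n} (he : e ∈ secondPairs n) : e.1 ≠ e.2 := by
  simp only [secondPairs, Finset.mem_filter] at he
  intro h
  rw [h] at he
  omega

lemma IsGOE.remainingSum_ae_eq (hQ : IsGOE P Q) :
    remainingSum P Q =ᵐ[P] fun ω => rankSum (orderedDiag (Q ω)) := by
  filter_upwards [hQ.pairProb_ae_eq_of_mem fun _ => ne_of_mem_remainingPairs] with ω h
  exact Finset.sum_congr rfl h

lemma IsGOE.minPairProb_ae_eq (hQ : IsGOE P Q) :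
    minPairProb P Q =ᵐ[P] fun ω => minFn (orderedDiag (Q ω)) := by
  unfold minPairProb minFn
  split_ifs with hn
  · refine (hQ.pairProb_ae_eq (by simp)).trans (ae_of_all _ fun ω => ?_)
    -- When one of the two values is the minimum itself, the square root vanishes and the threshold
    -- is the minimum; this is why the value is common to all `j`.
    simp [rankFn, pairFn]
  · rfl

lemma IsGOE.prefactor_ae_eq (hQ : IsGOE P Q) :
    prefactor P Q =ᵐ[P] fun ω => prefFn (orderedDiag (Q ω)) := by
  filter_upwards [hQ.pairProb_ae_eq_of_mem fun _ => ne_of_mem_secondPairs,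
    hQ.minPairProb_ae_eq] with ω h h'
  rw [prefactor, prefFn, h', Finset.prod_congr rfl fun e he => by rw [h e he]]

lemma IsGOE.termB_eq (hQ : IsGOE P Q) : termB P Q = ∫ ω, termFn (orderedDiag (Q ω)) ∂P := by
  refine integral_congr_ae ?_
  filter_upwards [hQ.pairProb_ae_eq_of_mem fun _ => ne_of_mem_remainingPairs,
    hQ.prefactor_ae_eq] with ω h h'
  rw [termFn, h', Finset.prod_congr rfl fun e he => by rw [h e he]]

lemma IsGOE.integrable_orderedDiag (hQ : IsGOE P Q) {f : (Fin n → ℝ) → ℝ} (hf : Measurable f)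
    {c : ℝ} (hc : ∀ z, |f z| ≤ c) : Integrable (fun ω => f (orderedDiag (Q ω))) P :=
  Integrable.of_bound (hf.comp hQ.measurable_orderedDiag).aestronglyMeasurable c
    (ae_of_all _ fun _ => hc _)

lemma IsGOE.integrable_rankSum (hQ : IsGOE P Q) :
    Integrable (fun ω => rankSum (orderedDiag (Q ω))) P :=
  hQ.integrable_orderedDiag measurable_rankSum fun z => by
    rw [abs_of_nonneg (rankSum_nonneg z)]
    exact rankSum_le_card z

lemma IsGOE.integrable_rankSum_sq (hQ : IsGOE P Q) :
    Integrable (fun ω => rankSum (orderedDiag (Q ω)) ^ 2) P :=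
  hQ.integrable_orderedDiag (measurable_rankSum.pow_const 2) fun z => by
    rw [abs_of_nonneg (by positivity)]
    exact pow_le_pow_left₀ (rankSum_nonneg z) (rankSum_le_card z) 2

lemma IsGOE.integrable_one_sub_prefFn_mul (hQ : IsGOE P Q) :
    Integrable (fun ω => (1 - prefFn (orderedDiag (Q ω))) * rankSum (orderedDiag (Q ω))) P :=
  hQ.integrable_orderedDiag (f := fun z => (1 - prefFn z) * rankSum z)
    ((measurable_const.sub measurable_prefFn).mul measurable_rankSum) fun z => by
    have h := prefFn_mem_Icc z
    have hS := rankSum_nonneg z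
    rw [abs_of_nonneg (mul_nonneg (sub_nonneg.2 h.2) hS)]
    exact (mul_le_of_le_one_left hS (sub_le_self _ h.1)).trans (rankSum_le_card z)

lemma IsGOE.integrable_termFn (hQ : IsGOE P Q) :
    Integrable (fun ω => termFn (orderedDiag (Q ω))) P :=
  hQ.integrable_orderedDiag measurable_termFn (c := 1) fun z => by
    have h := prefFn_mem_Icc z
    have h2 := prod_one_sub_mem_Icc (s := remainingPairs n) fun e _ => rankFn_mem_Icc e.1 e.2 z
    rw [termFn, abs_of_nonneg (mul_nonneg h.1 (sub_nonneg.2 h2.2))]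
    exact mul_le_one₀ h.2 (sub_nonneg.2 h2.2) (sub_le_self _ h2.1)

lemma IsGOE.integral_remainingSum (hQ : IsGOE P Q) : ∫ ω, remainingSum P Q ω ∂P =
    (∫⁻ d, ENNReal.ofReal (rankSum (sorted d))
      ∂(Measure.pi fun _ : Fin n => gaussianReal 0 1)).toReal := by
  rw [integral_congr_ae hQ.remainingSum_ae_eq, integral_eq_lintegral_of_nonneg_ae
    (ae_of_all _ fun _ => rankSum_nonneg _) hQ.integrable_rankSum.aestronglyMeasurable,
    hQ.lintegral_orderedDiag (f := fun z => ENNReal.ofReal (rankSum z))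
      measurable_rankSum.ennreal_ofReal]

lemma IsGOE.integral_rankSum_sq_le (hQ : IsGOE P Q) {c : ℝ} (hc : 0 ≤ c)
    (h : ∫⁻ d, ENNReal.ofReal (rankSum (sorted d)) ^ 2
      ∂(Measure.pi fun _ : Fin n => gaussianReal 0 1) ≤ ENNReal.ofReal c) :
    ∫ ω, rankSum (orderedDiag (Q ω)) ^ 2 ∂P ≤ c := by
  rw [integral_eq_lintegral_of_nonneg_ae (ae_of_all _ fun _ => sq_nonneg _)
    hQ.integrable_rankSum_sq.aestronglyMeasurable]
  simp_rw [ENNReal.ofReal_pow (rankSum_nonneg _)]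
  rw [hQ.lintegral_orderedDiag (f := fun z => ENNReal.ofReal (rankSum z) ^ 2)
      (measurable_rankSum.ennreal_ofReal.pow_const 2)]
  exact ENNReal.toReal_le_of_le_ofReal hc h

lemma IsGOE.integral_one_sub_prefFn_mul_le (hQ : IsGOE P Q) (hn : 2 ≤ n) {c : ℝ} (hc : 0 ≤ c)
    (h : ∫⁻ d : Fin n → ℝ, ENNReal.ofReal (Phi (√2 * sorted d ⟨0, by omega⟩)) *
      ENNReal.ofReal (rankSum (sorted d))
      ∂(Measure.pi fun _ : Fin n => gaussianReal 0 1) ≤ ENNReal.ofReal c) :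
    ∫ ω, (1 - prefFn (orderedDiag (Q ω))) * rankSum (orderedDiag (Q ω)) ∂P ≤ 2 * n * c := by
  rw [integral_eq_lintegral_of_nonneg_ae (ae_of_all _ fun _ =>
    mul_nonneg (sub_nonneg.2 (prefFn_mem_Icc _).2) (rankSum_nonneg _))
    hQ.integrable_one_sub_prefFn_mul.aestronglyMeasurable]
  refine ENNReal.toReal_le_of_le_ofReal (by positivity) ?_
  have hm : Measurable fun z : Fin n → ℝ =>
      ENNReal.ofReal (Phi (√2 * z ⟨0, by omega⟩)) * ENNReal.ofReal (rankSum z) :=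
    (measurable_Phi.comp (by fun_prop)).ennreal_ofReal.mul measurable_rankSum.ennreal_ofReal
  calc _ ≤ ∫⁻ ω, ENNReal.ofReal (2 * n) *
        (ENNReal.ofReal (Phi (√2 * orderedDiag (Q ω) ⟨0, by omega⟩)) *
          ENNReal.ofReal (rankSum (orderedDiag (Q ω)))) ∂P := by
        refine lintegral_mono fun ω => ?_
        rw [← ENNReal.ofReal_mul (Phi_nonneg _), ← ENNReal.ofReal_mul (by positivity), ← mul_assoc]
        exact ENNReal.ofReal_le_ofReal
          (mul_le_mul_of_nonneg_right (one_sub_prefFn_le hn _) (rankSum_nonneg _))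
    _ = ENNReal.ofReal (2 * n) * ∫⁻ d : Fin n → ℝ,
        ENNReal.ofReal (Phi (√2 * sorted d ⟨0, by omega⟩)) * ENNReal.ofReal (rankSum (sorted d))
        ∂(Measure.pi fun _ : Fin n => gaussianReal 0 1) :=
      (lintegral_const_mul _ (hm.comp hQ.measurable_orderedDiag)).trans
        (congrArg _ (hQ.lintegral_orderedDiag hm))
    _ ≤ ENNReal.ofReal (2 * n * c) := by
        rw [ENNReal.ofReal_mul (p := 2 * n) (by positivity)]
        exact mul_le_mul' le_rfl h

lemma IsGOE.abs_termB_sub_le (hQ : IsGOE P Q) :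
    |termB P Q - ∫ ω, remainingSum P Q ω ∂P| ≤
      ∫ ω, (1 - prefFn (orderedDiag (Q ω))) * rankSum (orderedDiag (Q ω)) ∂P +
        ∫ ω, rankSum (orderedDiag (Q ω)) ^ 2 ∂P := by
  rw [hQ.termB_eq, integral_congr_ae hQ.remainingSum_ae_eq,
    ← integral_sub hQ.integrable_termFn hQ.integrable_rankSum,
    ← integral_add hQ.integrable_one_sub_prefFn_mul hQ.integrable_rankSum_sq]
  exact (abs_integral_le_integral_abs).trans (integral_mono
    (hQ.integrable_termFn.sub hQ.integrable_rankSum).abs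
    (hQ.integrable_one_sub_prefFn_mul.add hQ.integrable_rankSum_sq)
    fun ω => abs_termFn_sub_rankSum_le _)

lemma IsGOE.remainingSum_sq_ae_eq (hQ : IsGOE P Q) :
    (fun ω => remainingSum P Q ω ^ 2) =ᵐ[P] fun ω => rankSum (orderedDiag (Q ω)) ^ 2 := by
  filter_upwards [hQ.remainingSum_ae_eq] with ω h
  rw [h]

lemma IsGOE.one_sub_prefactor_mul_ae_eq (hQ : IsGOE P Q) :
    (fun ω => (1 - prefactor P Q ω) * remainingSum P Q ω) =ᵐ[P]
      fun ω => (1 - prefFn (orderedDiag (Q ω))) * rankSum (orderedDiag (Q ω)) := by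
  filter_upwards [hQ.remainingSum_ae_eq, hQ.prefactor_ae_eq] with ω h h'
  rw [h, h']

end Transfer

/-! ### Conclusion: assembling the four asymptotic statements. -/

lemma tendsto_log_rpow_half_div :
    Tendsto (fun n : ℕ => log n ^ (1 / 2 : ℝ) / n) atTop (𝓝 0) := by
  have h := (isLittleO_log_rpow_rpow_atTop (1 / 2 : ℝ) (zero_lt_one' ℝ)).tendsto_div_nhds_zero
  simp only [Real.rpow_one] at h
  exact h.comp tendsto_natCast_atTop_atTop

end RandomStQP

open RandomStQP in
theorem mainTheorem3 (Ω : ℕ → Type*) [∀ n, MeasurableSpace (Ω n)]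
    (P : ∀ n, Measure (Ω n)) [∀ n, IsProbabilityMeasure (P n)]
    (Q : ∀ n, Ω n → Matrix (Fin n) (Fin n) ℝ)
    (hQ : ∀ n, RandomStQP.IsGOE (P n) (Q n)) :
    -- `Bₙ = (9 √(π/2) + o(1)) / (n (log n)^{3/2})`
    Tendsto
        (fun n : ℕ => RandomStQP.termB (P n) (Q n) * ((n : ℝ) * Real.log n ^ (3 / 2 : ℝ)))
        atTop (𝓝 (9 * √(Real.pi / 2))) ∧
    -- `E S₃ₙ = (9 √(π/2) + o(1)) / (n (log n)^{3/2})`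
    Tendsto
        (fun n : ℕ => (∫ ω, RandomStQP.remainingSum (P n) (Q n) ω ∂(P n)) *
          ((n : ℝ) * Real.log n ^ (3 / 2 : ℝ)))
        atTop (𝓝 (9 * √(Real.pi / 2))) ∧
    -- `E S₃ₙ² = O(1 / (n² log n))`
    ((∀ n, Integrable (fun ω => RandomStQP.remainingSum (P n) (Q n) ω ^ 2) (P n)) ∧
      (fun n : ℕ => ∫ ω, RandomStQP.remainingSum (P n) (Q n) ω ^ 2 ∂(P n))
        =O[atTop] fun n : ℕ => 1 / ((n : ℝ) ^ 2 * Real.log n)) ∧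
    -- `E[(1 - Wₙ) S₃ₙ] = O(1 / (n² log n))`
    ((∀ n, Integrable (fun ω => (1 - RandomStQP.prefactor (P n) (Q n) ω) *
        RandomStQP.remainingSum (P n) (Q n) ω) (P n)) ∧
      (fun n : ℕ => ∫ ω, (1 - RandomStQP.prefactor (P n) (Q n) ω) *
          RandomStQP.remainingSum (P n) (Q n) ω ∂(P n))
        =O[atTop] fun n : ℕ => 1 / ((n : ℝ) ^ 2 * Real.log n)) := by
  obtain ⟨c₁, hc₁, h₁⟩ := eventually_weighted_le
  obtain ⟨c₂, hc₂, h₂⟩ := eventually_rankSum_sq_le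
  have hlog : ∀ n : ℕ, 0 ≤ Real.log n := Real.log_natCast_nonneg
  have hsq : ∀ᶠ n : ℕ in atTop, ∫ ω, rankSum (orderedDiag (Q n ω)) ^ 2 ∂(P n) ≤
      c₂ / ((n : ℝ) ^ 2 * Real.log n) := by
    filter_upwards [h₂] with n hn
    exact (hQ n).integral_rankSum_sq_le
      (div_nonneg hc₂ (mul_nonneg (by positivity) (hlog n))) hn
  have hw : ∀ᶠ n : ℕ in atTop, ∫ ω, (1 - prefFn (orderedDiag (Q n ω))) *
      rankSum (orderedDiag (Q n ω)) ∂(P n) ≤ 2 * c₁ / ((n : ℝ) ^ 2 * Real.log n) := by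
    filter_upwards [h₁, eventually_ge_atTop 2] with n hn hn2
    refine ((hQ n).integral_one_sub_prefFn_mul_le hn2
      (div_nonneg hc₁ (mul_nonneg (by positivity) (hlog n))) (hn hn2)).trans (le_of_eq ?_)
    have h0 : (n : ℝ) ≠ 0 := Nat.cast_ne_zero.2 (by omega)
    field_simp
  have hS : Tendsto (fun n : ℕ => (∫ ω, remainingSum (P n) (Q n) ω ∂(P n)) *
      ((n : ℝ) * Real.log n ^ (3 / 2 : ℝ))) atTop (𝓝 (9 * √(Real.pi / 2))) := by
    simp_rw [(hQ _).integral_remainingSum]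
    exact tendsto_lintegral_rankSum
  refine ⟨?_, hS, ⟨fun n => ?_, ?_⟩, ⟨fun n => ?_, ?_⟩⟩
  -- The difference is `O(1 / (n^2 log n))`; after multiplication by `n (log n)^(3/2)` it is `O((log
  -- n)^(1/2) / n)`, which tends to zero.
  · have hd : Tendsto (fun n : ℕ => (termB (P n) (Q n) - ∫ ω, remainingSum (P n) (Q n) ω ∂(P n)) *
        ((n : ℝ) * Real.log n ^ (3 / 2 : ℝ))) atTop (𝓝 0) := by
      refine squeeze_zero_norm' ?_
        (by simpa using tendsto_log_rpow_half_div.const_mul (2 * c₁ + c₂))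
      filter_upwards [hsq, hw, eventually_ge_atTop 2] with n hn₂ hn₁ hn
      have hn0 : (0 : ℝ) < n := Nat.cast_pos.2 (by omega)
      have hl : 0 < Real.log n := Real.log_pos (by exact_mod_cast hn)
      have hL : Real.log n ^ (3 / 2 : ℝ) = Real.log n * Real.log n ^ (1 / 2 : ℝ) := by
        rw [← Real.rpow_one_add' hl.le (by norm_num)]
        norm_num
      rw [norm_mul, Real.norm_eq_abs, Real.norm_of_nonneg (by positivity)]
      calc _ ≤ (2 * c₁ / ((n : ℝ) ^ 2 * Real.log n) + c₂ / ((n : ℝ) ^ 2 * Real.log n)) *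
            ((n : ℝ) * Real.log n ^ (3 / 2 : ℝ)) :=
            mul_le_mul_of_nonneg_right ((hQ n).abs_termB_sub_le.trans (add_le_add hn₁ hn₂))
              (by positivity)
        _ = _ := by
            rw [hL]
            field_simp
    have := hd.add hS
    rw [zero_add] at this
    refine this.congr fun n => ?_
    ring
  · exact (hQ n).integrable_rankSum_sq.congr (hQ n).remainingSum_sq_ae_eq.symm
  · refine IsBigO.of_bound c₂ ?_
    filter_upwards [hsq] with n hn
    rw [integral_congr_ae (hQ n).remainingSum_sq_ae_eq,
      Real.norm_of_nonneg (integral_nonneg fun _ => sq_nonneg _),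
      Real.norm_of_nonneg (div_nonneg zero_le_one (mul_nonneg (by positivity) (hlog n))),
      mul_one_div]
    exact hn
  · exact (hQ n).integrable_one_sub_prefFn_mul.congr (hQ n).one_sub_prefactor_mul_ae_eq.symm
  · refine IsBigO.of_bound (2 * c₁) ?_
    filter_upwards [hw] with n hn
    rw [integral_congr_ae (hQ n).one_sub_prefactor_mul_ae_eq,
      Real.norm_of_nonneg (integral_nonneg fun _ =>
        mul_nonneg (sub_nonneg.2 (prefFn_mem_Icc _).2) (rankSum_nonneg _)),
      Real.norm_of_nonneg (div_nonneg zero_le_one (mul_nonneg (by positivity) (hlog n))),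
      mul_one_div]
    exact hn
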